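/- Let $m,n\ge 1$ be integers. Let $U$ be an $n\times n$ CUE random matrix and $U^{(m)}$ an $mn\times mn$ CUE random matrix; that is, each is distributed according to the Haar probability measure on the corresponding unitary group. Let $\theta_1,\dots,\theta_n\in[-\pi,\pi)$ and $\phi_1,\dots,\phi_{mn}\in[-\pi,\pi)$ be their eigenangles, listed with multiplicity, so that the eigenvalues of $U$ and $U^{(m)}$ are $e^{i\theta_j}$ and $e^{i\phi_j}$ respectively. For $A\subseteq[-\pi,\pi)$ put $$\mathcal N_A=\#\{j:\theta_j\in A\},\qquad \mathcal N_A^{(m)}=\#\Bigl\{j:\phi_j\in\Bigl[-\frac{\pi}{m},\frac{\pi}{m}\Bigr),\ m\phi_j\in A\Bigr\}.$$ If $A\subseteq[-\pi,\pi)$ is Lebesgue measurable with diameter $\operatorname{diam}A\le\pi$, then $$d_{TV}\bigl(\mathcal N_A,\mathcal N_A^{(m)}\bigr)\le W_1\bigl(\mathcal N_A,\mathcal N_A^{(m)}\bigr)\le\frac{\sqrt{mn}\,|A|\operatorname{diam}A}{6\pi},$$ where $|A|$ is the Lebesgue measure of $A$. Here, for integer-valued random variables $X$ and $Y$, the total variation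 distance is $d_{TV}(X,Y)=\sup_{S\subseteq\mathbb Z}|\mathbb P[X\in S]-\mathbb P[Y\in S]|$, and the $L^1$-Wasserstein distance is $W_1(X,Y)=\inf\mathbb E|Z_1-Z_2|$, where the infimum is over all random vectors $(Z_1,Z_2)$ such that $Z_1$ has the distribution of $X$ and $Z_2$ has the distribution of $Y$. -/

import Mathlib

open MeasureTheory ProbabilityTheory
open scoped ENNReal

noncomputable section

/-! ### Haar measure on the unitary group -/

/-- The Borel σ-algebra on the group of `N × N` unitary matrices. -/
instance unitaryMeasurableSpace (N : ℕ) : MeasurableSpace (Matrix.unitaryGroup (Fin N) ℂ) :=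
  borel _

instance unitaryBorelSpace (N : ℕ) : BorelSpace (Matrix.unitaryGroup (Fin N) ℂ) := ⟨rfl⟩

/-- The unitary group is compact. -/
instance unitaryCompactSpace (N : ℕ) : CompactSpace (Matrix.unitaryGroup (Fin N) ℂ) := by
  apply isCompact_iff_compactSpace.mp
  have hK : IsCompact (Set.univ.pi fun _ : Fin N => Set.univ.pi fun _ : Fin N =>
      Metric.closedBall (0 : ℂ) 1) :=
    isCompact_univ_pi fun _ => isCompact_univ_pi fun _ => isCompact_closedBall _ _
  have hc : IsClosed ((Matrix.unitaryGroup (Fin N) ℂ : Set (Matrix (Fin N) (Fin N) ℂ))) :=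
    isClosed_unitary
  refine hK.of_isClosed_subset hc ?_
  intro U hU i _ j _
  simpa using entry_norm_bound_of_unitary hU i j

/-- The law of an `N × N` CUE matrix: Haar measure on the compact group of `N × N` unitary
matrices, normalized to have total mass one. -/
def cueMeasure (N : ℕ) : Measure (Matrix.unitaryGroup (Fin N) ℂ) :=
  Measure.haarMeasure ⊤

instance cueMeasure_isProbabilityMeasure (N : ℕ) : IsProbabilityMeasure (cueMeasure N) :=
  ⟨by
    have h := Measure.haarMeasure_self
      (K₀ := (⊤ : TopologicalSpace.PositiveCompacts (Matrix.unitaryGroup (Fin N) ℂ)))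
    rwa [TopologicalSpace.PositiveCompacts.coe_top] at h⟩

/-! ### Eigenangles and their counts -/

/-- The argument of a complex number, taken in `[-π, π)`. (`Complex.arg` takes values in
`(-π, π]`.) -/
def principalAngle (z : ℂ) : ℝ := if z.arg = Real.pi then -Real.pi else z.arg

/-- The eigenangles in `[-π, π)` of a unitary matrix, counted with multiplicity. -/
def eigenangles {N : ℕ} (U : Matrix.unitaryGroup (Fin N) ℂ) : Multiset ℝ :=
  (U : Matrix (Fin N) (Fin N) ℂ).charpoly.roots.map principalAngle

open Classical in
/-- The number of eigenangles of `U` that lie in `A`. -/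
def eigenangleCount {N : ℕ} (A : Set ℝ) (U : Matrix.unitaryGroup (Fin N) ℂ) : ℕ :=
  (eigenangles U).countP (fun θ => θ ∈ A)

open Classical in
/-- The number of eigenangles `φ` of `U` with `φ ∈ [-π/m, π/m)` and `m φ ∈ A`. -/
def rescaledEigenangleCount {N : ℕ} (m : ℕ) (A : Set ℝ) (U : Matrix.unitaryGroup (Fin N) ℂ) : ℕ :=
  (eigenangles U).countP
    (fun φ => φ ∈ Set.Ico (-(Real.pi / m)) (Real.pi / m) ∧ (m : ℝ) * φ ∈ A)

/-! ### Distances between integer-valued random variables -/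

/-- Total variation distance between integer-valued random variables `X` (on `(Ω, P)`) and
`Y` (on `(Ω', Q)`): the supremum over `S ⊆ ℤ` of `|P[X ∈ S] - Q[Y ∈ S]|`. -/
def tvDist {Ω Ω' : Type*} [MeasurableSpace Ω] [MeasurableSpace Ω']
    (P : Measure Ω) (Q : Measure Ω') (X : Ω → ℤ) (Y : Ω' → ℤ) : ℝ :=
  ⨆ S : Set ℤ, |P.real (X ⁻¹' S) - Q.real (Y ⁻¹' S)|

/-- `L¹`-Wasserstein distance between integer-valued random variables `X` (on `(Ω, P)`) and
`Y` (on `(Ω', Q)`): the infimum of `E|Z₁ - Z₂|` over all couplings `(Z₁, Z₂)` of `X` and `Y`,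
where a coupling is given by its joint law `γ` on `ℤ × ℤ`. It is `∞` if there is no coupling. -/
def wasserstein1 {Ω Ω' : Type*} [MeasurableSpace Ω] [MeasurableSpace Ω']
    (P : Measure Ω) (Q : Measure Ω') (X : Ω → ℤ) (Y : Ω' → ℤ) : ℝ≥0∞ :=
  ⨅ (γ : Measure (ℤ × ℤ)) (_ : IdentDistrib (fun z : ℤ × ℤ => z.1) X γ P)
    (_ : IdentDistrib (fun z : ℤ × ℤ => z.2) Y γ Q),
    ∫⁻ z, ENNReal.ofReal |(z.1 : ℝ) - (z.2 : ℝ)| ∂γ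

end

/-! For a CUE matrix the generating function of a count is a determinant: `𝔼 (1 + t) ^ N = det (1 +
t G)`, where `G` is the Gram matrix on `A` of finitely many exponentials. `G` is Hermitian, so the
determinant factors as `∏ (1 + t p_i)` with `p_i` its eigenvalues, and the count has the law of a
sum of independent Bernoulli variables with parameters `p_i`. Two such sums driven by the same
uniform variables differ in mean by at most `∑ |p_i - q_i|`.

To compare the two spectra, both Gram matrices are realised, up to zero eigenvalues, as Hermitian
matrices `S`, `T` of the common size `n + m n` (`exists_isHermitian_of_gramMatrix`). The
Hoffman–Wielandt inequality and Cauchy–Schwarz bound the sum by the square root of `(n + m n) tr (S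
- T)²`. That trace is the integral over `A × A` of the squared difference of the two kernels `sin (n
u) / (2 π sin u)` and `sin (n u) / (2 π m sin (u / m))`, with `u = (x - y) / 2`. Since `sin u ≤ m
sin (u / m) ≤ u` and `1 / sin u - 1 / u ≤ u / 3` on `(0, π / 2]`, the difference is at most `|x - y|
/ (12 π)` (`norm_sum_wave_sub_sum_wave_le`). The total variation bound holds because distinct
integers are at distance at least one.

The determinantal formula is an instance of the Heine–Szegő identity: the mean of `∏ f(eigenvalue)`
is the Toeplitz determinant of `f`. It is derived from the invariance of Haar measure alone, with no
eigenvalue density. Translation by unitaries that differ from the identity by rank one gives two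
differential equations for the polynomial `Ψ = 𝔼 [det U ^ (-r) ∏ det (X_a - U)]` in `2 r` variables.
After multiplication by the Vandermonde polynomial they fix the sum and the sum of squares of the
exponents of every monomial. Antisymmetry and a degree bound then leave one alternant up to a scalar
(`exists_alternant_mul_charpolyMoment_eq`). The Toeplitz determinant times the Vandermonde is, up to
sign, the same alternant, and the scalar is found at one special point. This settles Laurent
polynomials; limits extend the identity to continuous functions and then to indicators. -/

noncomputable section

/-! ### Resolvents, characteristic polynomials and rank-one perturbations. -/

section MatrixResolvent

open Matrix Polynomial

variable {ι : Type*} [Fintype ι] [DecidableEq ι]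

theorem charpoly_eval_eq_det (A : Matrix ι ι ℂ) (x : ℂ) :
    A.charpoly.eval x = (x • (1 : Matrix ι ι ℂ) - A).det := by
  rw [charpoly, ← coe_evalRingHom, RingHom.map_det]
  congr 1
  ext i j
  by_cases h : i = j
  · subst h; simp
  · simp [h]

/-- With `R` the resolvent at `x`, `det (x + t - A) = det (x - A) det (1 + t R)`, and the second
factor has derivative `tr R` at `t = 0`. -/
theorem charpoly_derivative_eval (A : Matrix ι ι ℂ) (x : ℂ)
    (hx : (x • (1 : Matrix ι ι ℂ) - A).det ≠ 0) :
    A.charpoly.derivative.eval x =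
      A.charpoly.eval x * (x • (1 : Matrix ι ι ℂ) - A)⁻¹.trace := by
  set R := (x • (1 : Matrix ι ι ℂ) - A)⁻¹ with hR
  have key : A.charpoly.comp (X + C x) =
      C ((x • (1 : Matrix ι ι ℂ) - A).det) * det (1 + (X : ℂ[X]) • R.map C) := by
    refine Polynomial.funext fun t => ?_
    rw [eval_comp, charpoly_eval_eq_det, eval_mul, eval_C]
    have h0 : eval t (det (1 + (X : ℂ[X]) • R.map C)) =
        ((evalRingHom t).mapMatrix (1 + (X : ℂ[X]) • R.map C)).det := by
      rw [← RingHom.map_det, coe_evalRingHom]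
    rw [h0, ← det_mul]
    congr 1
    have h1 : (evalRingHom t).mapMatrix (1 + (X : ℂ[X]) • R.map C) = 1 + t • R := by
      ext i j
      by_cases h : i = j
      · subst h; simp; ring
      · simp [h]; ring
    rw [h1, mul_add, mul_one, mul_smul_comm, hR, mul_nonsing_inv _ (isUnit_iff_ne_zero.mpr hx)]
    simp [add_smul]
    abel
  have h2 := congrArg (fun p => p.derivative.eval 0) key
  simp only [derivative_comp, derivative_mul, derivative_C, zero_mul, zero_add, eval_mul, eval_C,
    derivative_det_one_add_X_smul] at h2
  rw [charpoly_eval_eq_det, ← h2]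
  simp

/-- The operator `A (x - A)⁻¹`. -/
def mulResolvent (A : Matrix ι ι ℂ) (x : ℂ) : Matrix ι ι ℂ :=
  A * (x • (1 : Matrix ι ι ℂ) - A)⁻¹

theorem mulResolvent_eq (A : Matrix ι ι ℂ) (x : ℂ)
    (hx : (x • (1 : Matrix ι ι ℂ) - A).det ≠ 0) :
    mulResolvent A x = x • (x • (1 : Matrix ι ι ℂ) - A)⁻¹ - 1 := by
  have h := mul_nonsing_inv _ (isUnit_iff_ne_zero.mpr hx)
  rw [sub_mul, smul_mul_assoc, one_mul] at h
  rw [mulResolvent, eq_sub_iff_add_eq, ← eq_sub_iff_add_eq', h]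

theorem mul_charpoly_derivative_eval (A : Matrix ι ι ℂ) (x : ℂ)
    (hx : (x • (1 : Matrix ι ι ℂ) - A).det ≠ 0) :
    x * A.charpoly.derivative.eval x =
      A.charpoly.eval x * (Fintype.card ι + (mulResolvent A x).trace) := by
  rw [mulResolvent_eq A x hx, charpoly_derivative_eval A x hx]
  simp only [trace_sub, trace_smul, trace_one, smul_eq_mul]
  ring

theorem mulResolvent_mul_mulResolvent (A : Matrix ι ι ℂ) (x y : ℂ)
    (hx : (x • (1 : Matrix ι ι ℂ) - A).det ≠ 0) (hy : (y • (1 : Matrix ι ι ℂ) - A).det ≠ 0) :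
    (y - x) • (mulResolvent A x * mulResolvent A y) =
      x • mulResolvent A x - y • mulResolvent A y := by
  have hRx := nonsing_inv_mul _ (isUnit_iff_ne_zero.mpr hx)
  have hRy := mul_nonsing_inv _ (isUnit_iff_ne_zero.mpr hy)
  rw [mulResolvent_eq A x hx, mulResolvent_eq A y hy]
  set R := (x • (1 : Matrix ι ι ℂ) - A)⁻¹
  set S := (y • (1 : Matrix ι ι ℂ) - A)⁻¹
  have hres : (y - x) • (R * S) = R - S := by
    have h1 : R * ((y • (1 : Matrix ι ι ℂ) - A) - (x • (1 : Matrix ι ι ℂ) - A)) * S = R - S := by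
      rw [mul_sub, sub_mul, mul_assoc, hRy, hRx, mul_one, one_mul]
    rw [← h1, sub_sub_sub_cancel_right, ← sub_smul]
    simp
  have h3 : (x • R - 1) * (y • S - 1) = (x * y) • (R * S) - x • R - y • S + 1 := by
    rw [sub_mul, mul_sub, smul_mul_smul_comm]
    simp only [mul_one, one_mul]
    abel
  rw [h3, smul_add, smul_sub, smul_sub, smul_comm, hres]
  module

/-- Consequence of the resolvent identity. It reduces traces of products to single traces, which
turns the second loop equation into a closed differential equation. -/
theorem trace_mulResolvent_mul (A : Matrix ι ι ℂ) (x y : ℂ) (hxy : x ≠ y)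
    (hx : (x • (1 : Matrix ι ι ℂ) - A).det ≠ 0) (hy : (y • (1 : Matrix ι ι ℂ) - A).det ≠ 0) :
    (mulResolvent A x * mulResolvent A y).trace =
      (x * (mulResolvent A x).trace - y * (mulResolvent A y).trace) / (y - x) := by
  have h := congrArg trace (mulResolvent_mul_mulResolvent A x y hx hy)
  simp only [trace_smul, trace_sub, smul_eq_mul] at h
  rw [eq_div_iff (sub_ne_zero.mpr hxy.symm), ← h, mul_comm]

/-- Factoring `x - A` out on the right leaves the identity minus a rank-one matrix, whose
determinant is a scalar. -/
theorem det_smul_one_sub_rankOne_mul (A : Matrix ι ι ℂ) (x c : ℂ) (v : ι → ℂ)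
    (hx : (x • (1 : Matrix ι ι ℂ) - A).det ≠ 0) :
    (x • (1 : Matrix ι ι ℂ) - (1 + c • vecMulVec v (star v)) * A).det =
      A.charpoly.eval x * (1 - c * (star v ⬝ᵥ (mulResolvent A x *ᵥ v))) := by
  have h : x • (1 : Matrix ι ι ℂ) - (1 + c • vecMulVec v (star v)) * A =
      (1 - c • (vecMulVec v (star v) * mulResolvent A x)) * (x • (1 : Matrix ι ι ℂ) - A) := by
    rw [mulResolvent, sub_mul, add_mul, smul_mul_assoc, smul_mul_assoc, mul_assoc, mul_assoc,
      nonsing_inv_mul _ (isUnit_iff_ne_zero.mpr hx)]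
    simp
    abel
  have h2 : (1 - c • (vecMulVec v (star v) * mulResolvent A x)).det =
      1 - c * (star v ⬝ᵥ (mulResolvent A x *ᵥ v)) := by
    rw [vecMulVec_eq Unit, Matrix.mul_assoc, ← Matrix.mul_smul, det_one_sub_mul_comm, det_unique]
    simp [Matrix.mul_apply, dotProduct, mulVec, Finset.mul_sum, Finset.sum_mul]
    rw [Finset.sum_comm]
    refine Finset.sum_congr rfl fun i _ => Finset.sum_congr rfl fun j _ => ?_
    ring
  rw [h, det_mul, h2, charpoly_eval_eq_det, mul_comm]

theorem det_one_add_smul_vecMulVec (c : ℂ) (v : ι → ℂ) :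
    (1 + c • vecMulVec v (star v)).det = 1 + c * (star v ⬝ᵥ v) := by
  rw [vecMulVec_eq Unit, ← Matrix.mul_smul, det_one_add_mul_comm, det_unique]
  simp [Matrix.mul_apply, dotProduct, Finset.mul_sum]

end MatrixResolvent

/-! ### Haar invariance under rank-one unitary translations. -/

section HaarLoop

open Matrix Polynomial
open scoped ComplexOrder

variable {n : ℕ} {κ : Type*} [Fintype κ]

theorem unitary_dotProduct_mulVec (U : unitaryGroup (Fin n) ℂ) (v w : Fin n → ℂ) :
    star ((U : Matrix (Fin n) (Fin n) ℂ) *ᵥ v) ⬝ᵥ ((U : Matrix (Fin n) (Fin n) ℂ) *ᵥ w) =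
      star v ⬝ᵥ w := by
  have h : (U : Matrix (Fin n) (Fin n) ℂ)ᴴ * (U : Matrix (Fin n) (Fin n) ℂ) = 1 :=
    (mem_unitaryGroup_iff'.mp U.2)
  rw [star_mulVec, dotProduct_mulVec, vecMul_vecMul, h, vecMul_one]

theorem norm_eq_one_of_det_eq_zero (U : unitaryGroup (Fin n) ℂ) {x : ℂ}
    (hx : (x • (1 : Matrix (Fin n) (Fin n) ℂ) - U).det = 0) : ‖x‖ = 1 := by
  obtain ⟨v, hv, h⟩ := exists_mulVec_eq_zero_iff.mpr hx
  rw [sub_mulVec, smul_mulVec, one_mulVec, sub_eq_zero] at h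
  have h2 := unitary_dotProduct_mulVec U v v
  rw [← h, star_smul, smul_dotProduct, dotProduct_smul, smul_eq_mul, smul_eq_mul, ← mul_assoc] at h2
  have h3 : star v ⬝ᵥ v ≠ 0 := by
    rwa [ne_eq, dotProduct_star_self_eq_zero]
  have h4 : star x * x = 1 := by
    have := mul_right_cancel₀ h3 (h2.trans (one_mul _).symm)
    exact this
  have h5 : ((‖x‖ : ℂ)) ^ 2 = 1 := by
    rw [← Complex.conj_mul']
    exact h4
  have h6 : ‖x‖ ^ 2 = 1 := by exact_mod_cast h5
  exact (pow_eq_one_iff_of_nonneg (norm_nonneg _) two_ne_zero).mp h6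

theorem det_smul_one_sub_ne_zero (U : unitaryGroup (Fin n) ℂ) {x : ℂ} (hx : 1 < ‖x‖) :
    (x • (1 : Matrix (Fin n) (Fin n) ℂ) - U).det ≠ 0 := fun h =>
  hx.ne' (norm_eq_one_of_det_eq_zero U h)

theorem continuous_mulResolvent {x : ℂ} (hx : 1 < ‖x‖) :
    Continuous fun U : unitaryGroup (Fin n) ℂ =>
      mulResolvent (U : Matrix (Fin n) (Fin n) ℂ) x := by
  unfold mulResolvent
  simp_rw [inv_def, Ring.inverse_eq_inv']
  have hc : Continuous fun U : unitaryGroup (Fin n) ℂ =>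
      (x • (1 : Matrix (Fin n) (Fin n) ℂ) - U) := by fun_prop
  exact continuous_subtype_val.matrix_mul
    ((hc.matrix_det.inv₀ fun U => det_smul_one_sub_ne_zero U hx).smul hc.matrix_adjugate)

theorem continuous_charpoly_eval (x : ℂ) :
    Continuous fun U : unitaryGroup (Fin n) ℂ =>
      (U : Matrix (Fin n) (Fin n) ℂ).charpoly.eval x := by
  simp_rw [charpoly_eval_eq_det]
  have hc : Continuous fun U : unitaryGroup (Fin n) ℂ =>
      (x • (1 : Matrix (Fin n) (Fin n) ℂ) - U) := by fun_prop
  exact hc.matrix_det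

/-- The product of the values of the characteristic polynomial at the points `x a`, multiplied by
`det U ^ (-r)`. -/
def twistedCharpolyProd (r : ℕ) (x : κ → ℂ) (U : unitaryGroup (Fin n) ℂ) : ℂ :=
  star (U : Matrix (Fin n) (Fin n) ℂ).det ^ r *
    ∏ a, (U : Matrix (Fin n) (Fin n) ℂ).charpoly.eval (x a)

theorem continuous_twistedCharpolyProd (r : ℕ) (x : κ → ℂ) :
    Continuous (twistedCharpolyProd (n := n) r x) := by
  unfold twistedCharpolyProd
  have hc : Continuous fun U : unitaryGroup (Fin n) ℂ => (U : Matrix (Fin n) (Fin n) ℂ).det :=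
    continuous_subtype_val.matrix_det
  exact ((continuous_star.comp hc).pow r).mul
    (continuous_finsetProd _ fun a _ => continuous_charpoly_eval (x a))

instance cueMeasure_isMulLeftInvariant (n : ℕ) : (cueMeasure n).IsMulLeftInvariant := by
  unfold cueMeasure; infer_instance

theorem integrable_cue_of_continuous {f : unitaryGroup (Fin n) ℂ → ℂ} (hf : Continuous f) :
    Integrable f (cueMeasure n) :=
  hf.integrable_of_hasCompactSupport (HasCompactSupport.of_compactSpace f)

/-- The unitary matrix acting by `s` on the line spanned by `v` and trivially on its orthogonal
complement. -/
theorem exists_unitary_rankOne (v : Fin n → ℂ) (hv : v ≠ 0) (s : ℂ) (hs : ‖s‖ = 1) :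
    ∃ g : unitaryGroup (Fin n) ℂ, (g : Matrix (Fin n) (Fin n) ℂ) =
      1 + ((s - 1) / (star v ⬝ᵥ v)) • vecMulVec v (star v) := by
  have h3 : star v ⬝ᵥ v ≠ 0 := by rwa [ne_eq, dotProduct_star_self_eq_zero]
  refine ⟨⟨1 + ((s - 1) / (star v ⬝ᵥ v)) • vecMulVec v (star v), ?_⟩, rfl⟩
  rw [mem_unitaryGroup_iff, star_eq_conjTranspose]
  have hN : star (star v ⬝ᵥ v) = star v ⬝ᵥ v := by
    rw [← star_dotProduct_star, star_star, dotProduct_comm]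
  have hss : s * star s = 1 := by
    have := Complex.mul_conj' s
    rw [hs] at this
    simpa using this
  have hV : (vecMulVec v (star v))ᴴ = vecMulVec v (star v) := by
    rw [conjTranspose_vecMulVec, star_star]
  have hVV : vecMulVec v (star v) * vecMulVec v (star v) =
      (star v ⬝ᵥ v) • vecMulVec v (star v) := by
    rw [vecMulVec_mul_vecMulVec, vecMulVec_smul]
  rw [conjTranspose_add, conjTranspose_one, conjTranspose_smul, hV, add_mul, mul_add, mul_add,
    smul_mul_smul_comm, hVV, one_mul, mul_one, one_mul, add_assoc, smul_smul, ← add_smul, ← add_smul]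
  rw [show star ((s - 1) / (star v ⬝ᵥ v)) = (star s - 1) / (star v ⬝ᵥ v) by
    rw [star_div₀, hN, star_sub, star_one]]
  convert add_zero (1 : Matrix (Fin n) (Fin n) ℂ)
  rw [show (star s - 1) / (star v ⬝ᵥ v) + ((s - 1) / (star v ⬝ᵥ v) +
    (s - 1) / (star v ⬝ᵥ v) * ((star s - 1) / (star v ⬝ᵥ v)) * (star v ⬝ᵥ v)) = 0 by
      field_simp
      linear_combination hss, zero_smul]

/-- Translate the integrand by the unitary `g` that multiplies `v` by `s`. Each characteristic
polynomial gains the factor of the matrix determinant lemma, and the conjugate determinant gains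
`(star s) ^ r`, which moves across as `s ^ r` because `|s| = 1`. -/
theorem integral_twistedCharpolyProd_rankOne (r : ℕ) (x : κ → ℂ) (hx : ∀ a, 1 < ‖x a‖)
    (v : Fin n → ℂ) (hv : v ≠ 0) (s : ℂ) (hs : ‖s‖ = 1) :
    ∫ U, twistedCharpolyProd r x U * ∏ a, (1 - (s - 1) / (star v ⬝ᵥ v) *
      (star v ⬝ᵥ (mulResolvent (U : Matrix (Fin n) (Fin n) ℂ) (x a) *ᵥ v))) ∂(cueMeasure n) =
      s ^ r * ∫ U, twistedCharpolyProd r x U ∂(cueMeasure n) := by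
  obtain ⟨g, hg⟩ := exists_unitary_rankOne v hv s hs
  have h3 : star v ⬝ᵥ v ≠ 0 := by rwa [ne_eq, dotProduct_star_self_eq_zero]
  have hdet : (g : Matrix (Fin n) (Fin n) ℂ).det = s := by
    rw [hg, det_one_add_smul_vecMulVec, div_mul_cancel₀ _ h3]; ring
  have hss : s * star s = 1 := by
    have := Complex.mul_conj' s
    rw [hs] at this
    simpa using this
  rw [← integral_mul_left_eq_self (twistedCharpolyProd r x) g, ← integral_const_mul]
  refine integral_congr_ae (Filter.Eventually.of_forall fun U => ?_)
  simp only [twistedCharpolyProd]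
  have h4 : ∀ a, ((g * U : unitaryGroup (Fin n) ℂ) : Matrix (Fin n) (Fin n) ℂ).charpoly.eval (x a)
      = (U : Matrix (Fin n) (Fin n) ℂ).charpoly.eval (x a) * (1 - (s - 1) / (star v ⬝ᵥ v) *
      (star v ⬝ᵥ (mulResolvent (U : Matrix (Fin n) (Fin n) ℂ) (x a) *ᵥ v))) := by
    intro a
    rw [charpoly_eval_eq_det, UnitaryGroup.mul_val, hg,
      det_smul_one_sub_rankOne_mul _ _ _ _ (det_smul_one_sub_ne_zero U (hx a))]
  simp only [h4]
  simp only [UnitaryGroup.mul_val, det_mul, hdet, Finset.prod_mul_distrib, star_mul', mul_pow]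
  have h5 : s ^ r * star s ^ r = 1 := by rw [← mul_pow, hss, one_pow]
  linear_combination (-1 : ℂ) * (star (U : Matrix (Fin n) (Fin n) ℂ).det ^ r *
    (∏ a, (U : Matrix (Fin n) (Fin n) ℂ).charpoly.eval (x a)) *
    ∏ a, (1 - (s - 1) / (star v ⬝ᵥ v) *
      (star v ⬝ᵥ (mulResolvent (U : Matrix (Fin n) (Fin n) ℂ) (x a) *ᵥ v)))) * h5

end HaarLoop

/-! ### From an identity on the unit circle to identities between coefficients. -/

section CoefficientExtraction

open Polynomial

variable {κ : Type*}

theorem coeff_prod_one_sub (s : Finset κ) (g : κ → ℂ) :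
    (∏ a ∈ s, (1 - C (g a) * X)).coeff 0 = 1 ∧
    (∏ a ∈ s, (1 - C (g a) * X)).coeff 1 = -∑ a ∈ s, g a ∧
    2 * (∏ a ∈ s, (1 - C (g a) * X)).coeff 2 = (∑ a ∈ s, g a) ^ 2 - ∑ a ∈ s, g a ^ 2 := by
  classical
  induction s using Finset.induction_on with
  | empty => simp [coeff_one]
  | insert a s ha ih =>
    obtain ⟨h0, h1, h2⟩ := ih
    rw [Finset.prod_insert ha, Finset.sum_insert ha, Finset.sum_insert ha]
    simp only [sub_mul, one_mul, mul_assoc, coeff_sub, coeff_C_mul, coeff_X_mul, coeff_X_mul_zero,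
      h0, h1]
    refine ⟨by ring, by ring, ?_⟩
    linear_combination h2

theorem natDegree_prod_one_sub_le (s : Finset κ) (g : κ → ℂ) :
    (∏ a ∈ s, (1 - C (g a) * X)).natDegree ≤ s.card := by
  refine (natDegree_prod_le _ _).trans ?_
  rw [Finset.card_eq_sum_ones]
  refine Finset.sum_le_sum fun a _ => ?_
  compute_degree

theorem continuous_coeff_prod_one_sub {G : Type*} [TopologicalSpace G] (s : Finset κ)
    (g : κ → G → ℂ) (hg : ∀ a, Continuous (g a)) (k : ℕ) :
    Continuous fun U => (∏ a ∈ s, (1 - C (g a U) * X)).coeff k := by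
  classical
  induction s using Finset.induction_on generalizing k with
  | empty => simpa using continuous_const
  | insert a s ha ih =>
    simp_rw [Finset.prod_insert ha, sub_mul, one_mul, mul_assoc, coeff_sub, coeff_C_mul]
    cases k with
    | zero => simpa using ih 0
    | succ k =>
      simp_rw [coeff_X_mul]
      exact (ih _).sub ((hg a).mul (ih k))

theorem infinite_unit_circle : {s : ℂ | ‖s‖ = 1}.Infinite := by
  have : Infinite (Set.Ioo (0 : ℝ) 1) := (Set.Ioo_infinite one_pos).to_subtype
  refine Set.infinite_of_injective_forall_mem
    (f := fun t : Set.Ioo (0 : ℝ) 1 => Complex.exp (t * Complex.I)) ?_ ?_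
  · intro a b hab
    obtain ⟨k, hk⟩ := Complex.exp_eq_exp_iff_exists_int.mp hab
    have h1 : ((a : ℝ) : ℂ) = (b : ℝ) + k * (2 * Real.pi) := by
      apply mul_right_cancel₀ Complex.I_ne_zero
      rw [hk]; ring
    have h2 : (a : ℝ) = b + k * (2 * Real.pi) := by exact_mod_cast h1
    have hk0 : k = 0 := by
      by_contra hne
      have h3 : (1 : ℝ) ≤ |(k : ℝ)| := by exact_mod_cast Int.one_le_abs hne
      have h4 : |(a : ℝ) - b| = |(k : ℝ)| * (2 * Real.pi) := by
        rw [h2, add_sub_cancel_left, abs_mul, abs_of_pos Real.two_pi_pos]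
      have h5 : |(a : ℝ) - b| < 1 := by
        rw [abs_lt]; constructor <;> linarith [a.2.1, a.2.2, b.2.1, b.2.2]
      nlinarith [Real.pi_gt_three]
    rw [hk0] at h2
    ext
    simpa using h2
  · intro t
    simp [Complex.norm_exp_ofReal_mul_I]

/-- In the variable `w = (s - 1) / N` the hypothesis equates the polynomial `∫ f ∏ (1 - w g_a)` with
`A (1 + N w) ^ r` at infinitely many points. The conclusions are the coefficients of `w` and `w ^
2`, the latter doubled and written with power sums. -/
theorem integral_coefficients_of_integral_prod {G : Type*} [TopologicalSpace G] [CompactSpace G]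
    [MeasurableSpace G] [BorelSpace G] (μ : Measure G) [IsFiniteMeasure μ] [Fintype κ]
    (f : G → ℂ) (hf : Continuous f)
    (g : κ → G → ℂ) (hg : ∀ a, Continuous (g a)) (N A : ℂ) (hN : N ≠ 0) (r : ℕ)
    (h : ∀ s : ℂ, ‖s‖ = 1 →
      ∫ U, f U * ∏ a, (1 - (s - 1) / N * g a U) ∂μ = s ^ r * A) :
    ∫ U, f U * ∑ a, g a U ∂μ = -(r * N * A) ∧
    ∫ U, f U * ((∑ a, g a U) ^ 2 - ∑ a, g a U ^ 2) ∂μ = r * (r - 1) * N ^ 2 * A := by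
  set p : G → ℂ[X] := fun U => ∏ a, (1 - C (g a U) * X) with hp
  have hint : ∀ {F : G → ℂ}, Continuous F → Integrable F μ := fun hF =>
    hF.integrable_of_hasCompactSupport (HasCompactSupport.of_compactSpace _)
  have hcont : ∀ k, Continuous fun U => (p U).coeff k := fun k =>
    continuous_coeff_prod_one_sub Finset.univ g hg k
  set q : ℂ[X] := ∑ k ∈ Finset.range (Fintype.card κ + 1),
    C (∫ U, f U * (p U).coeff k ∂μ) * X ^ k with hq
  have heval : ∀ w, q.eval w = ∫ U, f U * (p U).eval w ∂μ := by
    intro w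
    have h1 : ∀ U, f U * (p U).eval w = ∑ k ∈ Finset.range (Fintype.card κ + 1),
        f U * (p U).coeff k * w ^ k := by
      intro U
      rw [eval_eq_sum_range' (Nat.lt_succ_of_le (natDegree_prod_one_sub_le Finset.univ
        (fun a => g a U))), Finset.mul_sum]
      exact Finset.sum_congr rfl fun k _ => by ring
    simp_rw [h1]
    rw [integral_finsetSum _ fun k _ => hint (by have := hcont k; fun_prop), hq,
      eval_finsetSum]
    refine Finset.sum_congr rfl fun k _ => ?_
    rw [integral_mul_const]
    simp
  have hcoeff : ∀ k, q.coeff k = ∫ U, f U * (p U).coeff k ∂μ := by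
    intro k
    rw [hq, finsetSum_coeff]
    simp only [coeff_C_mul, coeff_X_pow, mul_ite, mul_one, mul_zero]
    rw [Finset.sum_ite_eq]
    split_ifs with hk
    · rfl
    · have : ∀ U, (p U).coeff k = 0 := fun U => coeff_eq_zero_of_natDegree_lt
        ((natDegree_prod_one_sub_le Finset.univ fun a => g a U).trans_lt
          (by simpa using hk))
      simp [this]
  have hpoly : q = C A * ∏ _i : Fin r, (1 - C (-N) * X) := by
    refine eq_of_infinite_eval_eq _ _ (((infinite_unit_circle).image
      (f := fun s : ℂ => (s - 1) / N) ?_).mono ?_)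
    · intro a _ b _ hab
      simpa [hN, div_left_inj' hN] using hab
    · rintro _ ⟨s, hs, rfl⟩
      have h1 := h s hs
      simp only [Set.mem_ofPred_eq]
      rw [heval]
      simp only [hp, eval_prod, eval_sub, eval_one, eval_mul, eval_C, eval_X]
      rw [Finset.prod_const, Finset.card_univ, Fintype.card_fin]
      rw [show (1 - -N * ((s - 1) / N)) = s by field_simp; ring, mul_comm A, ← h1]
      refine integral_congr_ae (Filter.Eventually.of_forall fun U => ?_)
      simp only [mul_comm]
  obtain ⟨-, hr1, hr2⟩ := coeff_prod_one_sub (Finset.univ : Finset (Fin r)) (fun _ => -N)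
  have hp12 := fun U => coeff_prod_one_sub (Finset.univ : Finset κ) (fun a => g a U)
  simp only [Finset.sum_const, Finset.card_univ, Fintype.card_fin, nsmul_eq_mul] at hr1 hr2
  constructor
  · have h1 := hcoeff 1
    rw [hpoly, coeff_C_mul, hr1] at h1
    have h2 : ∀ U, (p U).coeff 1 = -∑ a, g a U := fun U => (hp12 U).2.1
    simp_rw [h2, mul_neg] at h1
    rw [integral_neg] at h1
    linear_combination h1
  · have h1 := hcoeff 2
    rw [hpoly, coeff_C_mul] at h1
    have h2 : ∀ U, f U * ((∑ a, g a U) ^ 2 - ∑ a, g a U ^ 2) = 2 * (f U * (p U).coeff 2) :=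
      fun U => by rw [← (hp12 U).2.2]; ring
    simp_rw [h2]
    rw [integral_const_mul, ← h1]
    linear_combination A * hr2

end CoefficientExtraction

/-! ### Traces recovered from quadratic forms. -/

section Polarization

open Matrix

variable {n : ℕ} {κ : Type*}

theorem sum_offDiag_eq_sub [Fintype κ] [DecidableEq κ] (f : κ → κ → ℂ) :
    ∑ p ∈ (Finset.univ : Finset κ).offDiag, f p.1 p.2 =
      ∑ a, ∑ b, f a b - ∑ a, f a a := by
  rw [eq_sub_iff_add_eq, ← Finset.sum_product', ← Finset.diag_union_offDiag,
    Finset.sum_union (Finset.disjoint_diag_offDiag _), Finset.sum_diag, add_comm]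

theorem dotProduct_mulVec_single_add (A : Matrix (Fin n) (Fin n) ℂ) (i j : Fin n) (ω : ℂ)
    (hω : star ω * ω = 1) :
    star (Pi.single i 1 + ω • Pi.single j 1 : Fin n → ℂ) ⬝ᵥ
      (A *ᵥ (Pi.single i 1 + ω • Pi.single j 1)) =
      A i i + A j j + ω * A i j + star ω * A j i := by
  simp [mulVec_add, mulVec_smul, dotProduct_add, add_dotProduct]
  simp at hω
  linear_combination (A j j) * hω

theorem sum_fourth_roots_of_unity (f : ℂ → ℂ) :
    ∑ ω ∈ ({1, -1, Complex.I, -Complex.I} : Finset ℂ), f ω =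
      f 1 + (f (-1) + (f Complex.I + f (-Complex.I))) := by
  rw [Finset.sum_insert, Finset.sum_insert, Finset.sum_insert, Finset.sum_singleton] <;>
    norm_num [Complex.ext_iff]

/-- A finite substitute for averaging over the unit sphere. Summing over fourth roots of unity kills
the terms in `ω`, `ω ^ 2` and their conjugates, so only the diagonal part and `A i j * B j i + A j i
* B i j` survive. The subtracted sum removes the terms `A i i * B i i`. -/
theorem trace_mul_trace_add_trace_mul (A B : Matrix (Fin n) (Fin n) ℂ) :
    8 * (A.trace * B.trace + (A * B).trace) =
      (∑ i, ∑ j, ∑ ω ∈ ({1, -1, Complex.I, -Complex.I} : Finset ℂ),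
        (star (Pi.single i 1 + ω • Pi.single j 1 : Fin n → ℂ) ⬝ᵥ
          (A *ᵥ (Pi.single i 1 + ω • Pi.single j 1))) *
        (star (Pi.single i 1 + ω • Pi.single j 1 : Fin n → ℂ) ⬝ᵥ
          (B *ᵥ (Pi.single i 1 + ω • Pi.single j 1)))) -
      8 * n * ∑ i, (star (Pi.single i 1 : Fin n → ℂ) ⬝ᵥ (A *ᵥ Pi.single i 1)) *
        (star (Pi.single i 1 : Fin n → ℂ) ⬝ᵥ (B *ᵥ Pi.single i 1)) := by
  have hinner : ∀ i j, (∑ ω ∈ ({1, -1, Complex.I, -Complex.I} : Finset ℂ),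
        (star (Pi.single i 1 + ω • Pi.single j 1 : Fin n → ℂ) ⬝ᵥ
          (A *ᵥ (Pi.single i 1 + ω • Pi.single j 1))) *
        (star (Pi.single i 1 + ω • Pi.single j 1 : Fin n → ℂ) ⬝ᵥ
          (B *ᵥ (Pi.single i 1 + ω • Pi.single j 1)))) =
      4 * ((A i i + A j j) * (B i i + B j j) + A i j * B j i + A j i * B i j) := by
    intro i j
    rw [sum_fourth_roots_of_unity]
    rw [dotProduct_mulVec_single_add A i j 1 (by simp),
      dotProduct_mulVec_single_add B i j 1 (by simp),
      dotProduct_mulVec_single_add A i j (-1) (by simp),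
      dotProduct_mulVec_single_add B i j (-1) (by simp),
      dotProduct_mulVec_single_add A i j Complex.I (by simp),
      dotProduct_mulVec_single_add B i j Complex.I (by simp),
      dotProduct_mulVec_single_add A i j (-Complex.I) (by simp),
      dotProduct_mulVec_single_add B i j (-Complex.I) (by simp)]
    simp only [star_one, star_neg, Complex.star_def, Complex.conj_I]
    linear_combination (2 * A i j * B i j - 2 * A i j * B j i - 2 * A j i * B i j +
      2 * A j i * B j i) * Complex.I_sq
  have hdiag : ∀ (C : Matrix (Fin n) (Fin n) ℂ) i,
      star (Pi.single i 1 : Fin n → ℂ) ⬝ᵥ (C *ᵥ Pi.single i 1) = C i i := by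
    intro C i; simp
  simp only [hinner, hdiag]
  have e1 : ∑ i, ∑ j, A i i * B j j = A.trace * B.trace := by
    simp [trace, Finset.sum_mul_sum]
  have e1' : ∑ i, ∑ j, A j j * B i i = A.trace * B.trace := by
    rw [Finset.sum_comm]; exact e1
  have e2 : ∑ i, ∑ j, A i j * B j i = (A * B).trace := by
    simp [trace, Matrix.mul_apply]
  have e2' : ∑ i, ∑ j, A j i * B i j = (A * B).trace := by
    rw [Finset.sum_comm]; exact e2
  have e3 : ∑ i, ∑ _j : Fin n, A i i * B i i = n * ∑ i, A i i * B i i := by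
    simp [Finset.mul_sum]
  have e3' : ∑ _i : Fin n, ∑ j, A j j * B j j = n * ∑ i, A i i * B i i := by
    simp
  have : ∑ i, ∑ j, 4 * ((A i i + A j j) * (B i i + B j j) + A i j * B j i + A j i * B i j) =
      4 * (∑ i, ∑ j, A i i * B j j + ∑ i, ∑ j, A j j * B i i + ∑ i, ∑ j, A i j * B j i +
        ∑ i, ∑ j, A j i * B i j + ∑ i, ∑ _j : Fin n, A i i * B i i +
        ∑ _i : Fin n, ∑ j, A j j * B j j) := by
    simp only [← Finset.sum_add_distrib, Finset.mul_sum]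
    exact Finset.sum_congr rfl fun i _ => Finset.sum_congr rfl fun j _ => by ring
  rw [this, e1, e1', e2, e2', e3, e3']
  ring

end Polarization

/-! ### First and second loop equations for traces. -/

section LoopEquations

open Matrix
open scoped ComplexOrder

variable {n : ℕ} {κ : Type*} [Fintype κ]

theorem continuous_quadraticForm_mulResolvent {x : ℂ} (hx : 1 < ‖x‖) (v : Fin n → ℂ) :
    Continuous fun U : unitaryGroup (Fin n) ℂ =>
      star v ⬝ᵥ (mulResolvent (U : Matrix (Fin n) (Fin n) ℂ) x *ᵥ v) :=
  continuous_const.dotProduct ((continuous_mulResolvent hx).matrix_mulVec continuous_const)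

theorem integral_quadraticForm_loop (r : ℕ) (x : κ → ℂ) (hx : ∀ a, 1 < ‖x a‖)
    (v : Fin n → ℂ) (hv : v ≠ 0) :
    ∫ U, twistedCharpolyProd r x U * ∑ a,
        (star v ⬝ᵥ (mulResolvent (U : Matrix (Fin n) (Fin n) ℂ) (x a) *ᵥ v)) ∂(cueMeasure n) =
      -(r * (star v ⬝ᵥ v) * ∫ U, twistedCharpolyProd r x U ∂(cueMeasure n)) ∧
    ∫ U, twistedCharpolyProd r x U *
      ((∑ a, (star v ⬝ᵥ (mulResolvent (U : Matrix (Fin n) (Fin n) ℂ) (x a) *ᵥ v))) ^ 2 -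
        ∑ a, (star v ⬝ᵥ (mulResolvent (U : Matrix (Fin n) (Fin n) ℂ) (x a) *ᵥ v)) ^ 2)
        ∂(cueMeasure n) =
      r * (r - 1) * (star v ⬝ᵥ v) ^ 2 * ∫ U, twistedCharpolyProd r x U ∂(cueMeasure n) := by
  have h3 : star v ⬝ᵥ v ≠ 0 := by rwa [ne_eq, dotProduct_star_self_eq_zero]
  exact integral_coefficients_of_integral_prod (cueMeasure n) _ (continuous_twistedCharpolyProd r x)
    (fun a (U : unitaryGroup (Fin n) ℂ) =>
      star v ⬝ᵥ (mulResolvent (U : Matrix (Fin n) (Fin n) ℂ) (x a) *ᵥ v))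
    (fun a => continuous_quadraticForm_mulResolvent (hx a) v) _ _ h3 r
    fun s hs => integral_twistedCharpolyProd_rankOne r x hx v hv s hs

theorem integral_trace_loop (r : ℕ) (x : κ → ℂ) (hx : ∀ a, 1 < ‖x a‖) :
    ∫ U, twistedCharpolyProd r x U *
      ∑ a, (mulResolvent (U : Matrix (Fin n) (Fin n) ℂ) (x a)).trace ∂(cueMeasure n) =
      -(r * n * ∫ U, twistedCharpolyProd r x U ∂(cueMeasure n)) := by
  have h1 : ∀ U : unitaryGroup (Fin n) ℂ, twistedCharpolyProd r x U *
      ∑ a, (mulResolvent (U : Matrix (Fin n) (Fin n) ℂ) (x a)).trace =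
      ∑ i, twistedCharpolyProd r x U * ∑ a, (star (Pi.single i 1 : Fin n → ℂ) ⬝ᵥ
        (mulResolvent (U : Matrix (Fin n) (Fin n) ℂ) (x a) *ᵥ Pi.single i 1)) := by
    intro U
    rw [← Finset.mul_sum, Finset.sum_comm]
    simp [trace]
  simp_rw [h1]
  rw [integral_finsetSum]
  · rw [Finset.sum_congr rfl fun i _ => (integral_quadraticForm_loop r x hx (Pi.single i 1)
      (by simp)).1]
    simp
    ring
  · intro i _
    exact integrable_cue_of_continuous ((continuous_twistedCharpolyProd r x).mul
      (continuous_finsetSum _ fun a _ => continuous_quadraticForm_mulResolvent (hx a) _))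

/-- The second-order equation holds for every vector `v`. Combining it over the vectors of the
polarization identity replaces quadratic forms by traces, and `(star v ⬝ᵥ v) ^ 2` by the constant `n
(n + 1)`. -/
theorem integral_trace_pair_loop [DecidableEq κ] (r : ℕ) (x : κ → ℂ) (hx : ∀ a, 1 < ‖x a‖) :
    ∫ U, twistedCharpolyProd r x U * ∑ p ∈ (Finset.univ : Finset κ).offDiag,
      ((mulResolvent (U : Matrix (Fin n) (Fin n) ℂ) (x p.1)).trace *
        (mulResolvent (U : Matrix (Fin n) (Fin n) ℂ) (x p.2)).trace +
      (mulResolvent (U : Matrix (Fin n) (Fin n) ℂ) (x p.1) *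
        mulResolvent (U : Matrix (Fin n) (Fin n) ℂ) (x p.2)).trace) ∂(cueMeasure n) =
      n * (n + 1) * (r * (r - 1)) * ∫ U, twistedCharpolyProd r x U ∂(cueMeasure n) := by
  set Φ : (Fin n → ℂ) → unitaryGroup (Fin n) ℂ → ℂ := fun v U =>
    twistedCharpolyProd r x U * ∑ p ∈ (Finset.univ : Finset κ).offDiag,
      (star v ⬝ᵥ (mulResolvent (U : Matrix (Fin n) (Fin n) ℂ) (x p.1) *ᵥ v)) *
      (star v ⬝ᵥ (mulResolvent (U : Matrix (Fin n) (Fin n) ℂ) (x p.2) *ᵥ v)) with hΦ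
  have hint : ∀ v, Integrable (Φ v) (cueMeasure n) := fun v =>
    integrable_cue_of_continuous ((continuous_twistedCharpolyProd r x).mul
      (continuous_finsetSum _ fun p _ => (continuous_quadraticForm_mulResolvent (hx p.1) _).mul
        (continuous_quadraticForm_mulResolvent (hx p.2) _)))
  have hval : ∀ v, ∫ U, Φ v U ∂(cueMeasure n) =
      r * (r - 1) * (star v ⬝ᵥ v) ^ 2 * ∫ U, twistedCharpolyProd r x U ∂(cueMeasure n) := by
    intro v
    by_cases hv : v = 0
    · simp [hv, hΦ]
    rw [← (integral_quadraticForm_loop r x hx v hv).2]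
    refine integral_congr_ae (Filter.Eventually.of_forall fun U => ?_)
    simp only [hΦ]
    congr 1
    rw [sum_offDiag_eq_sub (fun a b =>
      (star v ⬝ᵥ (mulResolvent (U : Matrix (Fin n) (Fin n) ℂ) (x a) *ᵥ v)) *
      (star v ⬝ᵥ (mulResolvent (U : Matrix (Fin n) (Fin n) ℂ) (x b) *ᵥ v))), sq,
      Finset.sum_mul_sum]
    congr 1
    exact Finset.sum_congr rfl fun a _ => (sq _).symm
  set Ω : Finset ℂ := {1, -1, Complex.I, -Complex.I} with hΩ
  have hpt : ∀ U : unitaryGroup (Fin n) ℂ,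
      8 * (twistedCharpolyProd r x U * ∑ p ∈ (Finset.univ : Finset κ).offDiag,
      ((mulResolvent (U : Matrix (Fin n) (Fin n) ℂ) (x p.1)).trace *
        (mulResolvent (U : Matrix (Fin n) (Fin n) ℂ) (x p.2)).trace +
      (mulResolvent (U : Matrix (Fin n) (Fin n) ℂ) (x p.1) *
        mulResolvent (U : Matrix (Fin n) (Fin n) ℂ) (x p.2)).trace)) =
      (∑ i : Fin n, ∑ j : Fin n, ∑ ω ∈ Ω, Φ (Pi.single i 1 + ω • Pi.single j 1) U) -
        8 * n * ∑ i : Fin n, Φ (Pi.single i 1) U := by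
    intro U
    rw [mul_left_comm, Finset.mul_sum,
      Finset.sum_congr rfl fun p _ => trace_mul_trace_add_trace_mul _ _, Finset.sum_sub_distrib,
      ← Finset.mul_sum, mul_sub]
    simp only [hΦ, ← Finset.mul_sum]
    congr 1
    · congr 1
      rw [Finset.sum_comm]
      refine Finset.sum_congr rfl fun i _ => ?_
      rw [Finset.sum_comm]
      refine Finset.sum_congr rfl fun j _ => ?_
      rw [Finset.sum_comm]
    · rw [Finset.sum_comm]
      ring
  have h8 : (8 : ℂ) ≠ 0 := by norm_num
  refine mul_left_cancel₀ h8 ?_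
  rw [← integral_const_mul]
  simp_rw [hpt]
  rw [integral_sub, integral_const_mul, integral_finsetSum _ fun i _ => hint _,
    integral_finsetSum]
  rotate_left
  · exact fun i _ => integrable_finsetSum _ fun j _ => integrable_finsetSum _ fun ω _ => hint _
  · exact integrable_finsetSum _ fun i _ =>
      integrable_finsetSum _ fun j _ => integrable_finsetSum _ fun ω _ => hint _
  · exact (integrable_finsetSum _ fun i _ => hint _).const_mul _
  -- For `i ≠ j` the four squared lengths are all 2, which gives 16. For `i = j` they are 4, 0, 2,
  -- 2, which gives 24. Hence the total `16 n² + 8 n - 8 n² = 8 n (n + 1)`.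
  have hI : ∀ i j : Fin n, ∑ ω ∈ Ω, (star (Pi.single i 1 + ω • Pi.single j 1 : Fin n → ℂ) ⬝ᵥ
      (Pi.single i 1 + ω • Pi.single j 1)) ^ 2 = 16 + if i = j then 8 else 0 := by
    intro i j
    have h := fun ω hω => dotProduct_mulVec_single_add (1 : Matrix (Fin n) (Fin n) ℂ) i j ω hω
    simp only [one_mulVec, one_apply_eq] at h
    rw [hΩ, sum_fourth_roots_of_unity]
    rw [h 1 (by simp), h (-1) (by simp), h Complex.I (by simp), h (-Complex.I) (by simp)]
    simp only [star_one, star_neg, Complex.star_def, Complex.conj_I]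
    by_cases hij : i = j
    · subst hij
      simp
      norm_num
    · rw [one_apply_ne hij, one_apply_ne (Ne.symm hij)]
      simp [hij]
      norm_num
  have hsum : ∑ i : Fin n, ∫ U, ∑ j : Fin n, ∑ ω ∈ Ω, Φ (Pi.single i 1 + ω • Pi.single j 1) U
      ∂(cueMeasure n) = (∑ i : Fin n, ∑ j : Fin n, (16 + if i = j then 8 else 0)) *
        (r * (r - 1) * ∫ U, twistedCharpolyProd r x U ∂(cueMeasure n)) := by
    rw [Finset.sum_mul]
    refine Finset.sum_congr rfl fun i _ => ?_
    rw [integral_finsetSum _ fun j _ => integrable_finsetSum _ fun ω _ => hint _, Finset.sum_mul]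
    refine Finset.sum_congr rfl fun j _ => ?_
    rw [integral_finsetSum _ fun ω _ => hint _, ← hI i j, Finset.sum_mul]
    refine Finset.sum_congr rfl fun ω _ => ?_
    rw [hval]
    ring
  rw [hsum, Finset.sum_congr rfl fun i _ => hval _]
  simp [Finset.sum_add_distrib]
  ring

end LoopEquations

/-! ### Euler operators, diagonal on monomials. -/

section EulerDerivation

open MvPolynomial

variable {κ : Type*}

/-- The derivation `X_a ∂/∂X_a`. -/
def eulerDerivation (a : κ) : Derivation ℂ (MvPolynomial κ ℂ) (MvPolynomial κ ℂ) :=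
  (X a : MvPolynomial κ ℂ) • pderiv a

theorem coeff_eulerDerivation (a : κ) (p : MvPolynomial κ ℂ) (m : κ →₀ ℕ) :
    (eulerDerivation a p).coeff m = m a * p.coeff m := by
  classical
  rw [eulerDerivation, Derivation.smul_apply, smul_eq_mul, coeff_X_mul']
  split_ifs with h
  · rw [coeff_pderiv]
    have h1 : 1 ≤ m a := Nat.one_le_iff_ne_zero.mpr (Finsupp.mem_support_iff.mp h)
    have h2 : m - Finsupp.single a 1 + Finsupp.single a 1 = m :=
      tsub_add_cancel_of_le (Finsupp.single_le_iff.mpr h1)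
    rw [h2]
    simp only [Finsupp.coe_tsub, Pi.sub_apply, Finsupp.single_eq_same]
    rw [← Nat.cast_add_one, Nat.sub_add_cancel h1]
    ring
  · simp [Finsupp.notMem_support_iff.mp h]

theorem eulerDerivation_monomial (a : κ) (m : κ →₀ ℕ) (c : ℂ) :
    eulerDerivation a (monomial m c) = monomial m (m a * c) := by
  classical
  ext k
  rw [coeff_eulerDerivation, coeff_monomial, coeff_monomial]
  split_ifs with h
  · rw [h]
  · simp

end EulerDerivation

/-! ### Expected products of random polynomials, as multivariate polynomials. -/

section ExpectedPolynomial

open MvPolynomial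

variable {κ G : Type*} [Fintype κ] [DecidableEq κ] [MeasurableSpace G]

/-- The polynomial `𝔼[w ∏ₐ qₐ(Xₐ)]`, for random polynomials `qₐ` of degree at most `d`. -/
def expectedProd (μ : Measure G) (d : ℕ) (w : G → ℂ) (q : κ → G → Polynomial ℂ) :
    MvPolynomial κ ℂ :=
  ∑ k : κ → Fin (d + 1), monomial (Finsupp.equivFunOnFinite.symm fun a => (k a : ℕ))
    (∫ U, w U * ∏ a, (q a U).coeff (k a) ∂μ)

theorem eval_expectedProd (μ : Measure G) (d : ℕ) (w : G → ℂ) (q : κ → G → Polynomial ℂ)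
    (hd : ∀ a U, (q a U).natDegree ≤ d)
    (hint : ∀ k : κ → ℕ, Integrable (fun U => w U * ∏ a, (q a U).coeff (k a)) μ) (x : κ → ℂ) :
    eval x (expectedProd μ d w q) = ∫ U, w U * ∏ a, (q a U).eval (x a) ∂μ := by
  have h1 : ∀ U, w U * ∏ a, (q a U).eval (x a) =
      ∑ k : κ → Fin (d + 1), w U * (∏ a, (q a U).coeff (k a)) * ∏ a, x a ^ (k a : ℕ) := by
    intro U
    have : ∀ a, (q a U).eval (x a) =
        ∑ k : Fin (d + 1), (q a U).coeff k * x a ^ (k : ℕ) := fun a => by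
      rw [Polynomial.eval_eq_sum_range' (Nat.lt_succ_of_le (hd a U)), Finset.sum_range]
    rw [Finset.prod_congr rfl fun a _ => this a, Finset.prod_univ_sum, Finset.mul_sum,
      Fintype.piFinset_univ]
    exact Finset.sum_congr rfl fun k _ => by rw [Finset.prod_mul_distrib]; ring
  simp_rw [h1]
  rw [integral_finsetSum _ fun k _ => (hint fun a => k a).mul_const _, expectedProd, map_sum]
  refine Finset.sum_congr rfl fun k _ => ?_
  rw [integral_mul_const, eval_monomial, Finsupp.prod_fintype _ _ (by simp)]
  simp

theorem eulerDerivation_expectedProd (μ : Measure G) (d : ℕ) (w : G → ℂ)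
    (q : κ → G → Polynomial ℂ) (a : κ) :
    eulerDerivation a (expectedProd μ d w q) =
      expectedProd μ d w (Function.update q a fun U => Polynomial.X * (q a U).derivative) := by
  rw [expectedProd, map_sum, expectedProd]
  refine Finset.sum_congr rfl fun k _ => ?_
  rw [eulerDerivation_monomial, ← integral_const_mul]
  congr 1
  refine integral_congr_ae (Filter.Eventually.of_forall fun U => ?_)
  have hc : ∀ (p : Polynomial ℂ) (j : ℕ), (Polynomial.X * p.derivative).coeff j = j * p.coeff j := by
    intro p j
    cases j with
    | zero => simp
    | succ j => rw [Polynomial.coeff_X_mul, Polynomial.coeff_derivative]; push_cast; ring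
  simp only [Finsupp.equivFunOnFinite_symm_apply_apply]
  rw [← Finset.mul_prod_erase _ _ (Finset.mem_univ a), ← Finset.mul_prod_erase _
    (fun b => (Function.update q a (fun U => Polynomial.X * (q a U).derivative) b U).coeff (k b))
    (Finset.mem_univ a), Function.update_self, hc]
  have he : ∏ b ∈ Finset.univ.erase a,
      (Function.update q a (fun U => Polynomial.X * (q a U).derivative) b U).coeff (k b) =
      ∏ b ∈ Finset.univ.erase a, (q b U).coeff (k b) :=
    Finset.prod_congr rfl fun b hb => by
      rw [Function.update_of_ne (Finset.ne_of_mem_erase hb)]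
  rw [he]
  ring

theorem degreeOf_expectedProd_le (μ : Measure G) (d : ℕ) (w : G → ℂ)
    (q : κ → G → Polynomial ℂ) (a : κ) : degreeOf a (expectedProd μ d w q) ≤ d := by
  refine (degreeOf_sum_le _ _ _).trans (Finset.sup_le fun k _ => ?_)
  by_cases h : (∫ U, w U * ∏ a, (q a U).coeff (k a) ∂μ) = 0
  · rw [h]; simp
  · rw [degreeOf_monomial_eq _ _ h]
    simpa using Nat.lt_succ_iff.mp (k a).2

end ExpectedPolynomial

/-! ### Differential equations for the moments of the characteristic polynomial. -/

section CharpolyMoments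

open MvPolynomial Matrix

variable {n : ℕ} {κ : Type*} [Fintype κ] [DecidableEq κ]

theorem continuous_charpoly_coeff (k : ℕ) :
    Continuous fun U : unitaryGroup (Fin n) ℂ =>
      (U : Matrix (Fin n) (Fin n) ℂ).charpoly.coeff k := by
  have h : ∀ U : unitaryGroup (Fin n) ℂ, (U : Matrix (Fin n) (Fin n) ℂ).charpoly.coeff k =
      eval (fun p : Fin n × Fin n => (U : Matrix (Fin n) (Fin n) ℂ) p.1 p.2)
        ((charpoly.univ ℂ (Fin n)).coeff k) := by
    intro U
    have := charpoly.univ_coeff_eval₂Hom (Fin n) (RingHom.id ℂ)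
      (fun p : Fin n × Fin n => (U : Matrix (Fin n) (Fin n) ℂ) p.1 p.2) k
    exact this.symm
  simp_rw [h]
  refine (continuous_eval _).comp (continuous_pi fun p => ?_)
  exact (continuous_apply_apply p.1 p.2).comp continuous_subtype_val

/-- The polynomial `𝔼[det(U)^(-r) ∏ₐ det(Xₐ - U)]` for a Haar distributed unitary matrix. -/
def charpolyMoment (n r : ℕ) (κ : Type*) [Fintype κ] [DecidableEq κ] : MvPolynomial κ ℂ :=
  expectedProd (cueMeasure n) n
    (fun U : unitaryGroup (Fin n) ℂ => star (U : Matrix (Fin n) (Fin n) ℂ).det ^ r)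
    (fun _ U => (U : Matrix (Fin n) (Fin n) ℂ).charpoly)

theorem integrable_twisted_coeff {κ : Type*} [Fintype κ] (r : ℕ) (q : κ → unitaryGroup (Fin n) ℂ → Polynomial ℂ)
    (hq : ∀ a k, Continuous fun U => (q a U).coeff k) (k : κ → ℕ) :
    Integrable (fun U : unitaryGroup (Fin n) ℂ =>
      star (U : Matrix (Fin n) (Fin n) ℂ).det ^ r * ∏ a, (q a U).coeff (k a)) (cueMeasure n) := by
  refine integrable_cue_of_continuous (Continuous.mul ?_ (continuous_finsetProd _ fun a _ => hq a _))
  have hc : Continuous fun U : unitaryGroup (Fin n) ℂ => (U : Matrix (Fin n) (Fin n) ℂ).det :=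
    continuous_subtype_val.matrix_det
  exact (continuous_star.comp hc).pow r

theorem eval_charpolyMoment (r : ℕ) (x : κ → ℂ) :
    eval x (charpolyMoment n r κ) = ∫ U, twistedCharpolyProd r x U ∂(cueMeasure n) :=
  eval_expectedProd _ _ _ _ (fun _ U => by rw [charpoly_natDegree_eq_dim, Fintype.card_fin])
    (integrable_twisted_coeff r _ fun _ k => continuous_charpoly_coeff k) x

/-- `X_a ∂/∂X_a` applied to the `a`-th factor for all `a` in a finite set. -/
def eulerCharpoly (s : Finset κ) (a : κ) (U : unitaryGroup (Fin n) ℂ) : Polynomial ℂ :=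
  if a ∈ s then Polynomial.X * (U : Matrix (Fin n) (Fin n) ℂ).charpoly.derivative
  else (U : Matrix (Fin n) (Fin n) ℂ).charpoly

/-- The logarithmic derivative `x p'(x) / p(x)` of the characteristic polynomial is `n + tr
(mulResolvent U x)`. Points outside the closed unit disc keep the resolvents defined for every
unitary `U`. -/
theorem eval_expectedProd_eulerCharpoly (r : ℕ) (s : Finset κ) (x : κ → ℂ)
    (hx : ∀ a, 1 < ‖x a‖) :
    eval x (expectedProd (cueMeasure n) n
      (fun U : unitaryGroup (Fin n) ℂ => star (U : Matrix (Fin n) (Fin n) ℂ).det ^ r)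
      (eulerCharpoly s)) =
    ∫ U, twistedCharpolyProd r x U *
      ∏ a ∈ s, (n + (mulResolvent (U : Matrix (Fin n) (Fin n) ℂ) (x a)).trace)
      ∂(cueMeasure n) := by
  rw [eval_expectedProd]
  · refine integral_congr_ae (Filter.Eventually.of_forall fun U => ?_)
    simp only [twistedCharpolyProd, mul_assoc]
    congr 1
    have hs : ∏ a ∈ s, (n + (mulResolvent (U : Matrix (Fin n) (Fin n) ℂ) (x a)).trace) =
        ∏ a, if a ∈ s then (n + (mulResolvent (U : Matrix (Fin n) (Fin n) ℂ) (x a)).trace)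
          else 1 := by
      rw [Finset.prod_ite_mem, Finset.univ_inter]
    rw [hs, ← Finset.prod_mul_distrib]
    refine Finset.prod_congr rfl fun a _ => ?_
    unfold eulerCharpoly
    split_ifs with h
    · rw [Polynomial.eval_mul, Polynomial.eval_X, mul_charpoly_derivative_eval _ _
        (det_smul_one_sub_ne_zero U (hx a)), Fintype.card_fin]
    · rw [mul_one]
  · intro a U
    unfold eulerCharpoly
    have hdeg : (U : Matrix (Fin n) (Fin n) ℂ).charpoly.natDegree = n := by
      rw [charpoly_natDegree_eq_dim, Fintype.card_fin]
    split_ifs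
    · by_cases h0 : (U : Matrix (Fin n) (Fin n) ℂ).charpoly.derivative = 0
      · simp [h0]
      · rw [Polynomial.natDegree_X_mul h0]
        have h2 : (U : Matrix (Fin n) (Fin n) ℂ).charpoly.natDegree ≠ 0 := by
          intro h3
          rw [Polynomial.natDegree_eq_zero] at h3
          obtain ⟨c, hc⟩ := h3
          rw [← hc] at h0
          simp at h0
        have h1 := Polynomial.natDegree_derivative_lt h2
        omega
    · exact hdeg.le
  · refine integrable_twisted_coeff r _ fun a k => ?_
    unfold eulerCharpoly
    split_ifs
    · cases k with
      | zero => simpa using continuous_const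
      | succ k =>
        simp_rw [Polynomial.coeff_X_mul, Polynomial.coeff_derivative]
        exact (continuous_charpoly_coeff _).mul continuous_const
    · exact continuous_charpoly_coeff k

theorem expectedProd_eulerCharpoly_empty (r : ℕ) :
    expectedProd (cueMeasure n) n
      (fun U : unitaryGroup (Fin n) ℂ => star (U : Matrix (Fin n) (Fin n) ℂ).det ^ r)
      (eulerCharpoly (∅ : Finset κ)) = charpolyMoment n r κ := by
  rw [charpolyMoment]
  congr 1


theorem eulerDerivation_expectedProd_eulerCharpoly (r : ℕ) (s : Finset κ) (a : κ) (ha : a ∉ s) :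
    eulerDerivation a (expectedProd (cueMeasure n) n
      (fun U : unitaryGroup (Fin n) ℂ => star (U : Matrix (Fin n) (Fin n) ℂ).det ^ r)
      (eulerCharpoly s)) =
    expectedProd (cueMeasure n) n
      (fun U : unitaryGroup (Fin n) ℂ => star (U : Matrix (Fin n) (Fin n) ℂ).det ^ r)
      (eulerCharpoly (insert a s)) := by
  rw [eulerDerivation_expectedProd]
  congr 1
  ext1 b
  by_cases h : b = a
  · subst h
    rw [Function.update_self]
    ext1 U
    simp [eulerCharpoly, ha]
  · rw [Function.update_of_ne h]
    ext1 U
    simp [eulerCharpoly, h]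

theorem eval_eulerDerivation_charpolyMoment (r : ℕ) (x : κ → ℂ) (hx : ∀ a, 1 < ‖x a‖) (a : κ) :
    eval x (eulerDerivation a (charpolyMoment n r κ)) =
      ∫ U, twistedCharpolyProd r x U *
        (n + (mulResolvent (U : Matrix (Fin n) (Fin n) ℂ) (x a)).trace) ∂(cueMeasure n) := by
  rw [← expectedProd_eulerCharpoly_empty, eulerDerivation_expectedProd_eulerCharpoly _ _ _ (by simp),
    eval_expectedProd_eulerCharpoly r _ x hx]
  simp

theorem eval_eulerDerivation_eulerDerivation_charpolyMoment (r : ℕ) (x : κ → ℂ)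
    (hx : ∀ a, 1 < ‖x a‖) (a b : κ) (hab : a ≠ b) :
    eval x (eulerDerivation a (eulerDerivation b (charpolyMoment n r κ))) =
      ∫ U, twistedCharpolyProd r x U *
        ((n + (mulResolvent (U : Matrix (Fin n) (Fin n) ℂ) (x a)).trace) *
        (n + (mulResolvent (U : Matrix (Fin n) (Fin n) ℂ) (x b)).trace)) ∂(cueMeasure n) := by
  rw [← expectedProd_eulerCharpoly_empty, eulerDerivation_expectedProd_eulerCharpoly _ _ _ (by simp),
    eulerDerivation_expectedProd_eulerCharpoly _ _ _ (by simpa using hab),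
    eval_expectedProd_eulerCharpoly r _ x hx]
  simp [hab]

theorem sum_eval_eulerDerivation_charpolyMoment (r : ℕ) (x : κ → ℂ) (hx : ∀ a, 1 < ‖x a‖) :
    ∑ a, eval x (eulerDerivation a (charpolyMoment n r κ)) =
      (Fintype.card κ - r) * n * eval x (charpolyMoment n r κ) := by
  have hF := integrable_cue_of_continuous (continuous_twistedCharpolyProd (n := n) r x)
  have hG : ∀ a, Integrable (fun U : unitaryGroup (Fin n) ℂ => twistedCharpolyProd r x U *
      (mulResolvent (U : Matrix (Fin n) (Fin n) ℂ) (x a)).trace) (cueMeasure n) := fun a =>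
    integrable_cue_of_continuous ((continuous_twistedCharpolyProd (n := n) r x).mul
      (continuous_mulResolvent (hx a)).matrix_trace)
  have h1 := integral_trace_loop (n := n) r x hx
  simp_rw [Finset.mul_sum] at h1
  rw [integral_finsetSum _ fun a _ => hG a, ← eval_charpolyMoment] at h1
  have h2 : ∀ a, eval x (eulerDerivation a (charpolyMoment n r κ)) =
      n * eval x (charpolyMoment n r κ) + ∫ U, twistedCharpolyProd r x U *
      (mulResolvent (U : Matrix (Fin n) (Fin n) ℂ) (x a)).trace ∂(cueMeasure n) := by
    intro a
    rw [eval_eulerDerivation_charpolyMoment r x hx a, eval_charpolyMoment, ← integral_const_mul,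
      ← integral_add (hF.const_mul _) (hG a)]
    refine integral_congr_ae (Filter.Eventually.of_forall fun U => ?_)
    ring
  rw [Finset.sum_congr rfl fun a _ => h2 a, Finset.sum_add_distrib, h1]
  simp
  ring

theorem integral_linearCombination_four {G : Type*} [MeasurableSpace G] {μ : Measure G}
    {f g h k : G → ℂ} (hf : Integrable f μ) (hg : Integrable g μ) (hh : Integrable h μ)
    (hk : Integrable k μ) (c d e : ℂ) :
    ∫ U, f U + c * g U + d * h U + e * k U ∂μ =
      ∫ U, f U ∂μ + c * ∫ U, g U ∂μ + d * ∫ U, h U ∂μ + e * ∫ U, k U ∂μ := by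
  have h1 : Integrable (fun U => f U + c * g U) μ := hf.add (hg.const_mul c)
  have h2 : Integrable (fun U => f U + c * g U + d * h U) μ := h1.add (hh.const_mul d)
  rw [integral_add h2 (hk.const_mul e), integral_add h1 (hh.const_mul d),
    integral_add hf (hg.const_mul c), integral_const_mul, integral_const_mul, integral_const_mul]

/-- The second loop equation with each trace replaced by an Euler operator minus `n`. The trace of
the product contributes the divided difference, so the points must be distinct. -/
theorem sum_eval_eulerDerivation_pair_charpolyMoment (r : ℕ) (x : κ → ℂ) (hx : ∀ a, 1 < ‖x a‖)
    (hinj : Function.Injective x) :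
    ∑ p ∈ (Finset.univ : Finset κ).offDiag,
      (eval x (eulerDerivation p.1 (eulerDerivation p.2 (charpolyMoment n r κ))) -
        n * (eval x (eulerDerivation p.1 (charpolyMoment n r κ)) +
          eval x (eulerDerivation p.2 (charpolyMoment n r κ))) +
        (n ^ 2 + n) * eval x (charpolyMoment n r κ) -
        (x p.1 * eval x (eulerDerivation p.1 (charpolyMoment n r κ)) -
          x p.2 * eval x (eulerDerivation p.2 (charpolyMoment n r κ))) / (x p.1 - x p.2)) =
      n * (n + 1) * (r * (r - 1)) * eval x (charpolyMoment n r κ) := by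
  set F := twistedCharpolyProd (n := n) r x with hFdef
  have hFc := continuous_twistedCharpolyProd (n := n) r x
  have hG := fun a => (continuous_mulResolvent (n := n) (hx a)).matrix_trace
  have hF := integrable_cue_of_continuous hFc
  have hI1 : ∀ a, Integrable (fun U : unitaryGroup (Fin n) ℂ => F U *
      (n + (mulResolvent (U : Matrix (Fin n) (Fin n) ℂ) (x a)).trace)) (cueMeasure n) := fun a =>
    integrable_cue_of_continuous (hFc.mul (continuous_const.add (hG a)))
  have hI2 : ∀ a b, Integrable (fun U : unitaryGroup (Fin n) ℂ => F U *
      ((n + (mulResolvent (U : Matrix (Fin n) (Fin n) ℂ) (x a)).trace) *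
      (n + (mulResolvent (U : Matrix (Fin n) (Fin n) ℂ) (x b)).trace))) (cueMeasure n) :=
    fun a b => integrable_cue_of_continuous (hFc.mul ((continuous_const.add (hG a)).mul
      (continuous_const.add (hG b))))
  have hI3 : ∀ a b, Integrable (fun U : unitaryGroup (Fin n) ℂ => F U *
      ((mulResolvent (U : Matrix (Fin n) (Fin n) ℂ) (x a)).trace *
        (mulResolvent (U : Matrix (Fin n) (Fin n) ℂ) (x b)).trace +
      (mulResolvent (U : Matrix (Fin n) (Fin n) ℂ) (x a) *
        mulResolvent (U : Matrix (Fin n) (Fin n) ℂ) (x b)).trace)) (cueMeasure n) := fun a b =>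
    integrable_cue_of_continuous (hFc.mul (((hG a).mul (hG b)).add
      ((continuous_mulResolvent (hx a)).matrix_mul (continuous_mulResolvent (hx b))).matrix_trace))
  rw [eval_charpolyMoment, ← integral_trace_pair_loop r x hx, ← eval_charpolyMoment]
  simp_rw [Finset.mul_sum]
  rw [integral_finsetSum _ fun p _ => hI3 p.1 p.2]
  refine Finset.sum_congr rfl fun p hp => ?_
  obtain ⟨a, b⟩ := p
  have hab : a ≠ b := (Finset.mem_offDiag.mp hp).2.2
  have hxab : x a ≠ x b := fun h => hab (hinj h)
  have hsub : x a - x b ≠ 0 := sub_ne_zero.mpr hxab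
  have hsub' : x b - x a ≠ 0 := sub_ne_zero.mpr hxab.symm
  rw [eval_eulerDerivation_eulerDerivation_charpolyMoment r x hx a b hab,
    eval_eulerDerivation_charpolyMoment r x hx a, eval_eulerDerivation_charpolyMoment r x hx b,
    eval_charpolyMoment]
  have hpt : ∀ U : unitaryGroup (Fin n) ℂ, F U *
      ((mulResolvent (U : Matrix (Fin n) (Fin n) ℂ) (x a)).trace *
        (mulResolvent (U : Matrix (Fin n) (Fin n) ℂ) (x b)).trace +
      (mulResolvent (U : Matrix (Fin n) (Fin n) ℂ) (x a) *
        mulResolvent (U : Matrix (Fin n) (Fin n) ℂ) (x b)).trace) =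
      F U * ((n + (mulResolvent (U : Matrix (Fin n) (Fin n) ℂ) (x a)).trace) *
        (n + (mulResolvent (U : Matrix (Fin n) (Fin n) ℂ) (x b)).trace)) +
      (-n - x a / (x a - x b)) *
        (F U * (n + (mulResolvent (U : Matrix (Fin n) (Fin n) ℂ) (x a)).trace)) +
      (-n + x b / (x a - x b)) *
        (F U * (n + (mulResolvent (U : Matrix (Fin n) (Fin n) ℂ) (x b)).trace)) +
      (n ^ 2 + n) * F U := by
    intro U
    rw [trace_mulResolvent_mul _ _ _ hxab (det_smul_one_sub_ne_zero U (hx a))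
      (det_smul_one_sub_ne_zero U (hx b)), show x b - x a = -(x a - x b) by ring]
    field_simp
    ring
  refine Eq.trans ?_ ((integral_congr_ae (Filter.Eventually.of_forall hpt)).trans
    (integral_linearCombination_four (hI2 a b) (hI1 a) (hI1 b) hF _ _ _)).symm
  dsimp only
  field_simp
  ring

theorem rename_charpolyMoment (r : ℕ) (σ : Equiv.Perm κ) :
    rename σ (charpolyMoment n r κ) = charpolyMoment n r κ := by
  refine MvPolynomial.funext fun x => ?_
  rw [eval_rename, eval_charpolyMoment, eval_charpolyMoment]
  congr 1
  ext U
  simp only [twistedCharpolyProd, Function.comp_apply]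
  rw [Equiv.prod_comp σ fun a => (U : Matrix (Fin n) (Fin n) ℂ).charpoly.eval (x a)]

end CharpolyMoments

/-! ### Alternating polynomials and the Vandermonde determinant. -/

section Alternant

open MvPolynomial Matrix

variable {M : ℕ}

/-- The alternating polynomial `det (X_a ^ S_k)`. -/
def alternant (S : Fin M → ℕ) : MvPolynomial (Fin M) ℂ :=
  (Matrix.of fun a k => (X a : MvPolynomial (Fin M) ℂ) ^ S k).det

theorem alternant_eq_sum (S : Fin M → ℕ) :
    alternant S = ∑ σ : Equiv.Perm (Fin M),
      monomial (Finsupp.equivFunOnFinite.symm (S ∘ σ)) (((Equiv.Perm.sign σ : ℤ) : ℂ)) := by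
  rw [alternant, ← det_transpose, det_apply']
  refine Finset.sum_congr rfl fun σ _ => ?_
  rw [monomial_eq, Finsupp.prod_fintype _ _ (by simp)]
  simp only [transpose_apply, of_apply, Finsupp.equivFunOnFinite_symm_apply_apply,
    Function.comp_apply]
  simp

theorem exists_perm_of_coeff_alternant_ne_zero (S : Fin M → ℕ) (m : Fin M →₀ ℕ)
    (h : (alternant S).coeff m ≠ 0) : ∃ σ : Equiv.Perm (Fin M), ∀ a, m a = S (σ a) := by
  rw [alternant_eq_sum, coeff_sum] at h
  obtain ⟨σ, -, hσ⟩ := Finset.exists_ne_zero_of_sum_ne_zero h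
  rw [coeff_monomial] at hσ
  refine ⟨σ, fun a => ?_⟩
  have : Finsupp.equivFunOnFinite.symm (S ∘ σ) = m := by
    by_contra hne
    exact hσ (if_neg hne)
  rw [← this]; rfl

theorem coeff_alternant_self (S : Fin M → ℕ) (hS : Function.Injective S) :
    (alternant S).coeff (Finsupp.equivFunOnFinite.symm S) = 1 := by
  rw [alternant_eq_sum, coeff_sum, Finset.sum_eq_single 1]
  · simp
  · intro σ _ hσ
    rw [coeff_monomial, if_neg]
    intro h
    apply hσ
    have h2 := Finsupp.equivFunOnFinite.symm.injective h
    ext1 a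
    exact hS (congrFun h2 a)
  · simp

theorem rename_alternant (S : Fin M → ℕ) (σ : Equiv.Perm (Fin M)) :
    rename σ (alternant S) = ((Equiv.Perm.sign σ : ℤ) : MvPolynomial (Fin M) ℂ) * alternant S := by
  rw [alternant, ← det_permute, ← AlgHom.coe_toRingHom, RingHom.map_det]
  congr 1
  ext a k : 2
  simp

/-- A polynomial multiplied by the sign of `σ` when `σ` permutes its variables is determined by one
coefficient if its exponents are all rearrangements of a single one. -/
theorem eq_C_mul_alternant (S : Fin M → ℕ) (hS : Function.Injective S)
    (p : MvPolynomial (Fin M) ℂ)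
    (halt : ∀ σ : Equiv.Perm (Fin M),
      rename σ p = ((Equiv.Perm.sign σ : ℤ) : MvPolynomial (Fin M) ℂ) * p)
    (hsupp : ∀ m, p.coeff m ≠ 0 → ∃ σ : Equiv.Perm (Fin M), ∀ a, m a = S (σ a)) :
    p = C (p.coeff (Finsupp.equivFunOnFinite.symm S)) * alternant S := by
  have hcoeff : ∀ (q : MvPolynomial (Fin M) ℂ), (∀ σ : Equiv.Perm (Fin M),
      rename σ q = ((Equiv.Perm.sign σ : ℤ) : MvPolynomial (Fin M) ℂ) * q) →
      ∀ (σ : Equiv.Perm (Fin M)) (m : Fin M →₀ ℕ), (∀ a, m a = S (σ a)) →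
      q.coeff (Finsupp.equivFunOnFinite.symm S) =
        ((Equiv.Perm.sign σ : ℤ) : ℂ) * q.coeff m := by
    intro q hq σ m hm
    have h1 := congrArg (coeff (Finsupp.equivFunOnFinite.symm S)) (hq σ)
    -- All rearrangements of `S` are carried to `S` by permuting variables, so one coefficient
    -- determines the others up to sign.
    have h2 : Finsupp.equivFunOnFinite.symm S = m.mapDomain σ := by
      ext a
      rw [Finsupp.mapDomain_equiv_apply, hm]
      simp
    rw [← map_intCast (C : ℂ →+* MvPolynomial (Fin M) ℂ), coeff_C_mul, h2,
      coeff_rename_mapDomain _ σ.injective, ← h2] at h1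
    rw [h1, ← mul_assoc, ← Int.cast_mul]
    simp
  have hsgn : ∀ σ : Equiv.Perm (Fin M), ((Equiv.Perm.sign σ : ℤ) : ℂ) ≠ 0 := by
    intro σ
    rcases Int.units_eq_one_or (Equiv.Perm.sign σ) with h | h <;> simp [h]
  ext m
  rw [coeff_C_mul]
  by_cases h : ∃ σ : Equiv.Perm (Fin M), ∀ a, m a = S (σ a)
  · obtain ⟨σ, hσ⟩ := h
    refine mul_left_cancel₀ (hsgn σ) ?_
    rw [← hcoeff p halt σ m hσ, mul_left_comm, ← hcoeff _ (rename_alternant S) σ m hσ,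
      coeff_alternant_self S hS, mul_one]
  · have h1 : p.coeff m = 0 := by
      by_contra hne
      exact h (hsupp m hne)
    have h2 : (alternant S).coeff m = 0 := by
      by_contra hne
      exact h (exists_perm_of_coeff_alternant_ne_zero S m hne)
    rw [h1, h2, mul_zero]

theorem eval_alternant_val (x : Fin M → ℂ) :
    eval x (alternant fun k => (k : ℕ)) = (vandermonde x).det := by
  rw [alternant, RingHom.map_det]
  congr 1
  ext a k
  simp [vandermonde]

theorem alternant_val_ne_zero : alternant (fun k : Fin M => (k : ℕ)) ≠ 0 := by
  intro h
  have h1 := coeff_alternant_self (fun k : Fin M => (k : ℕ)) Fin.val_injective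
  rw [h] at h1
  simp at h1

/-- Multiplying by the Vandermonde polynomial makes the two sides agree also at points with repeated
coordinates; agreement on a product of infinite sets then suffices, and the nonzero factor cancels.
-/
theorem eq_of_eval_eq_of_injective (p q : MvPolynomial (Fin M) ℂ)
    (h : ∀ x : Fin M → ℂ, (∀ a, 1 < ‖x a‖) → Function.Injective x → eval x p = eval x q) :
    p = q := by
  refine mul_left_cancel₀ alternant_val_ne_zero ?_
  have hinf : {z : ℂ | 1 < ‖z‖}.Infinite := by
    refine Set.infinite_of_injective_forall_mem (f := fun k : ℕ => ((k : ℂ) + 2)) ?_ ?_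
    · intro a b hab
      simpa using hab
    · intro k
      have : ((k : ℂ) + 2) = ((k + 2 : ℕ) : ℂ) := by push_cast; ring
      rw [this, Set.mem_ofPred_eq, Complex.norm_natCast]
      push_cast
      linarith [(Nat.cast_nonneg k : (0 : ℝ) ≤ k)]
  refine funext_set (fun _ => {z : ℂ | 1 < ‖z‖}) (fun _ => hinf) fun x hx => ?_
  rw [map_mul, map_mul]
  by_cases hinj : Function.Injective x
  · rw [h x (fun a => hx a trivial) hinj]
  · have : eval x (alternant fun k : Fin M => (k : ℕ)) = 0 := by
      rw [eval_alternant_val]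
      by_contra hne
      exact hinj (det_vandermonde_ne_zero_iff.mp hne)
    rw [this, zero_mul, zero_mul]

theorem eval_derivation_prod {κ ι : Type*}
    (D : Derivation ℂ (MvPolynomial κ ℂ) (MvPolynomial κ ℂ)) (s : Finset ι)
    (f : ι → MvPolynomial κ ℂ) (x : κ → ℂ) (hf : ∀ i ∈ s, eval x (f i) ≠ 0) :
    eval x (D (∏ i ∈ s, f i)) =
      eval x (∏ i ∈ s, f i) * ∑ i ∈ s, eval x (D (f i)) / eval x (f i) := by
  classical
  induction s using Finset.induction_on with
  | empty => simp
  | insert a s ha ih =>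
    have h0 := hf a (Finset.mem_insert_self a s)
    rw [Finset.prod_insert ha, Finset.sum_insert ha, Derivation.leibniz, map_add, smul_eq_mul,
      smul_eq_mul, map_mul, map_mul, map_mul,
      ih fun i hi => hf i (Finset.mem_insert_of_mem hi)]
    field_simp
    ring

/-- Logarithmic differentiation of the product formula. These fractions are what cancels the divided
differences in the second loop equation. -/
theorem eval_eulerDerivation_alternant_val (x : Fin M → ℂ) (hx : Function.Injective x)
    (a : Fin M) :
    eval x (eulerDerivation a (alternant fun k => (k : ℕ))) =
      eval x (alternant fun k => (k : ℕ)) * ∑ c ∈ Finset.univ.erase a, x a / (x a - x c) := by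
  have hV : alternant (fun k : Fin M => (k : ℕ)) =
      ∏ p ∈ (Finset.univ : Finset (Fin M)).sigma fun i => Finset.Ioi i,
        ((X p.2 : MvPolynomial (Fin M) ℂ) - X p.1) := by
    rw [alternant, Finset.prod_sigma, ← det_vandermonde]
    rfl
  have hne : ∀ i j : Fin M, i ≠ j → x i - x j ≠ 0 := fun i j hij =>
    sub_ne_zero.mpr fun h => hij (hx h)
  have hX : ∀ j, eval x (eulerDerivation a (X j : MvPolynomial (Fin M) ℂ)) =
      if j = a then x a else 0 := by
    intro j
    rw [eulerDerivation, Derivation.smul_apply, pderiv_X]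
    by_cases h : j = a
    · subst h; simp
    · simp [h]
  rw [hV, eval_derivation_prod]
  swap
  · intro p hp
    have := (Finset.mem_Ioi.mp (Finset.mem_sigma.mp hp).2)
    simpa using hne _ _ this.ne'
  congr 1
  rw [Finset.sum_sigma]
  simp only [map_sub, hX, eval_X]
  have h1 : ∀ i, ∑ j ∈ Finset.Ioi i,
      ((if j = a then x a else 0) - if i = a then x a else 0) / (x j - x i) =
      (if i < a then x a / (x a - x i) else 0) +
        if i = a then ∑ j ∈ Finset.Ioi a, x a / (x a - x j) else 0 := by
    intro i
    simp_rw [sub_div]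
    rw [Finset.sum_sub_distrib, sub_eq_add_neg]
    congr 1
    · simp only [ite_div, zero_div]
      rw [Finset.sum_ite_eq']
      simp
    · split_ifs with h
      · subst h
        rw [← Finset.sum_neg_distrib]
        exact Finset.sum_congr rfl fun j _ => by rw [← neg_sub (x j), div_neg]
      · simp
  rw [Finset.sum_congr rfl fun i _ => h1 i, Finset.sum_add_distrib, Finset.sum_ite_eq',
    if_pos (Finset.mem_univ a), ← Finset.sum_filter]
  have h2 : (Finset.univ.erase a : Finset (Fin M)) =
      Finset.univ.filter (· < a) ∪ Finset.Ioi a := by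
    ext c
    simp [lt_or_lt_iff_ne]
  rw [h2, Finset.sum_union]
  rw [Finset.disjoint_left]
  intro c hc hc2
  simp at hc hc2
  exact absurd hc hc2.not_gt

/-- The exponents of every monomial in an alternant are a rearrangement of `S`, so operators
symmetric in the variables act on it by a scalar. -/
theorem sum_eulerDerivation_alternant (S : Fin M → ℕ) :
    ∑ a, eulerDerivation a (alternant S) = C (∑ k, (S k : ℂ)) * alternant S := by
  ext m
  rw [coeff_sum, coeff_C_mul]
  simp_rw [coeff_eulerDerivation]
  rw [← Finset.sum_mul]
  by_cases h : (alternant S).coeff m = 0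
  · simp [h]
  · obtain ⟨σ, hσ⟩ := exists_perm_of_coeff_alternant_ne_zero S m h
    congr 1
    rw [← Equiv.sum_comp σ fun k => (S k : ℂ)]
    simp [hσ]

theorem sum_eulerDerivation_pair_alternant (S : Fin M → ℕ) :
    ∑ p ∈ (Finset.univ : Finset (Fin M)).offDiag,
      eulerDerivation p.1 (eulerDerivation p.2 (alternant S)) =
      C ((∑ k, (S k : ℂ)) ^ 2 - ∑ k, (S k : ℂ) ^ 2) * alternant S := by
  ext m
  rw [coeff_sum, coeff_C_mul]
  simp_rw [coeff_eulerDerivation, ← mul_assoc]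
  rw [← Finset.sum_mul, sum_offDiag_eq_sub fun a b => ((m a : ℂ) * (m b : ℂ)),
    ← Finset.sum_mul_sum]
  by_cases h : (alternant S).coeff m = 0
  · simp [h]
  · obtain ⟨σ, hσ⟩ := exists_perm_of_coeff_alternant_ne_zero S m h
    congr 1
    rw [← Equiv.sum_comp σ fun k => (S k : ℂ), ← Equiv.sum_comp σ fun k => (S k : ℂ) ^ 2]
    simp [hσ, sq]

theorem degreeOf_alternant_val_le (a : Fin M) :
    degreeOf a (alternant fun k : Fin M => (k : ℕ)) ≤ M - 1 := by
  rw [alternant_eq_sum]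
  refine (degreeOf_sum_le _ _ _).trans (Finset.sup_le fun σ _ => ?_)
  rw [degreeOf_monomial_eq _ _ (by
    rcases Int.units_eq_one_or (Equiv.Perm.sign σ) with h | h <;> simp [h])]
  simp only [Finsupp.equivFunOnFinite_symm_apply_apply, Function.comp_apply]
  omega

end Alternant

/-! ### The Toeplitz determinant as a quotient of alternants. -/

section ToeplitzDeterminant

open Matrix

variable {R : Type*} [CommRing R]

/-- The Toeplitz matrix of the Laurent polynomial `z ^ (-r) * q`. -/
def polynomialToeplitz (n r : ℕ) (q : Polynomial R) : Matrix (Fin n) (Fin n) R :=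
  Matrix.of fun j k => (Polynomial.X ^ (j : ℕ) * q).coeff (r + k)

/-- The exponents `0, …, r - 1, n + r, …, n + 2 r - 1`. -/
def outerExponent (n r : ℕ) (k : Fin (2 * r)) : ℕ := if (k : ℕ) < r then k else n + k

theorem outerExponent_injective (n r : ℕ) : Function.Injective (outerExponent n r) := by
  intro a b h
  unfold outerExponent at h
  ext
  split_ifs at h <;> omega

/-- The rows of `A` are unit vectors and the coefficients of `X ^ j * q`; the columns of `W` are the
powers of each root `x b` and unit vectors. Since `X ^ j * q` vanishes at every root, `A * W` is
block triangular. Comparing determinants gives the identity, and the sign is that of the reordering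
of the exponents. The sign does not depend on the ring, so it serves both for polynomials and for
their values. -/
theorem exists_sign_det_polynomialToeplitz (n r : ℕ) :
    ∃ ε : ℤˣ, ∀ {R : Type} [CommRing R] (x : Fin (2 * r) → R),
      (polynomialToeplitz n r (∏ a, (Polynomial.C (x a) - Polynomial.X))).det *
        (((ε : ℤ) : R) * (vandermonde x).det) =
      (Matrix.of fun a k => x a ^ outerExponent n r k).det := by
  set e : Fin (2 * r) ⊕ Fin n → Fin (n + 2 * r) := Sum.elim
    (fun a => ⟨outerExponent n r a, by unfold outerExponent; split_ifs <;> omega⟩)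
    (fun k => ⟨r + k, by omega⟩) with he
  set e₀ : Fin (2 * r) ⊕ Fin n → Fin (n + 2 * r) := Sum.elim
    (fun a => ⟨a, by omega⟩) (fun k => ⟨2 * r + k, by omega⟩) with he₀
  have hebij : Function.Bijective e := by
    rw [Fintype.bijective_iff_injective_and_card]
    refine ⟨?_, by simp; omega⟩
    rintro (a | a) (b | b) h <;> simp only [he, Sum.elim_inl, Sum.elim_inr, Fin.mk.injEq] at h
    · rw [outerExponent_injective n r h]
    · unfold outerExponent at h; split_ifs at h <;> omega
    · unfold outerExponent at h; split_ifs at h <;> omega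
    · congr 1; ext; omega
  have he₀bij : Function.Bijective e₀ := by
    rw [Fintype.bijective_iff_injective_and_card]
    refine ⟨?_, by simp; omega⟩
    rintro (a | a) (b | b) h <;> simp only [he₀, Sum.elim_inl, Sum.elim_inr, Fin.mk.injEq] at h
    · congr 1; ext; exact h
    · omega
    · omega
    · congr 1; ext; omega
  set σ : Equiv.Perm (Fin (2 * r) ⊕ Fin n) :=
    (Equiv.ofBijective e hebij).trans (Equiv.ofBijective e₀ he₀bij).symm with hσ
  have hσe : ∀ i, e₀ (σ i) = e i := fun i =>
    (Equiv.ofBijective e₀ he₀bij).apply_symm_apply (e i)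
  refine ⟨Equiv.Perm.sign σ, fun {R} _ x => ?_⟩
  set q : Polynomial R := ∏ a, (Polynomial.C (x a) - Polynomial.X) with hq
  have hqdeg : q.natDegree ≤ 2 * r := by
    refine (Polynomial.natDegree_prod_le _ _).trans ?_
    refine (Finset.sum_le_card_nsmul _ _ 1 fun a _ => ?_).trans (by simp)
    compute_degree
  have hqlead : q.coeff (2 * r) = 1 := by
    have h1 : q = (-1) ^ (2 * r) * ∏ a, (Polynomial.X - Polynomial.C (x a)) := by
      rw [hq]
      have : ∀ a, Polynomial.C (x a) - Polynomial.X =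
          (-1) * (Polynomial.X - Polynomial.C (x a)) := fun a => by ring
      rw [Finset.prod_congr rfl fun a _ => this a, Finset.prod_mul_distrib]
      simp
    rw [h1, pow_mul, neg_one_sq, one_pow, one_mul]
    rcases subsingleton_or_nontrivial R with hR | hR
    · exact Subsingleton.elim _ _
    have h2 := Polynomial.monic_prod_of_monic Finset.univ
      (fun a => Polynomial.X - Polynomial.C (x a)) fun a _ => Polynomial.monic_X_sub_C (x a)
    have h3 : (∏ a, (Polynomial.X - Polynomial.C (x a))).natDegree = 2 * r := by
      rw [Polynomial.natDegree_prod_of_monic _ _ fun a _ => Polynomial.monic_X_sub_C (x a)]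
      simp
    have h4 := h2.coeff_natDegree
    rwa [h3] at h4
  have hXq : ∀ j : Fin n, (Polynomial.X ^ (j : ℕ) * q).natDegree < n + 2 * r := by
    intro j
    refine (Polynomial.natDegree_mul_le.trans
      (add_le_add (Polynomial.natDegree_X_pow_le _) hqdeg)).trans_lt ?_
    omega
  set A : Matrix (Fin (2 * r) ⊕ Fin n) (Fin (2 * r) ⊕ Fin n) R := fromBlocks 1 0
    (Matrix.of fun j a => (Polynomial.X ^ (j : ℕ) * q).coeff (outerExponent n r a))
    (polynomialToeplitz n r q) with hA
  set W₀ : Matrix (Fin (2 * r) ⊕ Fin n) (Fin (2 * r) ⊕ Fin n) R := Matrix.of fun i =>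
    Sum.elim (fun a => x a ^ (e₀ i : ℕ)) (fun k : Fin n => if (e₀ i : ℕ) = 2 * r + k then 1 else 0)
    with hW₀
  set W : Matrix (Fin (2 * r) ⊕ Fin n) (Fin (2 * r) ⊕ Fin n) R := W₀.submatrix σ id with hW
  have hAdet : A.det = (polynomialToeplitz n r q).det := by
    rw [hA, det_fromBlocks_zero₁₂, det_one, one_mul]
  have hW₀det : W₀.det = (vandermonde x).det := by
    have : W₀ = fromBlocks (vandermonde x)ᵀ 0
        (Matrix.of fun (k : Fin n) a => x a ^ (2 * r + k : ℕ)) 1 := by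
      ext i j
      rcases i with a | k <;> rcases j with b | l
      · simp [hW₀, he₀, vandermonde]
      · have : (a : ℕ) ≠ 2 * r + l := by omega
        simp [hW₀, he₀, this]
      · simp [hW₀, he₀]
      · simp [hW₀, he₀, one_apply, Fin.ext_iff]
    rw [this, det_fromBlocks_zero₁₂, det_one, mul_one, det_transpose]
  have hWdet : W.det = ((Equiv.Perm.sign σ : ℤ) : R) * (vandermonde x).det := by
    rw [hW, det_permute, hW₀det]
  have hWapp : ∀ i, W i = Sum.elim (fun a => x a ^ (e i : ℕ))
      (fun k : Fin n => if (e i : ℕ) = 2 * r + k then 1 else 0) := by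
    intro i
    ext j
    simp [hW, hW₀, hσe]
  have hrow : ∀ (j : Fin n) (i), A (Sum.inr j) i = (Polynomial.X ^ (j : ℕ) * q).coeff (e i) := by
    intro j i
    rcases i with a | k <;> simp [hA, he, polynomialToeplitz]
  have hAW : A * W = fromBlocks (Matrix.of fun a k => x k ^ outerExponent n r a)
      (Matrix.of fun a (k : Fin n) => if outerExponent n r a = 2 * r + k then 1 else 0) 0
      (Matrix.of fun j k : Fin n => (Polynomial.X ^ (j : ℕ) * q).coeff (2 * r + k)) := by
    ext i j
    rcases i with a | l
    · have : (A * W) (Sum.inl a) j = W (Sum.inl a) j := by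
        rw [Matrix.mul_apply, Fintype.sum_sum_type]
        simp [hA, one_apply]
      rw [this, hWapp]
      rcases j with b | k <;> simp [he]
    · rw [Matrix.mul_apply, Finset.sum_congr rfl fun i _ => by rw [hrow, hWapp]]
      rcases j with b | k
      · simp only [Sum.elim_inl, fromBlocks_apply₂₁, Matrix.zero_apply]
        refine (hebij.sum_comp
          fun t : Fin (n + 2 * r) => (Polynomial.X ^ (l : ℕ) * q).coeff t * x b ^ (t : ℕ)).trans ?_
        refine (Finset.sum_range fun t =>
          (Polynomial.X ^ (l : ℕ) * q).coeff t * x b ^ t).symm.trans ?_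
        rw [← Polynomial.eval_eq_sum_range' (hXq l), Polynomial.eval_mul, hq, Polynomial.eval_prod,
          Finset.prod_eq_zero (Finset.mem_univ b) (by simp), mul_zero]
      · simp only [Sum.elim_inr, fromBlocks_apply₂₂, of_apply]
        refine (hebij.sum_comp
          fun t : Fin (n + 2 * r) => (Polynomial.X ^ (l : ℕ) * q).coeff t *
            (if (t : ℕ) = 2 * r + k then 1 else 0)).trans ?_
        rw [Finset.sum_eq_single ⟨2 * r + k, by omega⟩]
        · simp
        · intro t _ ht
          rw [if_neg, mul_zero]
          intro h
          exact ht (Fin.ext h)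
        · simp
  -- The top coefficient of `q`, at exponent `2 r`, sits on the diagonal and nothing lies above it.
  have hT₀ : (Matrix.of fun j k : Fin n =>
      (Polynomial.X ^ (j : ℕ) * q).coeff (2 * r + k)).det = 1 := by
    rw [det_of_isLowerTriangular]
    · refine Finset.prod_eq_one fun j _ => ?_
      rw [of_apply, add_comm, Polynomial.coeff_X_pow_mul', if_pos (by omega), Nat.add_sub_cancel_left,
        hqlead]
    · intro j k hjk
      have hjk' : (j : ℕ) < k := hjk
      rw [of_apply]
      refine Polynomial.coeff_eq_zero_of_natDegree_lt ((Polynomial.natDegree_mul_le.trans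
        (add_le_add (Polynomial.natDegree_X_pow_le _) hqdeg)).trans_lt ?_)
      omega
  have hfinal := congrArg det hAW
  rw [det_mul, det_fromBlocks_zero₂₁, hT₀, mul_one, hAdet, hWdet, ← det_transpose (Matrix.of _)]
    at hfinal
  exact hfinal

end ToeplitzDeterminant

/-! ### Exponent sequences with prescribed sum and sum of squares. -/

section ExtremalExponents

theorem sum_val_fin_two_mul (r : ℕ) : ∑ k : Fin (2 * r), ((k : ℕ) : ℂ) = r * (2 * r - 1) := by
  have h : ∀ m : ℕ, ∑ k ∈ Finset.range m, (k : ℂ) = m * (m - 1) / 2 := by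
    intro m
    induction m with
    | zero => simp
    | succ m ih => rw [Finset.sum_range_succ, ih]; push_cast; ring
  rw [← Finset.sum_range fun k => (k : ℂ), h]
  push_cast
  ring

theorem sum_fin_two_mul (r : ℕ) (f : ℕ → ℂ) :
    ∑ k : Fin (2 * r), f k = ∑ k ∈ Finset.range r, f k + ∑ k ∈ Finset.range r, f (r + k) := by
  rw [← Finset.sum_range f, two_mul, Finset.sum_range_add]

theorem sum_outerExponent (n r : ℕ) :
    ∑ k : Fin (2 * r), (outerExponent n r k : ℂ) =
      ∑ k : Fin (2 * r), ((k : ℕ) : ℂ) + r * n := by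
  unfold outerExponent
  rw [sum_fin_two_mul r fun k => ((if k < r then k else n + k : ℕ) : ℂ),
    sum_fin_two_mul r fun k => (k : ℂ), add_assoc]
  congr 1
  · exact Finset.sum_congr rfl fun k hk => by rw [if_pos (Finset.mem_range.mp hk)]
  · rw [Finset.sum_congr rfl fun k _ => by rw [if_neg (by omega : ¬ r + k < r)]]
    push_cast
    simp only [Finset.sum_add_distrib, Finset.sum_const, Finset.card_range, nsmul_eq_mul]
    ring

theorem sum_outerExponent_sq (n r : ℕ) :
    ∑ k : Fin (2 * r), (outerExponent n r k : ℂ) ^ 2 =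
      ∑ k : Fin (2 * r), ((k : ℕ) : ℂ) ^ 2 + r * n ^ 2 + n * r * (3 * r - 1) := by
  have h : ∀ m : ℕ, ∑ k ∈ Finset.range m, (k : ℂ) = m * (m - 1) / 2 := by
    intro m
    induction m with
    | zero => simp
    | succ m ih => rw [Finset.sum_range_succ, ih]; push_cast; ring
  unfold outerExponent
  rw [sum_fin_two_mul r fun k => ((if k < r then k else n + k : ℕ) : ℂ) ^ 2,
    sum_fin_two_mul r fun k => (k : ℂ) ^ 2, add_assoc, add_assoc]
  congr 1
  · exact Finset.sum_congr rfl fun k hk => by rw [if_pos (Finset.mem_range.mp hk)]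
  · rw [Finset.sum_congr rfl fun k _ => by rw [if_neg (by omega : ¬ r + k < r)]]
    have h2 : ∀ k : ℕ, (((n + (r + k) : ℕ) : ℂ)) ^ 2 =
        ((r + k : ℕ) : ℂ) ^ 2 + (2 * n * k + (n ^ 2 + 2 * n * r)) := by
      intro k; push_cast; ring
    rw [Finset.sum_congr rfl fun k _ => h2 k, Finset.sum_add_distrib, Finset.sum_add_distrib,
      ← Finset.mul_sum, h, Finset.sum_const, Finset.card_range, nsmul_eq_mul]
    ring

/-- Among the injective sequences in `[0, n + 2 r)` with the same sum as `outerExponent n r`,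
only its rearrangements have the same sum of squares. -/
theorem exists_perm_eq_outerExponent (n r : ℕ) (hn : 1 ≤ n) (m : Fin (2 * r) → ℕ)
    (hinj : Function.Injective m) (hlt : ∀ a, m a < n + 2 * r)
    (h1 : ∑ a, (m a : ℂ) = ∑ k, (outerExponent n r k : ℂ))
    (h2 : ∑ a, (m a : ℂ) ^ 2 = ∑ k, (outerExponent n r k : ℂ) ^ 2) :
    ∃ σ : Equiv.Perm (Fin (2 * r)), ∀ a, m a = outerExponent n r (σ a) := by
  classical
  -- This quadratic is nonnegative exactly on the gap `r, …, n + r - 1` left by the outer exponents.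
  -- Its sum over `2 r` exponents depends only on their sum and sum of squares, so exchanging an
  -- outer exponent for one in the gap would raise a fixed quantity.
  set g : ℕ → ℤ := fun e => ((e : ℤ) - r) * (n + r - 1 - e) with hg
  set A := Finset.univ.image m with hA
  set B := Finset.univ.image (outerExponent n r) with hB
  have hcA : A.card = 2 * r := by
    rw [hA, Finset.card_image_of_injective _ hinj]; simp
  have hcB : B.card = 2 * r := by
    rw [hB, Finset.card_image_of_injective _ (outerExponent_injective n r)]; simp
  have hsum : ∑ e ∈ A, g e = ∑ e ∈ B, g e := by
    rw [hA, hB, Finset.sum_image fun a _ b _ h => hinj h,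
      Finset.sum_image fun a _ b _ h => outerExponent_injective n r h]
    have hz1 : ∑ a, (m a : ℤ) = ∑ k, (outerExponent n r k : ℤ) := by exact_mod_cast h1
    have hz2 : ∑ a, (m a : ℤ) ^ 2 = ∑ k, (outerExponent n r k : ℤ) ^ 2 := by exact_mod_cast h2
    have hge : ∀ e : ℕ, g e = (n + 2 * r - 1) * (e : ℤ) - (e : ℤ) ^ 2 - r * (n + r - 1) := by
      intro e; simp only [hg]; ring
    simp only [hge, Finset.sum_sub_distrib, ← Finset.mul_sum, hz1, hz2]
  have hAnonneg : ∀ e ∈ A, e ∉ B → 0 ≤ g e := by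
    intro e he heB
    obtain ⟨a, -, rfl⟩ := Finset.mem_image.mp he
    have hla := hlt a
    have h3 : ∀ k : Fin (2 * r), outerExponent n r k ≠ m a := fun k hk =>
      heB (Finset.mem_image.mpr ⟨k, Finset.mem_univ _, hk⟩)
    unfold outerExponent at h3
    have h4 : r ≤ m a := by
      by_contra hlt'
      have := h3 ⟨m a, by omega⟩
      simp at this
      omega
    have h5 : m a < n + r := by
      by_contra hge
      have := h3 ⟨m a - n, by omega⟩
      rw [if_neg (by simp only; omega)] at this
      simp only at this
      omega
    apply mul_nonneg <;> omega
  -- Strictness at `e = r - 1` and `e = n + r` is where `1 ≤ n` enters.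
  have hBneg : ∀ e ∈ B, g e < 0 := by
    intro e he
    obtain ⟨k, -, rfl⟩ := Finset.mem_image.mp he
    unfold outerExponent
    have := k.2
    split_ifs with h
    · apply mul_neg_of_neg_of_pos <;> omega
    · apply mul_neg_of_pos_of_neg <;> push_cast <;> omega
  have hsub : B \ A = ∅ := by
    by_contra hne
    have hne' := Finset.nonempty_iff_ne_empty.mpr hne
    have h3 : ∑ e ∈ B \ A, g e < 0 :=
      Finset.sum_neg (fun e he => hBneg e (Finset.mem_sdiff.mp he).1) hne'
    have h4 : 0 ≤ ∑ e ∈ A \ B, g e := Finset.sum_nonneg fun e he =>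
      hAnonneg e (Finset.mem_sdiff.mp he).1 (Finset.mem_sdiff.mp he).2
    have h5 := Finset.sum_inter_add_sum_sdiff A B g
    have h6 := Finset.sum_inter_add_sum_sdiff B A g
    rw [Finset.inter_comm] at h6
    linarith
  have hBA : B = A := Finset.eq_of_subset_of_card_le (Finset.sdiff_eq_empty_iff_subset.mp hsub)
    (by rw [hcA, hcB])
  have hex : ∀ a, ∃ k, outerExponent n r k = m a := by
    intro a
    have : m a ∈ B := by rw [hBA]; exact Finset.mem_image_of_mem _ (Finset.mem_univ _)
    obtain ⟨k, -, hk⟩ := Finset.mem_image.mp this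
    exact ⟨k, hk⟩
  choose f hf using hex
  have hfinj : Function.Injective f := fun a b hab => hinj (by rw [← hf a, ← hf b, hab])
  exact ⟨Equiv.ofBijective f (Finite.injective_iff_bijective.mp hfinj), fun a => (hf a).symm⟩

end ExtremalExponents

/-! ### The moment polynomial times the Vandermonde is a single alternant. -/

section HeineSzego

open MvPolynomial Matrix

variable {n : ℕ}

theorem sum_eulerDerivation_charpolyMoment (r M : ℕ) :
    ∑ a, eulerDerivation a (charpolyMoment n r (Fin M)) =
      C (((M : ℂ) - r) * n) * charpolyMoment n r (Fin M) := by
  refine eq_of_eval_eq_of_injective _ _ fun x hx _ => ?_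
  rw [map_sum, sum_eval_eulerDerivation_charpolyMoment r x hx]
  simp

theorem sum_eulerDerivation_alternant_mul_charpolyMoment (r M : ℕ) :
    ∑ a, eulerDerivation a ((alternant fun k : Fin M => (k : ℕ)) *
        charpolyMoment n r (Fin M)) =
      C (∑ k : Fin M, ((k : ℕ) : ℂ) + ((M : ℂ) - r) * n) *
        ((alternant fun k : Fin M => (k : ℕ)) * charpolyMoment n r (Fin M)) := by
  simp_rw [Derivation.leibniz, smul_eq_mul]
  rw [Finset.sum_add_distrib, ← Finset.mul_sum, ← Finset.mul_sum,
    sum_eulerDerivation_charpolyMoment, sum_eulerDerivation_alternant, map_add]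
  ring

/-- Write `Δ` for the Vandermonde polynomial and `Ψ` for the moment. In the Leibniz expansion the
cross terms `(D_a Δ) (D_b Ψ)`, summed over `a ≠ b`, equal the full product of sums minus the terms
`a = b`. Those diagonal terms cancel the divided differences in the equation for `Ψ`, which leaves
an eigenvalue equation with constant coefficients. -/
theorem sum_eulerDerivation_pair_alternant_mul_charpolyMoment (r M : ℕ) :
    ∑ p ∈ (Finset.univ : Finset (Fin M)).offDiag,
      eulerDerivation p.1 (eulerDerivation p.2 ((alternant fun k : Fin M => (k : ℕ)) *
        charpolyMoment n r (Fin M))) =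
      C (((∑ k : Fin M, ((k : ℕ) : ℂ)) ^ 2 - ∑ k : Fin M, ((k : ℕ) : ℂ) ^ 2) +
        2 * (∑ k : Fin M, ((k : ℕ) : ℂ)) * (((M : ℂ) - r) * n) +
        2 * n * (M - 1) * (((M : ℂ) - r) * n) - M * (M - 1) * (n ^ 2 + n) +
        n * (n + 1) * (r * (r - 1))) *
        ((alternant fun k : Fin M => (k : ℕ)) * charpolyMoment n r (Fin M)) := by
  refine eq_of_eval_eq_of_injective _ _ fun x hx hinj => ?_
  set Δ := alternant fun k : Fin M => (k : ℕ) with hΔ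
  set Ψ := charpolyMoment n r (Fin M) with hΨ
  have hpairΨ := sum_eval_eulerDerivation_pair_charpolyMoment (n := n) r x hx hinj
  have hpairΔ := congrArg (eval x) (sum_eulerDerivation_pair_alternant fun k : Fin M => (k : ℕ))
  have hΨ1 := congrArg (eval x) (sum_eulerDerivation_charpolyMoment (n := n) r M)
  have hΔ1 := congrArg (eval x) (sum_eulerDerivation_alternant fun k : Fin M => (k : ℕ))
  rw [← hΨ] at hpairΨ hΨ1
  rw [← hΔ] at hpairΔ hΔ1
  simp only [map_sum, map_mul, eval_C] at hpairΔ hΨ1 hΔ1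
  set u : Fin M → ℂ := fun a => eval x (eulerDerivation a Ψ) with hu
  set v : Fin M → ℂ := fun a => eval x (eulerDerivation a Δ) with hv
  change ∑ a, u a = _ at hΨ1
  change ∑ a, v a = _ at hΔ1
  have hsplit : ∀ p : Fin M × Fin M,
      eval x (eulerDerivation p.1 (eulerDerivation p.2 (Δ * Ψ))) =
      eval x (eulerDerivation p.1 (eulerDerivation p.2 Δ)) * eval x Ψ +
        (u p.1 * v p.2 + u p.2 * v p.1) +
        eval x Δ * eval x (eulerDerivation p.1 (eulerDerivation p.2 Ψ)) := by
    intro p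
    simp only [Derivation.leibniz, smul_eq_mul, map_add, map_mul, hu, hv]
    ring
  have hv_eq : ∀ a, v a = eval x Δ * ∑ c ∈ Finset.univ.erase a, x a / (x a - x c) :=
    fun a => eval_eulerDerivation_alternant_val x hinj a
  have huv : ∑ a, u a * v a = eval x Δ * ∑ p ∈ (Finset.univ : Finset (Fin M)).offDiag,
      x p.1 * u p.1 / (x p.1 - x p.2) := by
    rw [Finset.mul_sum]
    have hoff : (Finset.univ : Finset (Fin M)).offDiag =
        (Finset.univ ×ˢ Finset.univ).filter fun p : Fin M × Fin M => p.1 ≠ p.2 := by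
      ext p; simp
    rw [hoff, Finset.sum_filter, Finset.sum_product]
    refine Finset.sum_congr rfl fun a _ => ?_
    rw [← Finset.sum_filter, hv_eq, mul_left_comm, Finset.mul_sum, Finset.mul_sum]
    refine Finset.sum_congr ?_ fun c _ => by ring
    ext c
    simp [eq_comm]
  have hswap : ∀ f : Fin M × Fin M → ℂ, ∑ p ∈ (Finset.univ : Finset (Fin M)).offDiag, f p.swap =
      ∑ p ∈ (Finset.univ : Finset (Fin M)).offDiag, f p := by
    intro f
    refine Finset.sum_nbij' Prod.swap Prod.swap ?_ ?_ ?_ ?_ ?_ <;> simp +contextual [eq_comm]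
  -- Exchanging the two indices makes both halves of the divided difference equal.
  have hS : ∑ p ∈ (Finset.univ : Finset (Fin M)).offDiag,
      (x p.1 * u p.1 - x p.2 * u p.2) / (x p.1 - x p.2) =
      2 * ∑ p ∈ (Finset.univ : Finset (Fin M)).offDiag, x p.1 * u p.1 / (x p.1 - x p.2) := by
    rw [two_mul]
    nth_rewrite 3 [← hswap]
    rw [← Finset.sum_add_distrib]
    refine Finset.sum_congr rfl fun p _ => ?_
    rw [Prod.fst_swap, Prod.snd_swap, sub_div, ← neg_sub (x p.1) (x p.2), div_neg, sub_eq_add_neg]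
  have huv2 : ∑ p ∈ (Finset.univ : Finset (Fin M)).offDiag, (u p.1 * v p.2 + u p.2 * v p.1) =
      2 * ((∑ a, u a) * (∑ a, v a) - ∑ a, u a * v a) := by
    have h : ∑ p ∈ (Finset.univ : Finset (Fin M)).offDiag, u p.2 * v p.1 =
        ∑ p ∈ (Finset.univ : Finset (Fin M)).offDiag, u p.1 * v p.2 :=
      hswap fun p => u p.1 * v p.2
    rw [Finset.sum_add_distrib, h,
      sum_offDiag_eq_sub fun a b => u a * v b, Finset.sum_mul_sum]
    ring
  have hu2 : ∑ p ∈ (Finset.univ : Finset (Fin M)).offDiag, (n : ℂ) * (u p.1 + u p.2) =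
      2 * n * (M - 1) * ∑ a, u a := by
    have h : ∑ p ∈ (Finset.univ : Finset (Fin M)).offDiag, u p.2 =
        ∑ p ∈ (Finset.univ : Finset (Fin M)).offDiag, u p.1 := hswap fun p => u p.1
    rw [← Finset.mul_sum, Finset.sum_add_distrib, h,
      sum_offDiag_eq_sub fun a _ => u a]
    simp [← Finset.mul_sum]
    ring
  have hcard : ∑ _p ∈ (Finset.univ : Finset (Fin M)).offDiag, ((n : ℂ) ^ 2 + n) * eval x Ψ =
      M * (M - 1) * (n ^ 2 + n) * eval x Ψ := by
    rw [sum_offDiag_eq_sub fun _ _ => ((n : ℂ) ^ 2 + n) * eval x Ψ]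
    simp
    ring
  change ∑ p ∈ (Finset.univ : Finset (Fin M)).offDiag,
      (eval x (eulerDerivation p.1 (eulerDerivation p.2 Ψ)) - n * (u p.1 + u p.2) +
        (n ^ 2 + n) * eval x Ψ - (x p.1 * u p.1 - x p.2 * u p.2) / (x p.1 - x p.2)) = _ at hpairΨ
  rw [Finset.sum_sub_distrib, Finset.sum_add_distrib, Finset.sum_sub_distrib, hu2, hcard, hS]
    at hpairΨ
  rw [map_sum, Finset.sum_congr rfl fun p _ => hsplit p, Finset.sum_add_distrib,
    Finset.sum_add_distrib, ← Finset.sum_mul, ← Finset.mul_sum, hpairΔ, huv2, huv, hΨ1, hΔ1,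
    map_mul, map_mul, eval_C]
  rw [hΨ1] at hpairΨ
  linear_combination eval x Δ * hpairΨ

theorem rename_alternant_mul_charpolyMoment (r M : ℕ) (σ : Equiv.Perm (Fin M)) :
    rename σ ((alternant fun k : Fin M => (k : ℕ)) * charpolyMoment n r (Fin M)) =
      ((Equiv.Perm.sign σ : ℤ) : MvPolynomial (Fin M) ℂ) *
        ((alternant fun k : Fin M => (k : ℕ)) * charpolyMoment n r (Fin M)) := by
  rw [map_mul, rename_alternant, rename_charpolyMoment, mul_assoc]

/-- Swapping two variables with equal exponents fixes the monomial and negates its coefficient. -/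
theorem injective_of_coeff_ne_zero_of_alternating {M : ℕ} (p : MvPolynomial (Fin M) ℂ)
    (halt : ∀ σ : Equiv.Perm (Fin M),
      rename σ p = ((Equiv.Perm.sign σ : ℤ) : MvPolynomial (Fin M) ℂ) * p)
    (m : Fin M →₀ ℕ) (hm : p.coeff m ≠ 0) : Function.Injective m := by
  intro a b hab
  by_contra hne
  have h1 := congrArg (coeff m) (halt (Equiv.swap a b))
  have h2 : m = m.mapDomain (Equiv.swap a b) := by
    ext c
    rw [Finsupp.mapDomain_equiv_apply, Equiv.symm_swap]
    rcases em (c = a) with h | h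
    · rw [h, Equiv.swap_apply_left, hab]
    · by_cases h' : c = b
      · rw [h', Equiv.swap_apply_right, hab]
      · rw [Equiv.swap_apply_of_ne_of_ne h h']
  rw [← map_intCast (C : ℂ →+* MvPolynomial (Fin M) ℂ), coeff_C_mul, Equiv.Perm.sign_swap hne] at h1
  nth_rewrite 1 [h2] at h1
  rw [coeff_rename_mapDomain _ (Equiv.swap a b).injective] at h1
  apply hm
  have : p.coeff m = -p.coeff m := by simpa using h1
  linear_combination this / 2

/-- On a monomial the two eigenvalue equations read off the sum of the exponents and the sum of
their squares. Antisymmetry makes the exponents distinct, and the degree in each variable is at most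
`(2 r - 1) + n`. By extremality only rearrangements of the outer exponents remain. -/
theorem exists_alternant_mul_charpolyMoment_eq (hn : 1 ≤ n) (r : ℕ) :
    ∃ b : ℂ, (alternant fun k : Fin (2 * r) => (k : ℕ)) * charpolyMoment n r (Fin (2 * r)) =
      C b * alternant (outerExponent n r) := by
  set Q := (alternant fun k : Fin (2 * r) => (k : ℕ)) * charpolyMoment n r (Fin (2 * r)) with hQ
  have halt : ∀ σ : Equiv.Perm (Fin (2 * r)),
      rename σ Q = ((Equiv.Perm.sign σ : ℤ) : MvPolynomial (Fin (2 * r)) ℂ) * Q :=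
    rename_alternant_mul_charpolyMoment r (2 * r)
  refine ⟨_, eq_C_mul_alternant _ (outerExponent_injective n r) Q halt fun m hm => ?_⟩
  refine exists_perm_eq_outerExponent n r hn m
    (injective_of_coeff_ne_zero_of_alternating Q halt m hm) ?_ ?_ ?_
  · intro a
    have h1 : m a ≤ degreeOf a Q := by
      rw [degreeOf_eq_sup]
      exact Finset.le_sup (f := fun m : Fin (2 * r) →₀ ℕ => m a) (mem_support_iff.mpr hm)
    have h2 := degreeOf_mul_le a (alternant fun k : Fin (2 * r) => (k : ℕ))
      (charpolyMoment n r (Fin (2 * r)))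
    rw [← hQ] at h2
    have h3 := degreeOf_alternant_val_le a
    have h4 : degreeOf a (charpolyMoment n r (Fin (2 * r))) ≤ n := degreeOf_expectedProd_le _ _ _ _ _
    have := a.2
    omega
  · have h1 := congrArg (coeff m) (sum_eulerDerivation_alternant_mul_charpolyMoment (n := n) r (2 * r))
    rw [← hQ, coeff_sum, coeff_C_mul] at h1
    simp_rw [coeff_eulerDerivation] at h1
    rw [← Finset.sum_mul] at h1
    rw [mul_right_cancel₀ hm h1, sum_outerExponent]
    push_cast
    ring
  · have h1 := congrArg (coeff m) (sum_eulerDerivation_alternant_mul_charpolyMoment (n := n) r (2 * r))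
    have h2 := congrArg (coeff m)
      (sum_eulerDerivation_pair_alternant_mul_charpolyMoment (n := n) r (2 * r))
    rw [← hQ, coeff_sum, coeff_C_mul] at h1 h2
    simp_rw [coeff_eulerDerivation] at h1 h2
    simp_rw [← mul_assoc] at h2
    rw [← Finset.sum_mul] at h1 h2
    have h3 := mul_right_cancel₀ hm h1
    have h4 := mul_right_cancel₀ hm h2
    rw [sum_offDiag_eq_sub fun a b => (m a : ℂ) * m b, ← Finset.sum_mul_sum, h3] at h4
    rw [sum_outerExponent_sq]
    simp_rw [sq (m _ : ℂ)]
    push_cast at h4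
    rw [sum_val_fin_two_mul] at h4
    linear_combination -h4

end HeineSzego

/-! ### The Heine–Szegő identity for products of characteristic polynomials. -/

section HeineSzegoPolynomial

open MvPolynomial Matrix

variable {n : ℕ}

/-- With `r = 0` the first loop equation says that the moment is homogeneous of degree `M n`. As its
degree in each of the `M` variables is at most `n`, only one monomial is possible, and its
coefficient is 1 because the characteristic polynomial is monic. -/
theorem charpolyMoment_zero (M : ℕ) :
    charpolyMoment n 0 (Fin M) = monomial (Finsupp.equivFunOnFinite.symm fun _ => n) 1 := by
  have hcoeff : (charpolyMoment n 0 (Fin M)).coeff (Finsupp.equivFunOnFinite.symm fun _ => n) =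
      1 := by
    rw [charpolyMoment, expectedProd, coeff_sum, Finset.sum_eq_single fun _ => Fin.last n]
    · rw [coeff_monomial, if_pos (by simp)]
      have h : ∀ U : unitaryGroup (Fin n) ℂ,
          (U : Matrix (Fin n) (Fin n) ℂ).charpoly.coeff n = 1 := by
        intro U
        have h1 := (charpoly_monic (U : Matrix (Fin n) (Fin n) ℂ)).coeff_natDegree
        rwa [charpoly_natDegree_eq_dim, Fintype.card_fin] at h1
      simp [h]
    · intro k _ hk
      rw [coeff_monomial, if_neg]
      intro h
      apply hk
      funext a
      have := congrFun (Finsupp.equivFunOnFinite.symm.injective h) a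
      exact Fin.ext this
    · simp
  ext m
  rw [coeff_monomial]
  split_ifs with h
  · rw [← h, hcoeff]
  · by_contra hne
    apply h
    have h1 := congrArg (coeff m) (sum_eulerDerivation_charpolyMoment (n := n) 0 M)
    rw [coeff_sum, coeff_C_mul] at h1
    simp_rw [coeff_eulerDerivation] at h1
    rw [← Finset.sum_mul] at h1
    have h2 := mul_right_cancel₀ hne h1
    have h3 : ∑ a, m a = M * n := by
      have : ((∑ a, m a : ℕ) : ℂ) = ((M * n : ℕ) : ℂ) := by
        push_cast; rw [h2]; simp
      exact_mod_cast this
    have h4 : ∀ a, m a ≤ n := by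
      intro a
      have h5 : m a ≤ degreeOf a (charpolyMoment n 0 (Fin M)) := by
        rw [degreeOf_eq_sup]
        exact Finset.le_sup (f := fun m : Fin M →₀ ℕ => m a) (mem_support_iff.mpr hne)
      exact h5.trans (degreeOf_expectedProd_le _ _ _ _ _)
    have h6 : ∑ a, m a = ∑ _a : Fin M, n := by rw [h3]; simp
    have h7 := (Finset.sum_eq_sum_iff_of_le fun a _ => h4 a).mp h6
    ext a
    simpa using (h7 a (Finset.mem_univ a)).symm

theorem integral_charpoly_eval_one_pow (M : ℕ) :
    ∫ U : unitaryGroup (Fin n) ℂ,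
      (U : Matrix (Fin n) (Fin n) ℂ).charpoly.eval 1 ^ M ∂(cueMeasure n) = 1 := by
  have h := eval_charpolyMoment (n := n) 0 (fun _ : Fin M => (1 : ℂ))
  rw [charpolyMoment_zero, eval_monomial, Finsupp.prod_fintype _ _ (by simp)] at h
  simpa [twistedCharpolyProd] using h.symm

theorem eval_det_polynomialToeplitz (r M : ℕ) (x : Fin M → ℂ) :
    eval x (polynomialToeplitz n r
      (∏ a : Fin M, (Polynomial.C (X a : MvPolynomial (Fin M) ℂ) - Polynomial.X))).det =
    (polynomialToeplitz n r (∏ a, (Polynomial.C (x a) - Polynomial.X))).det := by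
  rw [RingHom.map_det]
  congr 1
  ext j k
  simp only [polynomialToeplitz, RingHom.mapMatrix_apply, map_apply, of_apply]
  rw [← Polynomial.coeff_map]
  simp [Polynomial.map_mul, Polynomial.map_prod]

theorem prod_ite_lt_fin_two_mul {α R : Type*} [CommMonoid R] (r : ℕ) (f : α → R) (c d : α) :
    ∏ a : Fin (2 * r), f (if (a : ℕ) < r then c else d) = f c ^ r * f d ^ r := by
  rw [← Finset.prod_range fun a => f (if a < r then c else d), two_mul, Finset.prod_range_add]
  congr 1
  · rw [Finset.prod_congr rfl fun a ha => by rw [if_pos (Finset.mem_range.mp ha)]]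
    simp
  · have : ∀ a ∈ Finset.range r, f (if r + a < r then c else d) = f d := fun a _ => by
      rw [if_neg (by omega)]
    rw [Finset.prod_congr rfl this]
    simp

/-- The normalising point: half of the variables at 1, half at 0. The factor `X ^ r` of the symbol
makes the matrix upper triangular. -/
theorem det_polynomialToeplitz_special (r : ℕ) :
    (polynomialToeplitz n r (∏ a : Fin (2 * r),
      (Polynomial.C (if (a : ℕ) < r then (1 : ℂ) else 0) - Polynomial.X))).det =
      ((-1) ^ r) ^ n := by
  have hq : ∏ a : Fin (2 * r),
      (Polynomial.C (if (a : ℕ) < r then (1 : ℂ) else 0) - Polynomial.X) =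
      Polynomial.C ((-1) ^ r) * (1 - Polynomial.X) ^ r * Polynomial.X ^ r := by
    rw [prod_ite_lt_fin_two_mul r (fun c : ℂ => Polynomial.C c - Polynomial.X), map_zero, zero_sub,
      map_one]
    rw [neg_pow]
    simp
    ring
  rw [hq, det_of_isUpperTriangular]
  · rw [Finset.prod_congr rfl fun j _ => ?_, Finset.prod_const, Finset.card_univ, Fintype.card_fin]
    simp only [polynomialToeplitz, of_apply]
    rw [add_comm, Polynomial.coeff_X_pow_mul', if_pos (by omega), Nat.add_sub_cancel_left,
      Polynomial.coeff_mul_X_pow', if_pos le_rfl, Nat.sub_self, mul_comm,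
      Polynomial.mul_coeff_zero, Polynomial.coeff_C_zero, Polynomial.coeff_zero_eq_eval_zero]
    simp
  · intro j k hjk
    have hjk' : (k : ℕ) < j := hjk
    simp only [polynomialToeplitz, of_apply]
    rw [← mul_assoc, Polynomial.coeff_mul_X_pow', if_pos (by omega), Nat.add_sub_cancel_left,
      Polynomial.coeff_X_pow_mul', if_neg (by omega)]

/-- Both sides times the Vandermonde are multiples of the same alternant, so they are proportional
as polynomials. Evaluation at the normalising point shows that the factor is 1. -/
theorem integral_twistedCharpolyProd_eq_det (hn : 1 ≤ n) (r : ℕ) (x : Fin (2 * r) → ℂ) :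
    ∫ U : unitaryGroup (Fin n) ℂ, twistedCharpolyProd r x U ∂(cueMeasure n) =
      (polynomialToeplitz n r (∏ a, (Polynomial.C (x a) - Polynomial.X))).det := by
  obtain ⟨b, hb⟩ := exists_alternant_mul_charpolyMoment_eq hn r
  obtain ⟨ε, hε⟩ := exists_sign_det_polynomialToeplitz n r
  have hprop : charpolyMoment n r (Fin (2 * r)) = C (b * ((ε : ℤ) : ℂ)) *
      (polynomialToeplitz n r (∏ a : Fin (2 * r),
        (Polynomial.C (X a : MvPolynomial (Fin (2 * r)) ℂ) - Polynomial.X))).det := by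
    refine mul_left_cancel₀ alternant_val_ne_zero ?_
    rw [hb, alternant, alternant, ← hε, map_mul, map_intCast, vandermonde]
    ring
  have hspec := congrArg (eval fun a : Fin (2 * r) => if (a : ℕ) < r then (1 : ℂ) else 0) hprop
  rw [map_mul, eval_C, eval_det_polynomialToeplitz, det_polynomialToeplitz_special,
    eval_charpolyMoment] at hspec
  have hval : ∫ U : unitaryGroup (Fin n) ℂ, twistedCharpolyProd r
      (fun a : Fin (2 * r) => if (a : ℕ) < r then (1 : ℂ) else 0) U ∂(cueMeasure n) =
      ((-1) ^ r) ^ n := by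
    -- The `r` factors at 0 contribute `det U ^ r` up to sign, which cancels the twist and leaves a
    -- moment with `r = 0`.
    have h1 : ∀ U : unitaryGroup (Fin n) ℂ, twistedCharpolyProd r
        (fun a : Fin (2 * r) => if (a : ℕ) < r then (1 : ℂ) else 0) U =
        ((-1) ^ r) ^ n * (U : Matrix (Fin n) (Fin n) ℂ).charpoly.eval 1 ^ r := by
      intro U
      have hdet : star (U : Matrix (Fin n) (Fin n) ℂ).det *
          (U : Matrix (Fin n) (Fin n) ℂ).det = 1 := by
        have h2 := congrArg det (mem_unitaryGroup_iff'.mp U.2)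
        rwa [star_eq_conjTranspose, det_mul, det_conjTranspose, det_one] at h2
      have h0 : (U : Matrix (Fin n) (Fin n) ℂ).charpoly.eval 0 =
          (-1) ^ n * (U : Matrix (Fin n) (Fin n) ℂ).det := by
        rw [charpoly_eval_eq_det, zero_smul, zero_sub, det_neg, Fintype.card_fin]
      rw [twistedCharpolyProd, prod_ite_lt_fin_two_mul r
        (fun c : ℂ => (U : Matrix (Fin n) (Fin n) ℂ).charpoly.eval c)]
      rw [h0, mul_pow, ← pow_mul, ← pow_mul, mul_comm r n]
      have h3 : star (U : Matrix (Fin n) (Fin n) ℂ).det ^ r *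
          (U : Matrix (Fin n) (Fin n) ℂ).det ^ r = 1 := by
        rw [← mul_pow, hdet, one_pow]
      linear_combination ((-1) ^ (n * r) *
        (U : Matrix (Fin n) (Fin n) ℂ).charpoly.eval 1 ^ r) * h3
    simp_rw [h1]
    rw [integral_const_mul, integral_charpoly_eval_one_pow, mul_one]
  rw [hval] at hspec
  have hne : (((-1 : ℂ) ^ r) ^ n) ≠ 0 := by simp
  have hc : b * ((ε : ℤ) : ℂ) = 1 := by
    refine mul_right_cancel₀ hne ?_
    rw [one_mul, ← hspec]
  rw [← eval_charpolyMoment, hprop, hc, map_one, one_mul, eval_det_polynomialToeplitz]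

end HeineSzegoPolynomial

/-! ### Uniform measure on the unit circle and Fourier coefficients. -/

section CircleLaw

/-- The uniform probability measure on the unit circle of `ℂ`. -/
def circleLaw : Measure ℂ :=
  ENNReal.ofReal (1 / (2 * Real.pi)) •
    (volume.restrict (Set.Ico (-Real.pi) Real.pi)).map fun θ : ℝ => Complex.exp (θ * Complex.I)

theorem measurable_exp_mul_I : Measurable fun θ : ℝ => Complex.exp (θ * Complex.I) := by fun_prop

theorem circleLaw_apply {s : Set ℂ} (hs : MeasurableSet s) :
    circleLaw s = ENNReal.ofReal (1 / (2 * Real.pi)) *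
      volume ({θ : ℝ | Complex.exp (θ * Complex.I) ∈ s} ∩ Set.Ico (-Real.pi) Real.pi) := by
  rw [circleLaw, Measure.smul_apply, Measure.map_apply measurable_exp_mul_I hs,
    Measure.restrict_apply (measurable_exp_mul_I hs), smul_eq_mul]
  rfl

instance circleLaw_isProbabilityMeasure : IsProbabilityMeasure circleLaw := ⟨by
  rw [circleLaw_apply MeasurableSet.univ]
  simp only [Set.mem_univ, Set.ofPred_true, Set.univ_inter, Real.volume_Ico]
  rw [← ENNReal.ofReal_mul (by positivity)]
  have : 1 / (2 * Real.pi) * (Real.pi - -Real.pi) = 1 := by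
    field_simp
    ring
  rw [this, ENNReal.ofReal_one]⟩

theorem integral_circleLaw {f : ℂ → ℂ} (hf : AEStronglyMeasurable f circleLaw) :
    ∫ z, f z ∂circleLaw = (1 / (2 * Real.pi) : ℝ) *
      ∫ θ in Set.Ico (-Real.pi) Real.pi, f (Complex.exp (θ * Complex.I)) := by
  have hc : ENNReal.ofReal (1 / (2 * Real.pi)) ≠ 0 := by
    rw [ne_eq, ENNReal.ofReal_eq_zero, not_le]; positivity
  have hf' : AEStronglyMeasurable f
      ((volume.restrict (Set.Ico (-Real.pi) Real.pi)).map
        fun θ : ℝ => Complex.exp (θ * Complex.I)) :=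
    hf.mono_ac (Measure.AbsolutelyContinuous.smul_right Measure.AbsolutelyContinuous.rfl hc)
  rw [circleLaw, integral_smul_measure, integral_map measurable_exp_mul_I.aemeasurable hf',
    ENNReal.toReal_ofReal (by positivity), Complex.real_smul]

theorem ae_circleLaw_norm_eq_one : ∀ᵐ z ∂circleLaw, ‖z‖ = 1 := by
  have hs : MeasurableSet {z : ℂ | ‖z‖ = 1}ᶜ :=
    (isClosed_eq continuous_norm continuous_const).measurableSet.compl
  rw [ae_iff]
  change circleLaw {z : ℂ | ‖z‖ = 1}ᶜ = 0
  rw [circleLaw_apply hs]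
  simp [Complex.norm_exp_ofReal_mul_I]

theorem integral_circleLaw_pow_mul_star_pow (a b : ℕ) :
    ∫ z, z ^ a * star z ^ b ∂circleLaw = if a = b then 1 else 0 := by
  rw [integral_circleLaw (by
    exact (Continuous.aestronglyMeasurable (by fun_prop)))]
  have h : ∀ θ : ℝ, Complex.exp (θ * Complex.I) ^ a * star (Complex.exp (θ * Complex.I)) ^ b =
      Complex.exp (((a : ℂ) - b) * Complex.I * θ) := by
    intro θ
    rw [Complex.star_def, ← Complex.exp_conj, ← Complex.exp_nat_mul, ← Complex.exp_nat_mul,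
      ← Complex.exp_add]
    congr 1
    simp
    ring
  simp_rw [h]
  rw [integral_Ico_eq_integral_Ioo, ← integral_Ioc_eq_integral_Ioo,
    ← intervalIntegral.integral_of_le (by linarith [Real.pi_pos])]
  split_ifs with hab
  · subst hab
    simp
    rw [← Complex.ofReal_ofNat]
    norm_cast
    field_simp
    norm_num
  · have hne : ((a : ℂ) - b) ≠ 0 := sub_ne_zero.mpr (by exact_mod_cast hab)
    rw [integral_exp_mul_complex (mul_ne_zero hne Complex.I_ne_zero)]
    have : Complex.exp (((a : ℂ) - b) * Complex.I * (Real.pi : ℝ)) =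
        Complex.exp (((a : ℂ) - b) * Complex.I * (-Real.pi : ℝ)) := by
      rw [Complex.exp_eq_exp_iff_exists_int]
      exact ⟨(a : ℤ) - b, by push_cast; ring⟩
    rw [this, sub_self, zero_div, mul_zero]

theorem integrable_circleLaw_of_continuous {f : ℂ → ℂ} (hf : Continuous f) :
    Integrable f circleLaw := by
  obtain ⟨C, hC⟩ := (isCompact_sphere (0 : ℂ) 1).exists_bound_of_continuousOn hf.continuousOn
  refine Integrable.of_bound hf.aestronglyMeasurable C ?_
  filter_upwards [ae_circleLaw_norm_eq_one] with z hz
  exact hC z (by simpa using hz)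

theorem integral_circleLaw_polynomial (p : Polynomial ℂ) (b : ℕ) :
    ∫ z, p.eval z * star z ^ b ∂circleLaw = p.coeff b := by
  simp_rw [Polynomial.eval_eq_sum_range, Finset.sum_mul, mul_assoc]
  rw [integral_finsetSum _ fun k _ => integrable_circleLaw_of_continuous (by fun_prop)]
  simp_rw [integral_const_mul, integral_circleLaw_pow_mul_star_pow]
  simp only [mul_ite, mul_one, mul_zero]
  rw [Finset.sum_ite_eq']
  split_ifs with h
  · rfl
  · rw [Polynomial.coeff_eq_zero_of_natDegree_lt (by simpa using h)]

end CircleLaw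

/-! ### The Heine–Szegő identity for continuous functions. -/

section EigenvalueProduct

open Matrix

variable {n : ℕ}

/-- The product of `f` over the eigenvalues of a unitary matrix, with multiplicity. -/
def eigenvalueProd (f : ℂ → ℂ) (U : unitaryGroup (Fin n) ℂ) : ℂ :=
  ((U : Matrix (Fin n) (Fin n) ℂ).charpoly.roots.map f).prod

/-- The Toeplitz matrix of the Fourier coefficients of `f`. -/
def circleToeplitz (n : ℕ) (f : ℂ → ℂ) : Matrix (Fin n) (Fin n) ℂ :=
  Matrix.of fun j k => ∫ z, f z * z ^ (j : ℕ) * star z ^ (k : ℕ) ∂circleLaw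

theorem norm_eq_one_of_mem_roots (U : unitaryGroup (Fin n) ℂ) {z : ℂ}
    (hz : z ∈ (U : Matrix (Fin n) (Fin n) ℂ).charpoly.roots) : ‖z‖ = 1 := by
  refine norm_eq_one_of_det_eq_zero U ?_
  rw [← charpoly_eval_eq_det]
  exact (Polynomial.mem_roots'.mp hz).2

theorem card_roots_charpoly (U : unitaryGroup (Fin n) ℂ) :
    (U : Matrix (Fin n) (Fin n) ℂ).charpoly.roots.card = n := by
  rw [← (IsAlgClosed.splits _).natDegree_eq_card_roots, charpoly_natDegree_eq_dim,
    Fintype.card_fin]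

theorem eigenvalueProd_congr {f g : ℂ → ℂ} (U : unitaryGroup (Fin n) ℂ)
    (h : ∀ z ∈ (U : Matrix (Fin n) (Fin n) ℂ).charpoly.roots, f z = g z) :
    eigenvalueProd f U = eigenvalueProd g U := by
  rw [eigenvalueProd, eigenvalueProd, Multiset.map_congr rfl h]

theorem norm_eigenvalueProd_le {f : ℂ → ℂ} (U : unitaryGroup (Fin n) ℂ) (C : ℝ)
    (h : ∀ z, ‖z‖ = 1 → ‖f z‖ ≤ C) : ‖eigenvalueProd f U‖ ≤ C ^ n := by
  have key : ∀ s : Multiset ℂ, (∀ z ∈ s, ‖z‖ = 1) → ‖(s.map f).prod‖ ≤ C ^ s.card := by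
    intro s
    induction s using Multiset.induction_on with
    | empty => simp
    | cons a s ih =>
      intro hs
      rw [Multiset.map_cons, Multiset.prod_cons, Multiset.card_cons, pow_succ', norm_mul]
      have h1 := h a (hs a (Multiset.mem_cons_self a s))
      exact mul_le_mul h1 (ih fun z hz => hs z (Multiset.mem_cons_of_mem hz)) (norm_nonneg _)
        ((norm_nonneg _).trans h1)
  have h2 := key _ fun z hz => norm_eq_one_of_mem_roots U hz
  rwa [card_roots_charpoly] at h2

theorem tendsto_eigenvalueProd {F : ℕ → ℂ → ℂ} {f : ℂ → ℂ} (U : unitaryGroup (Fin n) ℂ)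
    (h : ∀ z ∈ (U : Matrix (Fin n) (Fin n) ℂ).charpoly.roots,
      Filter.Tendsto (fun k => F k z) Filter.atTop (nhds (f z))) :
    Filter.Tendsto (fun k => eigenvalueProd (F k) U) Filter.atTop (nhds (eigenvalueProd f U)) :=
  tendsto_multiset_prod _ h

/-- The Heine–Szegő identity for the function `f` and Haar distributed unitary matrices. -/
structure HasHeineSzego (n : ℕ) (f : ℂ → ℂ) : Prop where
  aestronglyMeasurable : AEStronglyMeasurable f circleLaw
  aestronglyMeasurable_prod :
    AEStronglyMeasurable (eigenvalueProd (n := n) f) (cueMeasure n)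
  integral_eq : ∫ U, eigenvalueProd f U ∂(cueMeasure n) = (circleToeplitz n f).det

/-- Dominated convergence applies to the mean and to each Toeplitz entry. Almost everywhere
measurability of the eigenvalue product passes to the limit as well, so it never has to be proved
from a choice of eigenvalues. -/
theorem HasHeineSzego.of_tendsto {F : ℕ → ℂ → ℂ} {f : ℂ → ℂ} (hF : ∀ k, HasHeineSzego n (F k))
    (C : ℝ) (hC : ∀ k z, ‖z‖ = 1 → ‖F k z‖ ≤ C)
    (hlim : ∀ᵐ z ∂circleLaw, Filter.Tendsto (fun k => F k z) Filter.atTop (nhds (f z)))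
    (hlim_prod : ∀ᵐ U ∂cueMeasure n, Filter.Tendsto (fun k => eigenvalueProd (F k) U)
      Filter.atTop (nhds (eigenvalueProd f U))) : HasHeineSzego n f := by
  refine ⟨aestronglyMeasurable_of_tendsto_ae Filter.atTop (fun k => (hF k).1) hlim,
    aestronglyMeasurable_of_tendsto_ae Filter.atTop (fun k => (hF k).2) hlim_prod, ?_⟩
  have h1 : Filter.Tendsto (fun k => ∫ U, eigenvalueProd (F k) U ∂(cueMeasure n)) Filter.atTop
      (nhds (∫ U, eigenvalueProd f U ∂(cueMeasure n))) :=
    tendsto_integral_of_dominated_convergence (fun _ => C ^ n) (fun k => (hF k).2)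
      (integrable_const _)
      (fun k => Filter.Eventually.of_forall fun U => norm_eigenvalueProd_le U C (hC k)) hlim_prod
  have h2 : Filter.Tendsto (fun k => (circleToeplitz n (F k)).det) Filter.atTop
      (nhds (circleToeplitz n f).det) := by
    have hcont : Continuous fun A : Matrix (Fin n) (Fin n) ℂ => A.det := continuous_id.matrix_det
    refine (hcont.tendsto _).comp ?_
    refine tendsto_pi_nhds.mpr fun j => tendsto_pi_nhds.mpr fun k => ?_
    refine tendsto_integral_of_dominated_convergence (fun _ => C) (fun i => ?_)
      (integrable_const _) (fun i => ?_) ?_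
    · exact ((hF i).1.mul (Continuous.aestronglyMeasurable (by fun_prop))).mul
        (Continuous.aestronglyMeasurable (by fun_prop))
    · filter_upwards [ae_circleLaw_norm_eq_one] with z hz
      simpa [hz] using hC i z hz
    · filter_upwards [hlim] with z hz
      exact (hz.mul_const _).mul_const _
  refine tendsto_nhds_unique h1 ?_
  simp_rw [fun k => (hF k).3]
  exact h2

theorem HasHeineSzego.of_tendsto_circle {F : ℕ → ℂ → ℂ} {f : ℂ → ℂ}
    (hF : ∀ k, HasHeineSzego n (F k)) (C : ℝ) (hC : ∀ k z, ‖z‖ = 1 → ‖F k z‖ ≤ C)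
    (hlim : ∀ z, ‖z‖ = 1 → Filter.Tendsto (fun k => F k z) Filter.atTop (nhds (f z))) :
    HasHeineSzego n f := by
  refine HasHeineSzego.of_tendsto hF C hC ?_ ?_
  · filter_upwards [ae_circleLaw_norm_eq_one] with z hz using hlim z hz
  · exact Filter.Eventually.of_forall fun U => tendsto_eigenvalueProd U fun z hz =>
      hlim z (norm_eq_one_of_mem_roots U hz)

/-- The factors are `x a - X` rather than `X - x a` to match the Toeplitz symbol; even degree
absorbs the signs. -/
theorem exists_eq_C_mul_prod {M : ℕ} (hM : Even M) (q : Polynomial ℂ) (hq : q.natDegree = M) :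
    ∃ (c : ℂ) (x : Fin M → ℂ), q = Polynomial.C c * ∏ a, (Polynomial.C (x a) - Polynomial.X) := by
  have hcard : q.roots.toList.length = M := by
    rw [Multiset.length_toList, ← (IsAlgClosed.splits q).natDegree_eq_card_roots, hq]
  refine ⟨q.leadingCoeff, fun a => q.roots.toList.get (a.cast hcard.symm), ?_⟩
  conv_lhs => rw [(IsAlgClosed.splits q).eq_prod_roots]
  congr 1
  have h1 : q.roots = Multiset.map (fun a : Fin M => q.roots.toList.get (a.cast hcard.symm))
      Finset.univ.val := by
    conv_lhs => rw [← Multiset.coe_toList q.roots]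
    subst hcard
    have h := List.ofFn_get q.roots.toList
    simp only [Fin.univ_val_map, Fin.cast_eq_self]
    exact congrArg _ h.symm
  conv_lhs => rw [h1]
  rw [Multiset.map_map, Finset.prod_map_val]
  have h2 : ∀ a : Fin M, ((Polynomial.X : Polynomial ℂ) -
      Polynomial.C (q.roots.toList.get (a.cast hcard.symm))) =
      (-1) * (Polynomial.C (q.roots.toList.get (a.cast hcard.symm)) - Polynomial.X) :=
    fun a => by ring
  simp only [Function.comp_apply]
  rw [Finset.prod_congr rfl fun a _ => h2 a, Finset.prod_mul_distrib]
  simp [hM.neg_one_pow]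

theorem polynomialToeplitz_C_mul (r : ℕ) (c : ℂ) (q : Polynomial ℂ) :
    polynomialToeplitz n r (Polynomial.C c * q) = c • polynomialToeplitz n r q := by
  ext j k
  simp only [polynomialToeplitz, of_apply, Matrix.smul_apply, smul_eq_mul]
  rw [mul_left_comm, Polynomial.coeff_C_mul]

theorem multiset_prod_star_pow_mul_eval {M : ℕ} (r : ℕ) (c : ℂ) (x : Fin M → ℂ)
    (s : Multiset ℂ) :
    (s.map fun z => star z ^ r *
      (Polynomial.C c * ∏ a, (Polynomial.C (x a) - Polynomial.X)).eval z).prod =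
      c ^ s.card * ((s.map fun z => star z).prod ^ r * ∏ a, (s.map fun z => x a - z).prod) := by
  induction s using Multiset.induction_on with
  | empty => simp
  | cons a s ih =>
    rw [Multiset.map_cons, Multiset.prod_cons, ih]
    simp only [Multiset.map_cons, Multiset.prod_cons, Multiset.card_cons,
      Finset.prod_mul_distrib, Polynomial.eval_mul, Polynomial.eval_C, Polynomial.eval_prod,
      Polynomial.eval_sub, Polynomial.eval_X]
    ring

theorem eigenvalueProd_star_pow_mul_eval (r : ℕ) (c : ℂ) (x : Fin (2 * r) → ℂ)
    (U : unitaryGroup (Fin n) ℂ) :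
    eigenvalueProd (fun z => star z ^ r *
      (Polynomial.C c * ∏ a, (Polynomial.C (x a) - Polynomial.X)).eval z) U =
      c ^ n * twistedCharpolyProd r x U := by
  have h1 : ∀ x : ℂ, (U : Matrix (Fin n) (Fin n) ℂ).charpoly.eval x =
      ((U : Matrix (Fin n) (Fin n) ℂ).charpoly.roots.map fun z => x - z).prod := fun x =>
    (IsAlgClosed.splits _).eval_eq_prod_roots_of_monic (charpoly_monic _) x
  have h2 : star (U : Matrix (Fin n) (Fin n) ℂ).det =
      ((U : Matrix (Fin n) (Fin n) ℂ).charpoly.roots.map fun z => star z).prod := by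
    rw [det_eq_prod_roots_charpoly, Complex.star_def, map_multiset_prod]
  have h3 := card_roots_charpoly U
  rw [eigenvalueProd, twistedCharpolyProd, h2, Finset.prod_congr rfl fun a _ => h1 (x a)]
  rw [multiset_prod_star_pow_mul_eval, h3]

/-- Factoring `q` over its roots turns the product over eigenvalues into `c ^ n det U ^ (-r)` times
values of the characteristic polynomial at those roots. -/
theorem hasHeineSzego_laurent (hn : 1 ≤ n) (r : ℕ) (q : Polynomial ℂ) (hq : q.natDegree = 2 * r) :
    HasHeineSzego n fun z => star z ^ r * q.eval z := by
  obtain ⟨c, x, rfl⟩ := exists_eq_C_mul_prod (even_two_mul r) q hq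
  refine ⟨Continuous.aestronglyMeasurable (by fun_prop), ?_, ?_⟩
  · simp_rw [funext fun U => eigenvalueProd_star_pow_mul_eval (n := n) r c x U]
    exact (continuous_const.mul (continuous_twistedCharpolyProd r x)).aestronglyMeasurable
  · simp_rw [eigenvalueProd_star_pow_mul_eval]
    rw [integral_const_mul, integral_twistedCharpolyProd_eq_det hn]
    have h : circleToeplitz n (fun z => star z ^ r *
        (Polynomial.C c * ∏ a, (Polynomial.C (x a) - Polynomial.X)).eval z) =
        polynomialToeplitz n r (Polynomial.C c * ∏ a, (Polynomial.C (x a) - Polynomial.X)) := by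
      ext j k
      simp only [circleToeplitz, polynomialToeplitz, of_apply]
      rw [← integral_circleLaw_polynomial]
      congr 1
      ext z
      rw [Polynomial.eval_mul (p := Polynomial.X ^ (j : ℕ)), Polynomial.eval_pow,
        Polynomial.eval_X, pow_add]
      ring
    rw [h, polynomialToeplitz_C_mul, det_smul, Fintype.card_fin]

/-- Stone–Weierstrass for the star algebra generated by `z`. On the circle `star z * z = 1`, so each
of its elements has the form `star z ^ r * q z`. -/
theorem exists_laurent_approx (f : ℂ → ℂ) (hf : Continuous f) (ε : ℝ) (hε : 0 < ε) :
    ∃ (r : ℕ) (q : Polynomial ℂ), q.natDegree = 2 * r ∧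
      ∀ z, ‖z‖ = 1 → ‖star z ^ r * q.eval z - f z‖ < ε := by
  set S := Metric.sphere (0 : ℂ) 1 with hS
  have hmem : ∀ g ∈ (polynomialFunctions S).starClosure, ∃ (r : ℕ) (q : Polynomial ℂ),
      ∀ z : S, g z = star (z : ℂ) ^ r * q.eval (z : ℂ) := by
    have hzz : ∀ z : S, star (z : ℂ) * z = 1 := by
      intro z
      have h1 : ‖(z : ℂ)‖ = 1 := by simp
      rw [Complex.star_def, Complex.conj_mul', h1]
      simp
    intro g hg
    rw [polynomialFunctions.starClosure_eq_adjoin_X] at hg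
    induction hg using Algebra.adjoin_induction with
    | mem f hf =>
      rcases hf with hf | hf
      · rw [Set.mem_singleton_iff] at hf
        subst hf
        exact ⟨0, Polynomial.X, fun z => by simp⟩
      · rw [Set.mem_star, Set.mem_singleton_iff, star_eq_iff_star_eq] at hf
        subst hf
        exact ⟨1, 1, fun z => by simp⟩
    | algebraMap c => exact ⟨0, Polynomial.C c, fun z => by simp⟩
    | add f g _ _ hf hg =>
      obtain ⟨r, p, hp⟩ := hf
      obtain ⟨s, q, hq⟩ := hg
      refine ⟨r + s, Polynomial.X ^ s * p + Polynomial.X ^ r * q, fun z => ?_⟩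
      have h1 : star (z : ℂ) ^ s * (z : ℂ) ^ s = 1 := by rw [← mul_pow, hzz, one_pow]
      have h2 : star (z : ℂ) ^ r * (z : ℂ) ^ r = 1 := by rw [← mul_pow, hzz, one_pow]
      rw [ContinuousMap.add_apply, hp, hq]
      simp only [Polynomial.eval_add, Polynomial.eval_mul, Polynomial.eval_pow, Polynomial.eval_X]
      linear_combination -(star (z : ℂ) ^ r * p.eval (z : ℂ)) * h1 -
        (star (z : ℂ) ^ s * q.eval (z : ℂ)) * h2
    | mul f g _ _ hf hg =>
      obtain ⟨r, p, hp⟩ := hf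
      obtain ⟨s, q, hq⟩ := hg
      refine ⟨r + s, p * q, fun z => ?_⟩
      rw [ContinuousMap.mul_apply, hp, hq, Polynomial.eval_mul]
      ring
  set F : C(S, ℂ) := ⟨fun z => f z, hf.comp continuous_subtype_val⟩ with hF
  have hcl : F ∈ closure ((polynomialFunctions S).starClosure : Set C(S, ℂ)) := by
    have := polynomialFunctions.starClosure_topologicalClosure (𝕜 := ℂ) S
    rw [← StarSubalgebra.topologicalClosure_coe, this]
    exact StarSubalgebra.mem_top
  obtain ⟨g, hg, hdist⟩ := Metric.mem_closure_iff.mp hcl (ε / 2) (half_pos hε)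
  obtain ⟨r, q, hq⟩ := hmem g hg
  set s := r + q.natDegree + 1 with hs
  set p := Polynomial.X ^ (s - r) * q with hp
  have hpdeg : p.natDegree < 2 * s := by
    refine (Polynomial.natDegree_mul_le.trans (add_le_add
      (Polynomial.natDegree_X_pow_le _) le_rfl)).trans_lt ?_
    omega
  -- The extra leading term makes the degree exactly `2 s`, as the factorisation into `2 s` roots
  -- requires; it has modulus `ε / 2` on the circle.
  refine ⟨s, p + Polynomial.C ((ε / 2 : ℝ) : ℂ) * Polynomial.X ^ (2 * s), ?_, fun z hz => ?_⟩
  · rw [Polynomial.natDegree_add_eq_right_of_natDegree_lt] <;>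
      rw [Polynomial.natDegree_C_mul_X_pow _ _ (by exact_mod_cast (half_pos hε).ne')]
    exact hpdeg
  · have hzS : z ∈ S := by simpa [hS] using hz
    have h1 : star z * z = 1 := by
      rw [Complex.star_def, Complex.conj_mul', hz]; simp
    have h2 : star z ^ s * p.eval z = g ⟨z, hzS⟩ := by
      rw [hq, hp, Polynomial.eval_mul, Polynomial.eval_pow, Polynomial.eval_X]
      have h3 : star z ^ s = star z ^ r * star z ^ (s - r) := by
        rw [← pow_add]; congr 1; omega
      have h4 : star z ^ (s - r) * z ^ (s - r) = 1 := by rw [← mul_pow, h1, one_pow]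
      rw [h3]
      linear_combination (star z ^ r * q.eval z) * h4
    rw [Polynomial.eval_add, mul_add, h2, add_sub_right_comm]
    refine (norm_add_le _ _).trans_lt ?_
    have h5 : ‖g ⟨z, hzS⟩ - f z‖ < ε / 2 := by
      have := (ContinuousMap.dist_apply_le_dist (f := F) (g := g) ⟨z, hzS⟩).trans_lt hdist
      rw [dist_comm, dist_eq_norm] at this
      exact this
    have h6 : ‖star z ^ s * (Polynomial.C ((ε / 2 : ℝ) : ℂ) *
        Polynomial.X ^ (2 * s)).eval z‖ = ε / 2 := by
      simp [hz, abs_of_pos hε]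
    rw [h6]
    linarith

theorem hasHeineSzego_of_continuous (hn : 1 ≤ n) (f : ℂ → ℂ) (hf : Continuous f) :
    HasHeineSzego n f := by
  choose r q hdeg happ using fun k : ℕ =>
    exists_laurent_approx f hf (1 / ((k : ℝ) + 1)) Nat.one_div_pos_of_nat
  obtain ⟨C, hC⟩ := (isCompact_sphere (0 : ℂ) 1).exists_bound_of_continuousOn hf.continuousOn
  refine HasHeineSzego.of_tendsto_circle (fun k => hasHeineSzego_laurent hn (r k) (q k) (hdeg k))
    (C + 1) (fun k z hz => ?_) fun z hz => ?_
  · have h1 := hC z (by simpa using hz)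
    have h2 := happ k z hz
    have h3 : (1 : ℝ) / ((k : ℝ) + 1) ≤ 1 := by
      rw [div_le_one (by positivity)]
      linarith [(Nat.cast_nonneg k : (0 : ℝ) ≤ k)]
    calc ‖star z ^ r k * (q k).eval z‖ = ‖(star z ^ r k * (q k).eval z - f z) + f z‖ := by
          rw [sub_add_cancel]
      _ ≤ _ := norm_add_le _ _
      _ ≤ C + 1 := by linarith
  · rw [tendsto_iff_norm_sub_tendsto_zero]
    exact squeeze_zero (fun _ => norm_nonneg _) (fun k => (happ k z hz).le)
      tendsto_one_div_add_atTop_nhds_zero_nat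

end EigenvalueProduct

/-! ### The Heine–Szegő identity for indicators of null-measurable sets. -/

section IndicatorWeights

open Matrix

variable {n : ℕ}

theorem norm_add_mul_indicator_le (E : Set ℂ) (a t z : ℂ) :
    ‖a + t * E.indicator (fun _ => 1) z‖ ≤ ‖a‖ + ‖t‖ := by
  refine (norm_add_le _ _).trans (add_le_add le_rfl ?_)
  by_cases h : z ∈ E <;> simp [h]

theorem hasHeineSzego_indicator_of_isClosed (hn : 1 ≤ n) {F : Set ℂ} (hF : IsClosed F) (a t : ℂ) :
    HasHeineSzego n fun z => a + t * F.indicator (fun _ => 1) z := by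
  have hδ : ∀ k : ℕ, 0 < 1 / ((k : ℝ) + 1) := fun k => Nat.one_div_pos_of_nat
  refine HasHeineSzego.of_tendsto_circle
    (F := fun k z => a + t * ((thickenedIndicator (hδ k) F z : NNReal) : ℂ))
    (fun k => hasHeineSzego_of_continuous hn _ ?_) (‖a‖ + ‖t‖) (fun k z _ => ?_) fun z _ => ?_
  · have h1 := (thickenedIndicator (hδ k) F).continuous
    have h2 : Continuous fun x : NNReal => ((x : ℝ) : ℂ) := by fun_prop
    exact continuous_const.add (continuous_const.mul (h2.comp h1))
  · refine (norm_add_le _ _).trans (add_le_add le_rfl ?_)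
    have h1 : (thickenedIndicator (hδ k) F z : ℝ) ≤ 1 := by
      exact_mod_cast thickenedIndicator_le_one (hδ k) F z
    rw [norm_mul, Complex.norm_real, Real.norm_of_nonneg (NNReal.coe_nonneg _)]
    exact mul_le_of_le_one_right (norm_nonneg _) h1
  · have h1 := thickenedIndicator_tendsto_indicator_closure hδ
      tendsto_one_div_add_atTop_nhds_zero_nat F
    rw [tendsto_pi_nhds] at h1
    have h2 := h1 z
    rw [hF.closure_eq] at h2
    have h3 : Continuous fun x : NNReal => ((x : ℝ) : ℂ) := by fun_prop
    have h4 := (h3.tendsto _).comp h2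
    have h5 : (((F.indicator (fun _ => (1 : NNReal)) z : NNReal) : ℝ) : ℂ) = F.indicator (fun _ => 1) z := by
      by_cases h : z ∈ F <;> simp [h]
    rw [h5] at h4
    exact tendsto_const_nhds.add (tendsto_const_nhds.mul h4)

theorem hasHeineSzego_indicator_iUnion (hn : 1 ≤ n) {F : ℕ → Set ℂ} (hF : ∀ k, IsClosed (F k))
    (a t : ℂ) : HasHeineSzego n fun z => a + t * (⋃ k, F k).indicator (fun _ => 1) z := by
  refine HasHeineSzego.of_tendsto_circle
    (F := fun k z => a + t * (Set.accumulate F k).indicator (fun _ => 1) z)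
    (fun k => hasHeineSzego_indicator_of_isClosed hn ?_ a t) (‖a‖ + ‖t‖)
    (fun k z _ => norm_add_mul_indicator_le _ _ _ _) fun z _ => ?_
  · rw [Set.accumulate_def]
    exact (Set.finite_Iic k).isClosed_biUnion fun i _ => hF i
  · have h := (Set.monotone_accumulate (s := F)).tendsto_indicator _ (fun _ => (1 : ℂ)) z
    rw [Set.iUnion_accumulate] at h
    exact tendsto_const_nhds.add (tendsto_const_nhds.mul (h.mono_right (pure_le_nhds _)))

theorem circleToeplitz_one : circleToeplitz n (fun _ => 1) = 1 := by
  ext j k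
  simp only [circleToeplitz, of_apply, one_mul, integral_circleLaw_pow_mul_star_pow, one_apply,
    Fin.ext_iff]

theorem circleToeplitz_congr {f g : ℂ → ℂ} (h : f =ᵐ[circleLaw] g) :
    circleToeplitz n f = circleToeplitz n g := by
  ext j k
  simp only [circleToeplitz, of_apply]
  refine integral_congr_ae ?_
  filter_upwards [h] with z hz
  rw [hz]

/-- Cover `N` by open sets of measure tending to 0; the union `F` of their complements has full
measure and misses `N`. The Heine–Szegő identity for the indicator of `F` says that all eigenvalues
lie in `F` with probability `det 1 = 1`. -/
theorem ae_roots_notMem (hn : 1 ≤ n) {N : Set ℂ} (hN : circleLaw N = 0) :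
    ∀ᵐ U : unitaryGroup (Fin n) ℂ ∂cueMeasure n, ∀ z ∈ (U : Matrix (Fin n) (Fin n) ℂ).charpoly.roots, z ∉ N := by
  have hO : ∀ k : ℕ, ∃ O ⊇ N, IsOpen O ∧ circleLaw O < ((k : ℝ≥0∞) + 1)⁻¹ := fun k =>
    Set.exists_isOpen_lt_of_lt N _ (by rw [hN]; simp)
  choose O hNO hOo hOlt using hO
  set F : Set ℂ := ⋃ k, (O k)ᶜ with hF
  have hnull : circleLaw Fᶜ = 0 := by
    refine le_antisymm (le_of_forall_pos_le_add fun ε hε => ?_) zero_le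
    obtain ⟨k, hk⟩ := ENNReal.exists_inv_nat_lt hε.ne'
    rw [zero_add]
    refine le_trans (measure_mono ?_) ((hOlt k).le.trans (le_trans ?_ hk.le))
    · rw [hF, Set.compl_iUnion]
      exact (Set.iInter_subset _ k).trans (by rw [compl_compl])
    · exact ENNReal.inv_le_inv.mpr le_self_add
  have hH := hasHeineSzego_indicator_iUnion hn (F := fun k => (O k)ᶜ)
    (fun k => (hOo k).isClosed_compl) 0 1
  rw [← hF] at hH
  set f : ℂ → ℂ := fun z => 0 + 1 * F.indicator (fun _ => 1) z with hf
  have hf1 : f =ᵐ[circleLaw] fun _ => 1 := by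
    have : ∀ᵐ z ∂circleLaw, z ∉ Fᶜ := measure_eq_zero_iff_ae_notMem.mp hnull
    filter_upwards [this] with z hz
    simp [hf, Set.notMem_compl_iff.mp hz]
  have hint := hH.integral_eq
  rw [circleToeplitz_congr hf1, circleToeplitz_one, det_one] at hint
  have hbd : ∀ U : unitaryGroup (Fin n) ℂ, ‖eigenvalueProd f U‖ ≤ 1 := fun U => by
    simpa using norm_eigenvalueProd_le (f := f) U 1 fun z _ => by
      simpa [f] using norm_add_mul_indicator_le F 0 1 z
  have hI : Integrable (fun U => eigenvalueProd f U) (cueMeasure n) :=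
    Integrable.of_bound hH.aestronglyMeasurable_prod 1 (Filter.Eventually.of_forall hbd)
  have hI2 : Integrable (fun U => 1 - (eigenvalueProd f U).re) (cueMeasure n) :=
    (integrable_const _).sub hI.re
  have hzero : ∫ U, (1 - (eigenvalueProd f U).re) ∂(cueMeasure n) = 0 := by
    have h1 : Integrable (fun U => (eigenvalueProd f U).re) (cueMeasure n) := hI.re
    have h2 : ∫ U, (eigenvalueProd f U).re ∂(cueMeasure n) =
      (∫ U, eigenvalueProd f U ∂(cueMeasure n)).re := integral_re hI
    rw [integral_sub (integrable_const _) h1, h2, hint]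
    simp
  have hae := (integral_eq_zero_iff_of_nonneg (fun U => by
    have := (Complex.re_le_norm (eigenvalueProd f U)).trans (hbd U)
    simpa using this) hI2).mp hzero
  filter_upwards [hae] with U hU z hz hzN
  have hzF : z ∉ F := by
    simp only [hF, Set.mem_iUnion, Set.mem_compl_iff, not_exists, not_not]
    exact fun k => hNO k hzN
  have h0 : eigenvalueProd f U = 0 := by
    rw [eigenvalueProd, Multiset.prod_eq_zero_iff, Multiset.mem_map]
    exact ⟨z, hz, by simp [hf, hzF]⟩
  simp [h0] at hU

/-- Up to a null set, `E` is a countable union of closed sets. Almost surely no eigenvalue lies in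
that null set, so replacing `E` changes neither side; the limit taken here is of a constant
sequence. -/
theorem hasHeineSzego_indicator (hn : 1 ≤ n) {E : Set ℂ} (hE : NullMeasurableSet E circleLaw)
    (a t : ℂ) : HasHeineSzego n fun z => a + t * E.indicator (fun _ => 1) z := by
  obtain ⟨E', hE'E, hE'm, hE'ae⟩ := hE.exists_measurable_subset_ae_eq
  have hK : ∀ k : ℕ, ∃ K ⊆ E', IsClosed K ∧ circleLaw (E' \ K) < ((k : ℝ≥0∞) + 1)⁻¹ := fun k =>
    hE'm.exists_isClosed_sdiff_lt (measure_ne_top _ _) (by simp)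
  choose K hKE hKc hKlt using hK
  set F : Set ℂ := ⋃ k, K k with hF
  have hFE : F ⊆ E := (Set.iUnion_subset hKE).trans hE'E
  have hnull : circleLaw (E \ F) = 0 := by
    have h1 : circleLaw (E' \ F) = 0 := by
      refine le_antisymm (le_of_forall_pos_le_add fun ε hε => ?_) zero_le
      obtain ⟨k, hk⟩ := ENNReal.exists_inv_nat_lt hε.ne'
      rw [zero_add]
      refine le_trans (measure_mono ?_) ((hKlt k).le.trans (le_trans ?_ hk.le))
      · exact Set.sdiff_subset_sdiff_right (Set.subset_iUnion K k)
      · exact ENNReal.inv_le_inv.mpr le_self_add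
    have h2 : circleLaw (E \ E') = 0 := ae_le_set.mp hE'ae.symm.le
    refine measure_mono_null (fun z hz => ?_) (measure_union_null h1 h2)
    by_cases hz' : z ∈ E'
    · exact Or.inl ⟨hz', hz.2⟩
    · exact Or.inr ⟨hz.1, hz'⟩
  have heq : ∀ z, z ∉ E \ F → F.indicator (fun _ => (1 : ℂ)) z = E.indicator (fun _ => 1) z := by
    intro z hz
    by_cases h : z ∈ F
    · rw [Set.indicator_of_mem h, Set.indicator_of_mem (hFE h)]
    · have : z ∉ E := fun h' => hz ⟨h', h⟩
      rw [Set.indicator_of_notMem h, Set.indicator_of_notMem this]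
  refine HasHeineSzego.of_tendsto
    (F := fun _ z => a + t * F.indicator (fun _ => 1) z)
    (fun _ => hasHeineSzego_indicator_iUnion hn hKc a t) (‖a‖ + ‖t‖)
    (fun k z _ => norm_add_mul_indicator_le _ _ _ _) ?_ ?_
  · filter_upwards [measure_eq_zero_iff_ae_notMem.mp hnull] with z hz
    rw [heq z hz]
    exact tendsto_const_nhds
  · filter_upwards [ae_roots_notMem hn hnull] with U hU
    rw [eigenvalueProd_congr U fun z hz => by rw [heq z (hU z hz)]]
    exact tendsto_const_nhds

end IndicatorWeights

/-! ### Generating functions of eigenvalue counts. -/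

section EigenvalueCounts

open Matrix

variable {n : ℕ}

open Classical in
/-- The number of eigenvalues of `U` in `E`, with multiplicity. -/
def eigenvalueCount (E : Set ℂ) (U : unitaryGroup (Fin n) ℂ) : ℕ :=
  (U : Matrix (Fin n) (Fin n) ℂ).charpoly.roots.countP fun z => z ∈ E

theorem eigenvalueProd_one_add_mul_indicator (E : Set ℂ) (t : ℂ) (U : unitaryGroup (Fin n) ℂ) :
    eigenvalueProd (fun z => 1 + t * E.indicator (fun _ => 1) z) U =
      (1 + t) ^ eigenvalueCount E U := by
  classical
  rw [eigenvalueProd, eigenvalueCount]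
  generalize (U : Matrix (Fin n) (Fin n) ℂ).charpoly.roots = s
  induction s using Multiset.induction_on with
  | empty => simp
  | cons a s ih =>
    rw [Multiset.map_cons, Multiset.prod_cons, ih]
    by_cases h : a ∈ E
    · rw [Multiset.countP_cons_of_pos _ h, pow_succ']
      simp [h]
    · rw [Multiset.countP_cons_of_neg _ h]
      simp [h]

theorem eigenvalueCount_le (E : Set ℂ) (U : unitaryGroup (Fin n) ℂ) :
    eigenvalueCount E U ≤ n := by
  classical
  exact (Multiset.countP_le_card _ _).trans (card_roots_charpoly U).le

/-- The eigenvalue product of `1 + 1_E` is `2` to the power of the count, and a binary logarithm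
recovers the count. -/
theorem aemeasurable_eigenvalueCount (hn : 1 ≤ n) {E : Set ℂ}
    (hE : NullMeasurableSet E circleLaw) :
    AEMeasurable (eigenvalueCount (n := n) E) (cueMeasure n) := by
  have h := (hasHeineSzego_indicator hn hE 1 1).aestronglyMeasurable_prod.aemeasurable
  have hg : Measurable fun z : ℂ => Nat.log 2 ⌊z.re⌋₊ :=
    (measurable_from_top (f := Nat.log 2)).comp (Nat.measurable_floor.comp Complex.measurable_re)
  refine (hg.comp_aemeasurable h).congr (Filter.Eventually.of_forall fun U => ?_)
  have h2 : ((1 : ℂ) + 1) ^ eigenvalueCount E U = ((2 ^ eigenvalueCount E U : ℕ) : ℂ) := by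
    push_cast
    norm_num
  simp only [Function.comp_apply]
  rw [eigenvalueProd_one_add_mul_indicator, h2, Complex.natCast_re, Nat.floor_natCast,
    Nat.log_pow one_lt_two]

theorem integral_pow_eigenvalueCount (hn : 1 ≤ n) {E : Set ℂ}
    (hE : NullMeasurableSet E circleLaw) (t : ℂ) :
    ∫ U, (1 + t) ^ eigenvalueCount E U ∂(cueMeasure n) =
      (1 + t • Matrix.of fun j k : Fin n =>
        ∫ z in E, z ^ (j : ℕ) * star z ^ (k : ℕ) ∂circleLaw).det := by
  have h := (hasHeineSzego_indicator hn hE 1 t).integral_eq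
  simp_rw [eigenvalueProd_one_add_mul_indicator] at h
  rw [h, ← circleToeplitz_one]
  congr 1
  ext j k
  simp only [circleToeplitz, of_apply, Matrix.add_apply, Matrix.smul_apply, smul_eq_mul]
  have hI : Integrable (fun z : ℂ => z ^ (j : ℕ) * star z ^ (k : ℕ)) circleLaw :=
    integrable_circleLaw_of_continuous (by fun_prop)
  rw [← integral_indicator₀ hE, ← integral_const_mul, ← integral_add (by simpa using hI)
    ((hI.indicator₀ hE).const_mul t)]
  congr 1
  ext z
  by_cases hz : z ∈ E
  · simp only [Set.indicator_of_mem hz]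
    ring
  · simp only [Set.indicator_of_notMem hz]
    ring

end EigenvalueCounts

/-! ### From points of the circle to angles, and rescaling. -/

section Angles

open Matrix

theorem measurable_principalAngle : Measurable principalAngle :=
  Measurable.ite (Complex.measurable_arg (measurableSet_singleton _)) measurable_const
    Complex.measurable_arg

theorem principalAngle_exp {θ : ℝ} (hθ : θ ∈ Set.Ico (-Real.pi) Real.pi) :
    principalAngle (Complex.exp (θ * Complex.I)) = θ := by
  rw [principalAngle]
  rcases eq_or_lt_of_le hθ.1 with h | h
  · have : (Complex.exp (θ * Complex.I)).arg = Real.pi := by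
      rw [← h]
      push_cast
      rw [neg_mul, Complex.exp_neg, Complex.exp_pi_mul_I]
      norm_num [Complex.arg_neg_one]
    rw [if_pos this, h]
  · have : (Complex.exp (θ * Complex.I)).arg = θ := by
      rw [Complex.arg_exp_mul_I, toIocMod_eq_self]
      exact ⟨h, by linarith [hθ.2]⟩
    rw [this, if_neg hθ.2.ne]

theorem nullMeasurableSet_principalAngle_preimage {A : Set ℝ}
    (hA : NullMeasurableSet A volume) : NullMeasurableSet (principalAngle ⁻¹' A) circleLaw := by
  have hq : Measure.QuasiMeasurePreserving principalAngle circleLaw volume := by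
    refine ⟨measurable_principalAngle, Measure.AbsolutelyContinuous.mk fun s hs h0 => ?_⟩
    rw [Measure.map_apply measurable_principalAngle hs,
      circleLaw_apply (measurable_principalAngle hs)]
    refine mul_eq_zero_of_right _ (measure_mono_null (fun θ hθ => ?_) h0)
    have := hθ.1
    rwa [Set.mem_ofPred_eq, Set.mem_preimage, principalAngle_exp hθ.2] at this
  exact hA.preimage hq

theorem setIntegral_principalAngle_preimage {A : Set ℝ} (hA : NullMeasurableSet A volume)
    (hAs : A ⊆ Set.Ico (-Real.pi) Real.pi) {f : ℂ → ℂ} (hf : Continuous f) :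
    ∫ z in principalAngle ⁻¹' A, f z ∂circleLaw =
      (1 / (2 * Real.pi) : ℝ) * ∫ θ in A, f (Complex.exp (θ * Complex.I)) := by
  have hE := nullMeasurableSet_principalAngle_preimage hA
  rw [← integral_indicator₀ hE, integral_circleLaw
    ((integrable_circleLaw_of_continuous hf).indicator₀ hE).aestronglyMeasurable]
  congr 1
  have h1 : ∀ θ ∈ Set.Ico (-Real.pi) Real.pi,
      (principalAngle ⁻¹' A).indicator f (Complex.exp (θ * Complex.I)) =
        A.indicator (fun θ : ℝ => f (Complex.exp (θ * Complex.I))) θ := by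
    intro θ hθ
    by_cases h : θ ∈ A
    · rw [Set.indicator_of_mem h, Set.indicator_of_mem]
      rwa [Set.mem_preimage, principalAngle_exp hθ]
    · rw [Set.indicator_of_notMem h, Set.indicator_of_notMem]
      rwa [Set.mem_preimage, principalAngle_exp hθ]
  rw [setIntegral_congr_fun measurableSet_Ico h1, ← integral_indicator measurableSet_Ico,
    ← integral_indicator₀ hA, Set.indicator_indicator, Set.inter_eq_self_of_subset_right hAs]

theorem eigenangleCount_eq {N : ℕ} (A : Set ℝ) (U : unitaryGroup (Fin N) ℂ) :
    eigenangleCount A U = eigenvalueCount (principalAngle ⁻¹' A) U := by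
  classical
  rw [eigenangleCount, eigenangles, eigenvalueCount, Multiset.countP_map,
    Multiset.countP_eq_card_filter]
  rfl

/-- The window `[-π/m, π/m)` is implied by `m φ ∈ A`, because `A` lies in `[-π, π)`. -/
theorem rescaledEigenangleCount_eq {N m : ℕ} (hm : 1 ≤ m) {A : Set ℝ}
    (hA : A ⊆ Set.Ico (-Real.pi) Real.pi) (U : unitaryGroup (Fin N) ℂ) :
    rescaledEigenangleCount m A U = eigenangleCount ((fun φ : ℝ => (m : ℝ) * φ) ⁻¹' A) U := by
  classical
  have hm' : (0 : ℝ) < m := by exact_mod_cast hm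
  rw [rescaledEigenangleCount, eigenangleCount]
  refine Multiset.countP_congr rfl fun φ _ => propext ⟨fun h => h.2, fun h => ⟨?_, h⟩⟩
  have h1 := hA h
  refine ⟨?_, ?_⟩
  · rw [neg_le_iff_add_nonneg, ← sub_neg_eq_add, sub_nonneg, neg_le_iff_add_nonneg, ← sub_neg_eq_add,
      sub_nonneg, ← neg_div, div_le_iff₀ hm']
    linarith [h1.1]
  · rw [lt_div_iff₀ hm']
    linarith [h1.2]

theorem preimage_mul_subset_Ico {m : ℕ} (hm : 1 ≤ m) {A : Set ℝ}
    (hA : A ⊆ Set.Ico (-Real.pi) Real.pi) :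
    (fun φ : ℝ => (m : ℝ) * φ) ⁻¹' A ⊆ Set.Ico (-Real.pi) Real.pi := by
  intro φ hφ
  have hm' : (1 : ℝ) ≤ m := by exact_mod_cast hm
  have h1 := hA hφ
  refine ⟨?_, ?_⟩
  · by_contra! h
    nlinarith [h1.1, Real.pi_pos]
  · by_contra! h
    nlinarith [h1.2, Real.pi_pos]

theorem nullMeasurableSet_preimage_mul {m : ℕ} (hm : 1 ≤ m) {A : Set ℝ}
    (hA : NullMeasurableSet A volume) :
    NullMeasurableSet ((fun φ : ℝ => (m : ℝ) * φ) ⁻¹' A) volume := by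
  have hm' : (m : ℝ) ≠ 0 := by positivity
  refine hA.preimage ⟨by fun_prop, ?_⟩
  rw [Real.map_volume_mul_left hm']
  exact Measure.smul_absolutelyContinuous

theorem setIntegral_preimage_mul {m : ℕ} (hm : 1 ≤ m) {A : Set ℝ}
    (hA : NullMeasurableSet A volume) (f : ℝ → ℂ) :
    ∫ φ in (fun φ : ℝ => (m : ℝ) * φ) ⁻¹' A, f φ = (1 / m : ℝ) * ∫ x in A, f (x / m) := by
  have hm' : (0 : ℝ) < m := by positivity
  rw [← integral_indicator₀ (nullMeasurableSet_preimage_mul hm hA), ← integral_indicator₀ hA]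
  have h := Measure.integral_comp_mul_left (A.indicator fun x => f (x / m)) (m : ℝ)
  rw [abs_of_pos (inv_pos.mpr hm'), Complex.real_smul, ← one_div] at h
  rw [← h]
  congr 1
  ext φ
  by_cases hφ : (m : ℝ) * φ ∈ A
  · rw [Set.indicator_of_mem hφ, Set.indicator_of_mem (by exact hφ),
      mul_div_cancel_left₀ _ hm'.ne']
  · rw [Set.indicator_of_notMem hφ, Set.indicator_of_notMem (by exact hφ)]

end Angles

/-! ### Total variation is at most the Wasserstein distance. -/

section TotalVariation

/-- Under any coupling the two probabilities differ by at most the mass where exactly one coordinate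
is in `S`. There the integers differ, hence by at least 1. -/
theorem ofReal_tvDist_le_wasserstein1 {Ω Ω' : Type*} [MeasurableSpace Ω] [MeasurableSpace Ω']
    (P : Measure Ω) [IsProbabilityMeasure P] (Q : Measure Ω') (X : Ω → ℤ) (Y : Ω' → ℤ) :
    ENNReal.ofReal (tvDist P Q X Y) ≤ wasserstein1 P Q X Y := by
  refine le_iInf fun γ => le_iInf fun h1 => le_iInf fun h2 => ?_
  have hγ : IsProbabilityMeasure γ := ⟨by
    have := h1.measure_mem_eq MeasurableSet.univ
    simpa using this⟩
  set c := ∫⁻ z, ENNReal.ofReal |(z.1 : ℝ) - (z.2 : ℝ)| ∂γ with hc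
  rcases eq_or_ne c ∞ with hct | hct
  · rw [hct]; exact le_top
  rw [ENNReal.ofReal_le_iff_le_toReal hct]
  refine ciSup_le fun S => ?_
  have hm1 : MeasurableSet ((fun z : ℤ × ℤ => z.1) ⁻¹' S) := measurable_fst (.of_discrete)
  have hm2 : MeasurableSet ((fun z : ℤ × ℤ => z.2) ⁻¹' S) := measurable_snd (.of_discrete)
  rw [measureReal_def, measureReal_def, ← h1.measure_mem_eq (.of_discrete),
    ← h2.measure_mem_eq (.of_discrete), ← measureReal_def, ← measureReal_def]
  refine (abs_measureReal_sub_le_measureReal_symmDiff hm1.nullMeasurableSet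
    hm2.nullMeasurableSet).trans ?_
  rw [measureReal_def]
  refine ENNReal.toReal_mono hct ?_
  rw [← lintegral_indicator_one (hm1.symmDiff hm2)]
  refine lintegral_mono fun z => ?_
  by_cases hz : z ∈ symmDiff ((fun z : ℤ × ℤ => z.1) ⁻¹' S) ((fun z : ℤ × ℤ => z.2) ⁻¹' S)
  · rw [Set.indicator_of_mem hz, Pi.one_apply, ENNReal.one_le_ofReal]
    have hne : z.1 - z.2 ≠ 0 := by
      intro h
      rw [sub_eq_zero] at h
      simp [Set.mem_symmDiff, h] at hz
    exact_mod_cast Int.one_le_abs hne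
  · rw [Set.indicator_of_notMem hz]
    exact zero_le

end TotalVariation

/-! ### Laws of counts from generating functions. -/

section GeneratingFunction

/-- Taking `1 + t` on the unit circle gives the characteristic functions. -/
theorem identDistrib_of_integral_pow_eq {Ω Ω' : Type*} [MeasurableSpace Ω] [MeasurableSpace Ω']
    {P : Measure Ω} [IsProbabilityMeasure P] {Q : Measure Ω'} [IsProbabilityMeasure Q]
    {X : Ω → ℕ} {Y : Ω' → ℕ} (hX : AEMeasurable X P) (hY : AEMeasurable Y Q)
    (h : ∀ t : ℂ, ∫ ω, (1 + t) ^ X ω ∂P = ∫ ω, (1 + t) ^ Y ω ∂Q) :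
    IdentDistrib (fun ω => (X ω : ℤ)) (fun ω => (Y ω : ℤ)) P Q := by
  have hcast : Measurable (Nat.cast : ℕ → ℝ) := measurable_from_top
  have hX' : AEMeasurable (fun ω => (X ω : ℝ)) P := hcast.comp_aemeasurable hX
  have hY' : AEMeasurable (fun ω => (Y ω : ℝ)) Q := hcast.comp_aemeasurable hY
  have key : IdentDistrib (fun ω => (X ω : ℝ)) (fun ω => (Y ω : ℝ)) P Q := by
    refine ⟨hX', hY', ?_⟩
    have := Measure.isProbabilityMeasure_map hX'
    have := Measure.isProbabilityMeasure_map hY'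
    refine Measure.ext_of_charFun ?_
    ext t
    rw [charFun_apply_real, charFun_apply_real,
      integral_map hX' (Continuous.aestronglyMeasurable (by fun_prop)),
      integral_map hY' (Continuous.aestronglyMeasurable (by fun_prop))]
    have h1 : ∀ k : ℕ, Complex.exp (t * (k : ℝ) * Complex.I) =
        (1 + (Complex.exp (t * Complex.I) - 1)) ^ k := by
      intro k
      rw [add_sub_cancel, ← Complex.exp_nat_mul]
      congr 1
      push_cast
      ring
    simp_rw [h1]
    exact h _
  have := key.comp (u := fun x : ℝ => ⌊x⌋) Int.measurable_floor
  convert this using 2 <;> simp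

end GeneratingFunction

/-! ### Coupling sums of Bernoulli variables through common uniforms. -/

section BernoulliCoupling

variable {ι : Type*} [Fintype ι]

/-- The uniform distribution on `[0, 1]`. -/
def unitLaw : Measure ℝ := volume.restrict (Set.Icc 0 1)

instance unitLaw_isProbabilityMeasure : IsProbabilityMeasure unitLaw := ⟨by simp [unitLaw]⟩

/-- The number of indices `i` with `u i ≤ p i`. For independent uniform `u i` this is a sum of
independent Bernoulli variables with parameters `p i`. -/
def bernoulliSum (p u : ι → ℝ) : ℕ := ∑ i, (Set.Iic (p i)).indicator (fun _ => 1) (u i)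

theorem measurable_bernoulliSum (p : ι → ℝ) : Measurable (bernoulliSum p) :=
  Finset.measurable_fun_sum _ fun i _ =>
    (measurable_const.indicator measurableSet_Iic).comp (measurable_pi_apply i)

theorem unitLaw_real_Iic {p : ℝ} (hp : p ∈ Set.Icc 0 1) : unitLaw.real (Set.Iic p) = p := by
  rw [measureReal_def, unitLaw, Measure.restrict_apply measurableSet_Iic]
  have : Set.Iic p ∩ Set.Icc 0 1 = Set.Icc 0 p := by
    ext x
    exact ⟨fun h => ⟨h.2.1, h.1⟩, fun h => ⟨h.2, h.1, h.2.trans hp.2⟩⟩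
  rw [this, Real.volume_Icc, sub_zero, ENNReal.toReal_ofReal hp.1]

theorem integral_pow_bernoulliSum (p : ι → ℝ) (hp : ∀ i, p i ∈ Set.Icc 0 1) (t : ℂ) :
    ∫ u, (1 + t) ^ bernoulliSum p u ∂(Measure.pi fun _ : ι => unitLaw) = ∏ i, (1 + t * p i) := by
  have h1 : ∀ u : ι → ℝ, (1 + t) ^ bernoulliSum p u =
      ∏ i, (1 + t * (Set.Iic (p i)).indicator (fun _ => (1 : ℂ)) (u i)) := by
    intro u
    rw [bernoulliSum, ← Finset.prod_pow_eq_pow_sum]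
    refine Finset.prod_congr rfl fun i _ => ?_
    by_cases h : u i ∈ Set.Iic (p i)
    · simp only [Set.indicator_of_mem h, pow_one, mul_one]
    · simp only [Set.indicator_of_notMem h, pow_zero, mul_zero, add_zero]
  simp_rw [h1]
  rw [integral_fintype_prod_eq_prod (μ := fun _ : ι => unitLaw)
    (f := fun i x => 1 + t * (Set.Iic (p i)).indicator (fun _ => (1 : ℂ)) x)]
  refine Finset.prod_congr rfl fun i _ => ?_
  have hI : Integrable ((Set.Iic (p i)).indicator fun _ => (1 : ℂ)) unitLaw :=
    (integrable_const _).indicator measurableSet_Iic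
  rw [integral_add (integrable_const _) (hI.const_mul t), integral_const_mul,
    integral_indicator_const _ measurableSet_Iic, unitLaw_real_Iic (hp i)]
  simp

/-- The two indicators at index `i` disagree only when `u i` falls between `p i` and `q i`, an event
of probability at most `|p i - q i|`. -/
theorem lintegral_bernoulliSum_sub_le (p q : ι → ℝ) :
    ∫⁻ u, ENNReal.ofReal |((bernoulliSum p u : ℤ) : ℝ) - ((bernoulliSum q u : ℤ) : ℝ)|
      ∂(Measure.pi fun _ : ι => unitLaw) ≤ ENNReal.ofReal (∑ i, |p i - q i|) := by
  have h1 : ∀ u : ι → ℝ,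
      ENNReal.ofReal |((bernoulliSum p u : ℤ) : ℝ) - ((bernoulliSum q u : ℤ) : ℝ)| ≤
        ∑ i, (Set.uIoc (p i) (q i)).indicator (fun _ => (1 : ℝ≥0∞)) (u i) := by
    intro u
    have h2 : |((bernoulliSum p u : ℤ) : ℝ) - ((bernoulliSum q u : ℤ) : ℝ)| ≤
        ∑ i, (Set.uIoc (p i) (q i)).indicator (fun _ => (1 : ℝ)) (u i) := by
      simp only [bernoulliSum, Nat.cast_sum, Int.cast_sum]
      rw [← Finset.sum_sub_distrib]
      refine (Finset.abs_sum_le_sum_abs _ _).trans (Finset.sum_le_sum fun i _ => ?_)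
      have hmem : u i ∈ Set.uIoc (p i) (q i) ↔
          (p i < u i ∧ u i ≤ q i) ∨ (q i < u i ∧ u i ≤ p i) := Set.mem_uIoc
      by_cases ha : u i ≤ p i <;> by_cases hb : u i ≤ q i <;>
        simp [hmem, ha, hb, not_lt.mpr, not_le.mp]
    refine (ENNReal.ofReal_le_ofReal h2).trans_eq ?_
    rw [ENNReal.ofReal_sum_of_nonneg fun i _ => Set.indicator_nonneg (fun _ _ => zero_le_one) _]
    refine Finset.sum_congr rfl fun i _ => ?_
    by_cases h : u i ∈ Set.uIoc (p i) (q i) <;> simp [h]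
  refine (lintegral_mono h1).trans ?_
  have hmeas : ∀ i, Measurable fun u : ι → ℝ =>
      (Set.uIoc (p i) (q i)).indicator (fun _ => (1 : ℝ≥0∞)) (u i) := fun i =>
    (measurable_const.indicator measurableSet_uIoc).comp (measurable_pi_apply i)
  rw [lintegral_finsetSum _ fun i _ => hmeas i,
    ENNReal.ofReal_sum_of_nonneg fun i _ => abs_nonneg _]
  refine Finset.sum_le_sum fun i _ => ?_
  have h3 := (measurePreserving_eval (fun _ : ι => unitLaw) i).lintegral_comp
    (f := (Set.uIoc (p i) (q i)).indicator fun _ => (1 : ℝ≥0∞))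
    (measurable_const.indicator measurableSet_uIoc)
  simp only [Function.eval] at h3
  rw [h3, lintegral_indicator_const measurableSet_uIoc, one_mul, unitLaw, abs_sub_comm,
    ← Real.volume_uIoc]
  exact Measure.restrict_apply_le _ _

theorem wasserstein1_le_of_integral_pow_eq {Ω Ω' : Type*} [MeasurableSpace Ω] [MeasurableSpace Ω']
    {P : Measure Ω} [IsProbabilityMeasure P] {Q : Measure Ω'} [IsProbabilityMeasure Q]
    {X : Ω → ℕ} {Y : Ω' → ℕ} (hX : AEMeasurable X P) (hY : AEMeasurable Y Q)
    {p q : ι → ℝ} (hp : ∀ i, p i ∈ Set.Icc 0 1) (hq : ∀ i, q i ∈ Set.Icc 0 1)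
    (hXp : ∀ t : ℂ, ∫ ω, (1 + t) ^ X ω ∂P = ∏ i, (1 + t * p i))
    (hYq : ∀ t : ℂ, ∫ ω, (1 + t) ^ Y ω ∂Q = ∏ i, (1 + t * q i)) :
    wasserstein1 P Q (fun ω => (X ω : ℤ)) (fun ω => (Y ω : ℤ)) ≤
      ENNReal.ofReal (∑ i, |p i - q i|) := by
  set π := Measure.pi fun _ : ι => unitLaw with hπ
  have h1 : IdentDistrib (fun u => (bernoulliSum p u : ℤ)) (fun ω => (X ω : ℤ)) π P :=
    identDistrib_of_integral_pow_eq (measurable_bernoulliSum p).aemeasurable hX fun t => by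
      rw [integral_pow_bernoulliSum p hp, hXp]
  have h2 : IdentDistrib (fun u => (bernoulliSum q u : ℤ)) (fun ω => (Y ω : ℤ)) π Q :=
    identDistrib_of_integral_pow_eq (measurable_bernoulliSum q).aemeasurable hY fun t => by
      rw [integral_pow_bernoulliSum q hq, hYq]
  have hcast : Measurable (Nat.cast : ℕ → ℤ) := measurable_from_top
  set Φ : (ι → ℝ) → ℤ × ℤ := fun u => (bernoulliSum p u, bernoulliSum q u) with hΦ
  have hΦm : Measurable Φ :=
    (hcast.comp (measurable_bernoulliSum p)).prodMk (hcast.comp (measurable_bernoulliSum q))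
  refine iInf_le_of_le (π.map Φ) (iInf_le_of_le ?_ (iInf_le_of_le ?_ ?_))
  · exact IdentDistrib.trans ⟨measurable_fst.aemeasurable, h1.aemeasurable_fst,
      by rw [Measure.map_map measurable_fst hΦm]; rfl⟩ h1
  · exact IdentDistrib.trans ⟨measurable_snd.aemeasurable, h2.aemeasurable_fst,
      by rw [Measure.map_map measurable_snd hΦm]; rfl⟩ h2
  · rw [lintegral_map (.of_discrete) hΦm]
    exact lintegral_bernoulliSum_sub_le p q

end BernoulliCoupling

/-! ### The Hoffman–Wielandt inequality. -/

section HoffmanWielandt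

open Matrix

variable {ι : Type*} [Fintype ι] [DecidableEq ι]

theorem Matrix.IsHermitian.eq_conj_diagonal {S : Matrix ι ι ℂ} (hS : S.IsHermitian) :
    S = (hS.eigenvectorUnitary : Matrix ι ι ℂ) * diagonal (fun i => (hS.eigenvalues i : ℂ)) *
      star (hS.eigenvectorUnitary : Matrix ι ι ℂ) := by
  conv_lhs => rw [hS.spectral_theorem, Unitary.conjStarAlgAut_apply]
  rfl

theorem Matrix.IsHermitian.det_one_add_smul {S : Matrix ι ι ℂ} (hS : S.IsHermitian) (t : ℂ) :
    (1 + t • S).det = ∏ i, (1 + t * hS.eigenvalues i) := by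
  set U := (hS.eigenvectorUnitary : Matrix ι ι ℂ) with hU
  have h1 : star U * U = 1 := Unitary.coe_star_mul_self _
  have h2 : t • S = U * ((t • diagonal fun i => (hS.eigenvalues i : ℂ)) * star U) := by
    conv_lhs => rw [hS.eq_conj_diagonal]
    rw [smul_mul_assoc, mul_smul_comm, mul_assoc]
  rw [h2, det_one_add_mul_comm, mul_assoc, h1, mul_one, ← diagonal_smul, ← diagonal_one,
    diagonal_add, det_diagonal]
  simp

theorem normSq_unitary_mem_doublyStochastic (W : unitaryGroup ι ℂ) :
    (Matrix.of fun i j => Complex.normSq ((W : Matrix ι ι ℂ) i j)) ∈ doublyStochastic ℝ ι := by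
  rw [mem_doublyStochastic_iff_sum]
  refine ⟨fun i j => Complex.normSq_nonneg _, fun i => ?_, fun j => ?_⟩
  · have h : ((W : Matrix ι ι ℂ) * star (W : Matrix ι ι ℂ)) i i = 1 := by
      have hW : (W : Matrix ι ι ℂ) * star (W : Matrix ι ι ℂ) = 1 := Unitary.coe_mul_star_self W
      rw [hW, one_apply_eq]
    rw [mul_apply] at h
    have h2 : ((∑ j, Complex.normSq ((W : Matrix ι ι ℂ) i j) : ℝ) : ℂ) = 1 := by
      rw [← h]
      push_cast
      exact Finset.sum_congr rfl fun j _ => (Complex.mul_conj _).symm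
    exact_mod_cast h2
  · have h : (star (W : Matrix ι ι ℂ) * (W : Matrix ι ι ℂ)) j j = 1 := by
      have hW : star (W : Matrix ι ι ℂ) * (W : Matrix ι ι ℂ) = 1 := Unitary.coe_star_mul_self W
      rw [hW, one_apply_eq]
    rw [mul_apply] at h
    have h2 : ((∑ i, Complex.normSq ((W : Matrix ι ι ℂ) i j) : ℝ) : ℂ) = 1 := by
      rw [← h]
      push_cast
      exact Finset.sum_congr rfl fun i _ => Complex.normSq_eq_conj_mul_self
    exact_mod_cast h2

/-- By Birkhoff's theorem `D` is a convex combination of permutation matrices, and a linear function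
is at one of them no larger than at `D`. -/
theorem exists_perm_sum_le_of_mem_doublyStochastic (c : ι → ι → ℝ) {D : Matrix ι ι ℝ}
    (hD : D ∈ doublyStochastic ℝ ι) :
    ∃ σ : Equiv.Perm ι, ∑ i, c i (σ i) ≤ ∑ i, ∑ j, c i j * D i j := by
  set f : Matrix ι ι ℝ →ₗ[ℝ] ℝ := ∑ i, ∑ j, c i j • Matrix.entryLinearMap ℝ ℝ i j with hf
  have hfa : ∀ M : Matrix ι ι ℝ, f M = ∑ i, ∑ j, c i j * M i j := by
    intro M
    simp [hf, LinearMap.sum_apply]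
  have hD' : D ∈ convexHull ℝ {x : Matrix ι ι ℝ | ∃ σ, Equiv.Perm.permMatrix ℝ σ = x} := by
    rw [← doublyStochastic_eq_convexHull_permMatrix]; exact hD
  obtain ⟨_, ⟨σ, rfl⟩, hσ⟩ := (f.concaveOn convex_univ).exists_le_of_mem_convexHull
    (Set.subset_univ _) hD'
  refine ⟨σ, ?_⟩
  rw [hfa, hfa] at hσ
  refine le_trans (le_of_eq ?_) hσ
  refine Finset.sum_congr rfl fun i _ => ?_
  simp [Equiv.Perm.permMatrix, PEquiv.toMatrix_apply]

/-- With `W` the change of basis between the eigenbases, `tr (S - T)²` is the sum of `(λ_i - μ_j)²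
|W_ij|²`, linear in the doubly stochastic matrix `|W_ij|²`. -/
theorem Matrix.IsHermitian.exists_perm_sum_sq_eigenvalues_sub_le {S T : Matrix ι ι ℂ}
    (hS : S.IsHermitian) (hT : T.IsHermitian) :
    ∃ σ : Equiv.Perm ι, ∑ i, (hS.eigenvalues i - hT.eigenvalues (σ i)) ^ 2 ≤
      ((S - T) * (S - T)).trace.re := by
  set U := hS.eigenvectorUnitary with hU
  set V := hT.eigenvectorUnitary with hV
  set W := star U * V with hW
  obtain ⟨σ, hσ⟩ := exists_perm_sum_le_of_mem_doublyStochastic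
    (fun i j => (hS.eigenvalues i - hT.eigenvalues j) ^ 2) (normSq_unitary_mem_doublyStochastic W)
  refine ⟨σ, hσ.trans_eq ?_⟩
  set D₁ : Matrix ι ι ℂ := diagonal fun i => (hS.eigenvalues i : ℂ)
  set D₂ : Matrix ι ι ℂ := diagonal fun i => (hT.eigenvalues i : ℂ)
  set Y : Matrix ι ι ℂ := D₁ * (W : Matrix ι ι ℂ) - (W : Matrix ι ι ℂ) * D₂ with hY
  have hUU : (U : Matrix ι ι ℂ) * star (U : Matrix ι ι ℂ) = 1 := Unitary.coe_mul_star_self _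
  have hUU' : star (U : Matrix ι ι ℂ) * (U : Matrix ι ι ℂ) = 1 := Unitary.coe_star_mul_self _
  have hVV : (V : Matrix ι ι ℂ) * star (V : Matrix ι ι ℂ) = 1 := Unitary.coe_mul_star_self _
  have hVV' : star (V : Matrix ι ι ℂ) * (V : Matrix ι ι ℂ) = 1 := Unitary.coe_star_mul_self _
  have hWc : (W : Matrix ι ι ℂ) = star (U : Matrix ι ι ℂ) * (V : Matrix ι ι ℂ) := rfl
  have hST : S - T = (U : Matrix ι ι ℂ) * Y * star (V : Matrix ι ι ℂ) := by
    have h1 : S = (U : Matrix ι ι ℂ) * D₁ * star (U : Matrix ι ι ℂ) := hS.eq_conj_diagonal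
    have h2 : T = (V : Matrix ι ι ℂ) * D₂ * star (V : Matrix ι ι ℂ) := hT.eq_conj_diagonal
    conv_lhs => rw [h1, h2]
    rw [hY, hWc]
    calc _ = (U : Matrix ι ι ℂ) * D₁ * star (U : Matrix ι ι ℂ) *
          ((V : Matrix ι ι ℂ) * star (V : Matrix ι ι ℂ)) -
          ((U : Matrix ι ι ℂ) * star (U : Matrix ι ι ℂ)) *
          ((V : Matrix ι ι ℂ) * D₂ * star (V : Matrix ι ι ℂ)) := by
          rw [hVV, hUU, mul_one, one_mul]
      _ = _ := by noncomm_ring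
  have hST' : S - T = (V : Matrix ι ι ℂ) * star Y * star (U : Matrix ι ι ℂ) := by
    have h1 : star (S - T) = S - T := (hS.sub hT)
    rw [← h1, hST]
    simp [star_mul, mul_assoc]
  have htr : ((S - T) * (S - T)).trace = (star Y * Y).trace := by
    nth_rewrite 1 [hST']
    rw [hST]
    calc _ = ((V : Matrix ι ι ℂ) * (star Y * (star (U : Matrix ι ι ℂ) * (U : Matrix ι ι ℂ)) * Y *
          star (V : Matrix ι ι ℂ))).trace := by congr 1; noncomm_ring
      _ = _ := by rw [trace_mul_comm, hUU', mul_one, mul_assoc, hVV', mul_one]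
  have hYij : ∀ i j, Y i j = ((hS.eigenvalues i - hT.eigenvalues j : ℝ) : ℂ) *
      (W : Matrix ι ι ℂ) i j := by
    intro i j
    simp only [hY, D₁, D₂, Matrix.sub_apply, diagonal_mul, mul_diagonal]
    push_cast
    ring
  rw [htr, trace, Complex.re_sum, Finset.sum_comm]
  refine Finset.sum_congr rfl fun j _ => ?_
  rw [diag_apply, mul_apply, Complex.re_sum]
  refine Finset.sum_congr rfl fun i _ => ?_
  have h1 : star Y j i * Y i j = (Complex.normSq (Y i j) : ℂ) :=
    Complex.normSq_eq_conj_mul_self.symm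
  rw [h1, Complex.ofReal_re, hYij, Complex.normSq_mul, Complex.normSq_ofReal, of_apply]
  ring

end HoffmanWielandt

/-! ### Wasserstein bound for counts with determinantal generating functions. -/

section CountComparison

open Matrix

variable {ι : Type*} [Fintype ι]

theorem integral_pow_pos {Ω : Type*} [MeasurableSpace Ω] {P : Measure Ω} [IsProbabilityMeasure P]
    {X : Ω → ℕ} (hX : AEMeasurable X P) {K : ℕ} (hK : ∀ ω, X ω ≤ K) {s : ℝ} (hs : 0 < s) :
    0 < ∫ ω, s ^ X ω ∂P := by
  have hm : AEStronglyMeasurable (fun ω => s ^ X ω) P :=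
    ((measurable_from_top (f := fun k : ℕ => s ^ k)).comp_aemeasurable hX).aestronglyMeasurable
  have hI : Integrable (fun ω => s ^ X ω) P := by
    refine Integrable.of_bound hm ((max s 1) ^ K) (Filter.Eventually.of_forall fun ω => ?_)
    rw [Real.norm_of_nonneg (by positivity)]
    exact (pow_le_pow_left₀ hs.le (le_max_left _ _) _).trans
      (pow_le_pow_right₀ (le_max_right _ _) (hK ω))
  rw [integral_pos_iff_support_of_nonneg (fun ω => by positivity) hI]
  have : Function.support (fun ω => s ^ X ω) = Set.univ := by
    ext ω
    simp [hs.ne']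
  rw [this, measure_univ]
  exact one_pos

/-- A parameter outside `[0, 1]` would give a zero at `t = -1 / p i`, where `1 + t > 0` and the
generating function is positive. So the eigenvalues are probabilities with no operator bound needed.
-/
theorem mem_Icc_of_integral_pow_eq_prod {Ω : Type*} [MeasurableSpace Ω] {P : Measure Ω}
    [IsProbabilityMeasure P] {X : Ω → ℕ} (hX : AEMeasurable X P) {K : ℕ} (hK : ∀ ω, X ω ≤ K)
    {p : ι → ℝ} (h : ∀ t : ℂ, ∫ ω, (1 + t) ^ X ω ∂P = ∏ i, (1 + t * p i)) (i : ι) :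
    p i ∈ Set.Icc 0 1 := by
  by_contra hi
  have hp : p i ≠ 0 := by
    rintro h0
    exact hi (by rw [h0]; simp)
  have hpos : 0 < 1 + -(p i)⁻¹ := by
    rw [Set.mem_Icc, not_and_or, not_le, not_le] at hi
    rcases hi with hi | hi
    · have := inv_lt_zero.mpr hi
      linarith
    · have := inv_lt_one_of_one_lt₀ hi
      linarith
  have h1 := h ((-(p i)⁻¹ : ℝ) : ℂ)
  have h2 : ∏ j, (1 + ((-(p i)⁻¹ : ℝ) : ℂ) * p j) = 0 := by
    refine Finset.prod_eq_zero (Finset.mem_univ i) ?_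
    push_cast
    rw [neg_mul, inv_mul_cancel₀ (by exact_mod_cast hp), add_neg_cancel]
  have h3 := integral_pow_pos hX hK hpos
  have h4 : ∫ ω, (1 + ((-(p i)⁻¹ : ℝ) : ℂ)) ^ X ω ∂P =
      ((∫ ω, (1 + -(p i)⁻¹) ^ X ω ∂P : ℝ) : ℂ) := by
    rw [← integral_complex_ofReal]
    push_cast
    rfl
  rw [h4, h2] at h1
  exact h3.ne' (by exact_mod_cast h1)

theorem wasserstein1_le_of_integral_pow_eq_det [DecidableEq ι] {Ω Ω' : Type*} [MeasurableSpace Ω]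
    [MeasurableSpace Ω'] {P : Measure Ω} [IsProbabilityMeasure P] {Q : Measure Ω'}
    [IsProbabilityMeasure Q] {X : Ω → ℕ} {Y : Ω' → ℕ} (hX : AEMeasurable X P)
    (hY : AEMeasurable Y Q) {K L : ℕ} (hK : ∀ ω, X ω ≤ K) (hL : ∀ ω, Y ω ≤ L)
    {S T : Matrix ι ι ℂ} (hS : S.IsHermitian) (hT : T.IsHermitian)
    (hXS : ∀ t : ℂ, ∫ ω, (1 + t) ^ X ω ∂P = (1 + t • S).det)
    (hYT : ∀ t : ℂ, ∫ ω, (1 + t) ^ Y ω ∂Q = (1 + t • T).det) :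
    wasserstein1 P Q (fun ω => (X ω : ℤ)) (fun ω => (Y ω : ℤ)) ≤
      ENNReal.ofReal (Real.sqrt (Fintype.card ι * ((S - T) * (S - T)).trace.re)) := by
  obtain ⟨σ, hσ⟩ := hS.exists_perm_sum_sq_eigenvalues_sub_le hT
  have hp : ∀ t : ℂ, ∫ ω, (1 + t) ^ X ω ∂P = ∏ i, (1 + t * hS.eigenvalues i) := fun t => by
    rw [hXS, hS.det_one_add_smul]
  have hq : ∀ t : ℂ, ∫ ω, (1 + t) ^ Y ω ∂Q = ∏ i, (1 + t * hT.eigenvalues (σ i)) := fun t => by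
    rw [hYT, hT.det_one_add_smul, Equiv.prod_comp σ fun i => 1 + t * (hT.eigenvalues i : ℂ)]
  refine (wasserstein1_le_of_integral_pow_eq hX hY (mem_Icc_of_integral_pow_eq_prod hX hK hp)
    (mem_Icc_of_integral_pow_eq_prod hY hL hq) hp hq).trans (ENNReal.ofReal_le_ofReal ?_)
  -- Cauchy–Schwarz passes from the sum of absolute differences to the sum of squares, at the cost
  -- of the matrix size.
  refine Real.le_sqrt_of_sq_le (sq_sum_le_card_mul_sum_sq.trans ?_)
  simp_rw [sq_abs]
  exact mul_le_mul_of_nonneg_left hσ (Nat.cast_nonneg _)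

end CountComparison

/-! ### Gram matrices of different sizes realised on one space. -/

section Gram

open Matrix
open scoped ComplexOrder MatrixOrder

variable {α ι κ : Type*} [MeasurableSpace α] {μ : Measure α}

/-- The Gram matrix of a family of functions in `L²(μ)`. -/
def gramMatrix (μ : Measure α) (h : ι → α → ℂ) : Matrix ι ι ℂ :=
  Matrix.of fun i j => ∫ x, star (h i x) * h j x ∂μ

variable [Fintype ι] [Fintype κ]

theorem posSemidef_gramMatrix {h : ι → α → ℂ}
    (hint : ∀ i j, Integrable (fun x => star (h i x) * h j x) μ) :
    (gramMatrix μ h).PosSemidef := by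
  refine PosSemidef.of_dotProduct_mulVec_nonneg ?_ fun v => ?_
  · ext i j
    simp only [conjTranspose_apply, gramMatrix, of_apply]
    rw [Complex.star_def, ← integral_conj]
    congr 1
    ext x
    simp [mul_comm]
  · have h1 : star v ⬝ᵥ gramMatrix μ h *ᵥ v =
        ∫ x, star (∑ i, h i x * v i) * ∑ j, h j x * v j ∂μ := by
      simp only [star_sum, Finset.sum_mul_sum, star_mul']
      simp only [dotProduct, mulVec, gramMatrix, of_apply, Finset.mul_sum, Pi.star_apply]
      have hI : ∀ i j, Integrable (fun x => star (h i x) * star (v i) * (h j x * v j)) μ :=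
        fun i j => ((hint i j).const_mul (star (v i) * v j)).congr
          (Filter.Eventually.of_forall fun x => by ring)
      rw [integral_finsetSum _ fun i _ => integrable_finsetSum _ fun j _ => hI i j]
      refine Finset.sum_congr rfl fun i _ => ?_
      rw [integral_finsetSum _ fun j _ => hI i j]
      refine Finset.sum_congr rfl fun j _ => ?_
      rw [← integral_mul_const, ← integral_const_mul]
      congr 1
      ext x
      ring
    have h2 : ∀ x, star (∑ i, h i x * v i) * ∑ j, h j x * v j =
        ((Complex.normSq (∑ i, h i x * v i) : ℝ) : ℂ) := fun x =>
      Complex.normSq_eq_conj_mul_self.symm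
    rw [h1]
    simp_rw [h2]
    rw [integral_complex_ofReal]
    exact Complex.zero_le_real.mpr (integral_nonneg fun x => Complex.normSq_nonneg _)

/-- The squared Hilbert–Schmidt norm of the kernel of a signed sum of rank-one operators, computed
from inner products. -/
theorem integral_integral_normSq_signed_sum [DecidableEq ι] {h : ι → α → ℂ}
    (hint : ∀ i j, Integrable (fun x => star (h i x) * h j x) μ) (ε : ι → ℝ) :
    ((∫ x, ∫ y, Complex.normSq (∑ i, ε i * h i x * star (h i y)) ∂μ ∂μ : ℝ) : ℂ) =
      (diagonal (fun i => (ε i : ℂ)) * gramMatrix μ h *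
        (diagonal (fun i => (ε i : ℂ)) * gramMatrix μ h)).trace := by
  have h1 : ∀ x y, ((Complex.normSq (∑ i, ε i * h i x * star (h i y)) : ℝ) : ℂ) =
      ∑ i, ∑ j, (ε i * ε j * (star (h j x) * h i x)) * (star (h i y) * h j y) := by
    intro x y
    rw [← Complex.mul_conj, map_sum, Finset.sum_mul_sum]
    refine Finset.sum_congr rfl fun i _ => Finset.sum_congr rfl fun j _ => ?_
    simp only [map_mul, Complex.conj_ofReal, Complex.star_def, Complex.conj_conj]
    ring
  have h2 : ∀ x, ((∫ y, Complex.normSq (∑ i, ε i * h i x * star (h i y)) ∂μ : ℝ) : ℂ) =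
      ∑ i, ∑ j, (ε i * ε j * gramMatrix μ h i j) * (star (h j x) * h i x) := by
    intro x
    rw [← integral_complex_ofReal]
    simp_rw [h1]
    rw [integral_finsetSum _ fun i _ => integrable_finsetSum _ fun j _ =>
      (hint i j).const_mul _]
    refine Finset.sum_congr rfl fun i _ => ?_
    rw [integral_finsetSum _ fun j _ => (hint i j).const_mul _]
    refine Finset.sum_congr rfl fun j _ => ?_
    rw [integral_const_mul, gramMatrix, of_apply]
    ring
  rw [← integral_complex_ofReal]
  simp_rw [h2]
  rw [integral_finsetSum _ fun i _ => integrable_finsetSum _ fun j _ =>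
    (hint j i).const_mul _]
  rw [trace]
  refine Finset.sum_congr rfl fun i _ => ?_
  rw [integral_finsetSum _ fun j _ => (hint j i).const_mul _, diag_apply, mul_apply]
  refine Finset.sum_congr rfl fun j _ => ?_
  rw [integral_const_mul, diagonal_mul, diagonal_mul]
  simp only [gramMatrix, of_apply]
  ring

/-- Factor the joint Gram matrix as `Rᴴ * R` and let `F`, `G` be the two column blocks of `R`. Then
`F * Fᴴ` and `G * Gᴴ` have the same size, and `det (1 + t F Fᴴ) = det (1 + t Fᴴ F)`. Their
difference is `R * D * Rᴴ` with `D` a diagonal of signs, so the trace of its square is the kernel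
integral. -/
theorem exists_isHermitian_of_gramMatrix [DecidableEq ι] [DecidableEq κ] {f : ι → α → ℂ}
    {g : κ → α → ℂ}
    (hint : ∀ i j, Integrable (fun x => star (Sum.elim f g i x) * Sum.elim f g j x) μ) :
    ∃ S T : Matrix (ι ⊕ κ) (ι ⊕ κ) ℂ, S.IsHermitian ∧ T.IsHermitian ∧
      (∀ t : ℂ, (1 + t • S).det = (1 + t • gramMatrix μ f).det) ∧
      (∀ t : ℂ, (1 + t • T).det = (1 + t • gramMatrix μ g).det) ∧
      ((S - T) * (S - T)).trace.re = ∫ x, ∫ y, Complex.normSq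
        (∑ i, f i x * star (f i y) - ∑ k, g k x * star (g k y)) ∂μ ∂μ := by
  obtain ⟨R, hR : _ = Rᴴ * R⟩ :=
    CStarAlgebra.nonneg_iff_eq_star_mul_self.mp (posSemidef_gramMatrix hint).nonneg
  set F : Matrix (ι ⊕ κ) ι ℂ := R.submatrix id Sum.inl with hF
  set G : Matrix (ι ⊕ κ) κ ℂ := R.submatrix id Sum.inr with hG
  have hFF : Fᴴ * F = gramMatrix μ f := by
    ext i j
    have := congrFun (congrFun hR (Sum.inl i)) (Sum.inl j)
    rw [mul_apply] at this ⊢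
    exact this.symm
  have hGG : Gᴴ * G = gramMatrix μ g := by
    ext i j
    have := congrFun (congrFun hR (Sum.inr i)) (Sum.inr j)
    rw [mul_apply] at this ⊢
    exact this.symm
  refine ⟨F * Fᴴ, G * Gᴴ, isHermitian_mul_conjTranspose_self F,
    isHermitian_mul_conjTranspose_self G, fun t => ?_, fun t => ?_, ?_⟩
  · rw [← hFF, ← Matrix.smul_mul, det_one_add_mul_comm, Matrix.mul_smul]
  · rw [← hGG, ← Matrix.smul_mul, det_one_add_mul_comm, Matrix.mul_smul]
  · set ε : ι ⊕ κ → ℝ := Sum.elim (fun _ => 1) fun _ => -1 with hε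
    set D : Matrix (ι ⊕ κ) (ι ⊕ κ) ℂ := diagonal fun i => (ε i : ℂ) with hD
    have hST : F * Fᴴ - G * Gᴴ = R * D * Rᴴ := by
      ext a b
      rw [Matrix.sub_apply, mul_apply, mul_apply, mul_apply, Fintype.sum_sum_type]
      simp [hD, hε, hF, hG, mul_diagonal, sub_eq_add_neg]
    have htr : ((F * Fᴴ - G * Gᴴ) * (F * Fᴴ - G * Gᴴ)).trace =
        (D * gramMatrix μ (Sum.elim f g) * (D * gramMatrix μ (Sum.elim f g))).trace := by
      rw [hST, hR]
      calc _ = (R * (D * (Rᴴ * R) * D * Rᴴ)).trace := by congr 1; simp only [mul_assoc]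
        _ = _ := by rw [trace_mul_comm]; congr 1; simp only [mul_assoc]
    rw [htr, hD, ← integral_integral_normSq_signed_sum hint ε, Complex.ofReal_re]
    congr 1
    ext x
    congr 1
    ext y
    congr 1
    rw [Fintype.sum_sum_type]
    simp [hε, sub_eq_add_neg]

end Gram

/-! ### Elementary estimates for the sine. -/

section KernelEstimate

/-- Equivalent to `3 y ≤ (3 + y²) sin y`, which follows from `sin y ≥ y - y³ / 6` as soon as `y² ≤
3`. -/
theorem inv_sin_sub_inv_le {y : ℝ} (hy : 0 < y) (hy2 : y ≤ Real.pi / 2) :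
    1 / Real.sin y - 1 / y ≤ y / 3 := by
  have hs : 0 < Real.sin y := Real.sin_pos_of_pos_of_lt_pi hy (by linarith [Real.pi_pos])
  have h1 := Real.sin_ge_sub_cube hy.le
  have h2 : y ^ 2 ≤ 3 := by nlinarith [Real.pi_lt_d2]
  rw [sub_le_iff_le_add, div_add_div _ _ (by norm_num) hy.ne', div_le_div_iff₀ hs (by positivity)]
  have h3 : (3 + y ^ 2) * (y - y ^ 3 / 6) ≤ (3 + y ^ 2) * Real.sin y :=
    mul_le_mul_of_nonneg_left h1 (by positivity)
  have h4 : 0 ≤ y ^ 3 * (3 - y ^ 2) := mul_nonneg (by positivity) (by linarith)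
  nlinarith

theorem sin_le_mul_sin_div {y : ℝ} (hy : 0 ≤ y) (hy2 : y ≤ Real.pi) {m : ℕ} (hm : 1 ≤ m) :
    Real.sin y ≤ m * Real.sin (y / m) := by
  have hm' : (1 : ℝ) ≤ m := by exact_mod_cast hm
  have hm0 : (0 : ℝ) < m := by linarith
  have ha : (0 : ℝ) ≤ 1 - 1 / m := by
    rw [sub_nonneg, div_le_one hm0]
    exact hm'
  have hb : (0 : ℝ) ≤ 1 / m := by positivity
  have h := strictConcaveOn_sin_Icc.concaveOn.2 (Set.left_mem_Icc.mpr Real.pi_pos.le)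
    (Set.mem_Icc.mpr ⟨hy, hy2⟩) ha hb (by ring)
  simp only [smul_eq_mul, mul_zero, Real.sin_zero, zero_add] at h
  rw [one_div_mul_eq_div, one_div_mul_eq_div, div_le_iff₀ hm0] at h
  linarith

/-- For positive `y`, `m sin (y / m)` lies between `sin y` (concavity) and `y`, so the difference is
at most `1 / sin y - 1 / y`, uniformly in `m`. -/
theorem abs_inv_sin_sub_le {y : ℝ} (hy : y ≠ 0) (hy2 : |y| ≤ Real.pi / 2) {m : ℕ} (hm : 1 ≤ m) :
    |1 / Real.sin y - 1 / (m * Real.sin (y / m))| ≤ |y| / 3 := by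
  wlog hpos : 0 < y with H
  · have hneg : 0 < -y := by
      rw [not_lt] at hpos
      exact neg_pos.mpr (lt_of_le_of_ne hpos hy)
    have h := H (neg_ne_zero.mpr hy) (by rwa [abs_neg]) hm hneg
    rw [abs_neg, neg_div, Real.sin_neg, Real.sin_neg, mul_neg, div_neg, div_neg, ← neg_add',
      abs_neg] at h
    convert h using 2
    ring
  · rw [abs_of_pos hpos] at hy2 ⊢
    have hm0 : (0 : ℝ) < m := by exact_mod_cast hm
    have hs : 0 < Real.sin y := Real.sin_pos_of_pos_of_lt_pi hpos (by linarith [Real.pi_pos])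
    have h1 : Real.sin y ≤ m * Real.sin (y / m) :=
      sin_le_mul_sin_div hpos.le (by linarith [Real.pi_pos]) hm
    have h2 : m * Real.sin (y / m) ≤ y := by
      have := Real.sin_le (x := y / m) (by positivity)
      rw [le_div_iff₀ hm0] at this
      linarith
    have h3 : 1 / (m * Real.sin (y / m)) ≤ 1 / Real.sin y := one_div_le_one_div_of_le hs h1
    have h4 : 1 / y ≤ 1 / (m * Real.sin (y / m)) := one_div_le_one_div_of_le (hs.trans_le h1) h2
    rw [abs_of_nonneg (sub_nonneg.mpr h3)]
    linarith [inv_sin_sub_inv_le hpos hy2]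

end KernelEstimate

/-! ### The projection kernels and their difference. -/

section Waves

/-- The functions `x ↦ exp (i (j - (N - 1) / 2) x / m) / √(2 π m)`, for `j < N`. -/
def wave (N m : ℕ) (j : Fin N) (x : ℝ) : ℂ :=
  Complex.exp ((((j : ℝ) - ((N : ℝ) - 1) / 2) * (x / m) : ℝ) * Complex.I) /
    (Real.sqrt (2 * Real.pi * m) : ℝ)

theorem continuous_wave (N m : ℕ) (j : Fin N) : Continuous (wave N m j) := by
  unfold wave
  fun_prop

theorem wave_mul_star_wave (N m : ℕ) (j k : Fin N) (x y : ℝ) :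
    wave N m j x * star (wave N m k y) =
      Complex.exp (((((j : ℝ) - ((N : ℝ) - 1) / 2) * (x / m) -
        ((k : ℝ) - ((N : ℝ) - 1) / 2) * (y / m) : ℝ) : ℂ) * Complex.I) / (2 * Real.pi * m) := by
  have hsq : ((Real.sqrt (2 * Real.pi * m) : ℝ) : ℂ) * (Real.sqrt (2 * Real.pi * m) : ℝ) =
      2 * Real.pi * m := by
    rw [← Complex.ofReal_mul, Real.mul_self_sqrt (by positivity)]
    push_cast
    ring
  have hstar : star (wave N m k y) =
      Complex.exp (-((((k : ℝ) - ((N : ℝ) - 1) / 2) * (y / m) : ℝ) : ℂ) * Complex.I) /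
        (Real.sqrt (2 * Real.pi * m) : ℝ) := by
    rw [wave, Complex.star_def, map_div₀, ← Complex.exp_conj, map_mul, Complex.conj_ofReal,
      Complex.conj_ofReal, Complex.conj_I, mul_neg, neg_mul]
  rw [hstar, wave, div_mul_div_comm, hsq, ← Complex.exp_add]
  congr 2
  push_cast
  ring

/-- Multiplication by `2 i sin d` telescopes the geometric sum. Because the frequencies are centred,
the kernel is real; without this, phases depending on `N` would spoil the comparison of the two
kernels. -/
theorem sum_wave_mul_star_wave (N m : ℕ) (hm : 1 ≤ m) (x y : ℝ)
    (hs : Real.sin ((x - y) / 2 / m) ≠ 0) :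
    ∑ j, wave N m j x * star (wave N m j y) =
      ((Real.sin (N * ((x - y) / 2 / m)) / (2 * Real.pi) *
        (1 / (m * Real.sin ((x - y) / 2 / m))) : ℝ) : ℂ) := by
  set d := (x - y) / 2 / m with hd
  have hm0 : (m : ℂ) ≠ 0 := by
    have : m ≠ 0 := by omega
    exact_mod_cast this
  have hpi : (Real.pi : ℂ) ≠ 0 := by exact_mod_cast Real.pi_ne_zero
  have hs' : (Real.sin d : ℂ) ≠ 0 := by exact_mod_cast hs
  have h2i : 2 * Complex.I * (Real.sin d : ℂ) =
      Complex.exp (d * Complex.I) - Complex.exp (-d * Complex.I) := by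
    have h := Complex.two_sin (d : ℂ)
    rw [Complex.ofReal_sin]
    linear_combination Complex.I * h + (Complex.exp (-d * Complex.I) -
      Complex.exp (d * Complex.I)) * Complex.I_sq
  have h2iN : 2 * Complex.I * (Real.sin (N * d) : ℂ) =
      Complex.exp (N * d * Complex.I) - Complex.exp (-(N * d) * Complex.I) := by
    have h := Complex.two_sin ((N : ℂ) * d)
    rw [Complex.ofReal_sin]
    push_cast
    linear_combination Complex.I * h + (Complex.exp (-(N * d) * Complex.I) -
      Complex.exp (N * d * Complex.I)) * Complex.I_sq
  have hterm : ∀ j : Fin N, wave N m j x * star (wave N m j y) =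
      Complex.exp ((2 * (j : ℂ) - N + 1) * d * Complex.I) / (2 * Real.pi * m) := by
    intro j
    rw [wave_mul_star_wave, hd]
    congr 2
    push_cast
    ring
  have htel : (∑ j : Fin N, Complex.exp ((2 * (j : ℂ) - N + 1) * d * Complex.I)) *
      (2 * Complex.I * (Real.sin d : ℂ)) = 2 * Complex.I * (Real.sin (N * d) : ℂ) := by
    rw [h2i, h2iN, Finset.sum_mul]
    have h1 : ∀ j : Fin N, Complex.exp ((2 * (j : ℂ) - N + 1) * d * Complex.I) *
        (Complex.exp (d * Complex.I) - Complex.exp (-d * Complex.I)) =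
        Complex.exp ((2 * (((j : ℕ) + 1 : ℕ) : ℂ) - N) * d * Complex.I) -
          Complex.exp ((2 * ((j : ℕ) : ℂ) - N) * d * Complex.I) := by
      intro j
      rw [mul_sub, ← Complex.exp_add, ← Complex.exp_add]
      congr 2 <;> push_cast <;> ring
    rw [Finset.sum_congr rfl fun j _ => h1 j,
      Fin.sum_univ_eq_sum_range (fun j : ℕ =>
        Complex.exp ((2 * ((j + 1 : ℕ) : ℂ) - N) * d * Complex.I) -
          Complex.exp ((2 * (j : ℂ) - N) * d * Complex.I)) N,
      Finset.sum_range_sub fun j : ℕ => Complex.exp ((2 * (j : ℂ) - N) * d * Complex.I)]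
    congr 2 <;> push_cast <;> ring
  have hsum : ∑ j : Fin N, Complex.exp ((2 * (j : ℂ) - N + 1) * d * Complex.I) =
      (Real.sin (N * d) : ℂ) / Real.sin d := by
    rw [eq_div_iff hs']
    refine mul_left_cancel₀ (mul_ne_zero two_ne_zero Complex.I_ne_zero) ?_
    rw [← htel]
    ring
  rw [Finset.sum_congr rfl fun j _ => hterm j, ← Finset.sum_div, hsum]
  push_cast
  field_simp

theorem sum_wave_mul_star_wave_self (N m : ℕ) (x : ℝ) :
    ∑ j, wave N m j x * star (wave N m j x) = N / (2 * Real.pi * m) := by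
  have h : ∀ j : Fin N, wave N m j x * star (wave N m j x) = 1 / (2 * Real.pi * m) := by
    intro j
    rw [wave_mul_star_wave, sub_self]
    simp
  rw [Finset.sum_congr rfl fun j _ => h j, Finset.sum_const, Finset.card_univ, Fintype.card_fin,
    nsmul_eq_mul, mul_one_div]

theorem norm_sum_wave_sub_sum_wave_le {n m : ℕ} (hm : 1 ≤ m) {x y : ℝ}
    (hxy : |x - y| ≤ Real.pi) :
    ‖∑ j, wave n 1 j x * star (wave n 1 j y) -
      ∑ k, wave (m * n) m k x * star (wave (m * n) m k y)‖ ≤ |x - y| / (12 * Real.pi) := by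
  have hm0 : (0 : ℝ) < m := by exact_mod_cast hm
  rcases eq_or_ne x y with rfl | hne
  · have hmc : (m : ℂ) ≠ 0 := by exact_mod_cast hm0.ne'
    have hpi : (Real.pi : ℂ) ≠ 0 := by exact_mod_cast Real.pi_ne_zero
    rw [sum_wave_mul_star_wave_self, sum_wave_mul_star_wave_self]
    have : (n : ℂ) / (2 * Real.pi * (1 : ℕ)) - ((m * n : ℕ) : ℂ) / (2 * Real.pi * m) = 0 := by
      push_cast
      field_simp
      ring
    rw [this, sub_self, norm_zero, abs_zero, zero_div]
  · set y' := (x - y) / 2 with hy'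
    have hy0 : y' ≠ 0 := div_ne_zero (sub_ne_zero.mpr hne) two_ne_zero
    have habs : |y'| = |x - y| / 2 := by rw [hy', abs_div, abs_two]
    have hy2 : |y'| ≤ Real.pi / 2 := by rw [habs]; linarith
    have hsin : ∀ z : ℝ, z ≠ 0 → |z| ≤ Real.pi / 2 → Real.sin z ≠ 0 := by
      intro z hz hz2 h
      rw [Real.sin_eq_zero_iff_of_lt_of_lt] at h
      · exact hz h
      · linarith [neg_le_of_abs_le hz2, Real.pi_pos]
      · linarith [le_of_abs_le hz2, Real.pi_pos]
    have hm1 : |y' / m| ≤ Real.pi / 2 := by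
      rw [abs_div, abs_of_pos hm0]
      exact (div_le_self (abs_nonneg _) (by exact_mod_cast hm)).trans hy2
    have h1 := sum_wave_mul_star_wave n 1 le_rfl x y (by
      rw [Nat.cast_one, div_one]; exact hsin _ hy0 hy2)
    have h2 := sum_wave_mul_star_wave (m * n) m hm x y (hsin _ (div_ne_zero hy0 hm0.ne') hm1)
    rw [h1, h2, ← Complex.ofReal_sub, Complex.norm_real, Real.norm_eq_abs, ← hy']
    -- The frequency `m n` at scale `1 / m` gives both kernels the same numerator `sin (n y')`; only
    -- the denominators differ.
    have h3 : ((m * n : ℕ) : ℝ) * (y' / m) = n * y' := by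
      push_cast
      field_simp
    rw [h3, Nat.cast_one, div_one, one_mul, ← mul_sub, abs_mul]
    have h4 := abs_inv_sin_sub_le hy0 hy2 hm
    have h5 : |Real.sin (n * y') / (2 * Real.pi)| ≤ 1 / (2 * Real.pi) := by
      rw [abs_div, abs_of_pos (by positivity : 0 < 2 * Real.pi)]
      exact div_le_div_of_nonneg_right (Real.abs_sin_le_one _) (by positivity)
    calc _ ≤ 1 / (2 * Real.pi) * (|y'| / 3) :=
          mul_le_mul h5 h4 (abs_nonneg _) (by positivity)
      _ = |x - y| / (12 * Real.pi) := by
          rw [habs]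
          field_simp
          norm_num

end Waves

/-! ### Determinantal formula for the counts and the final estimate. -/

section CountGeneratingFunction

open Matrix

/-- The centring of the frequencies cancels in each Gram entry, which leaves `exp (i (k - j) x / m)
/ (2 π m)`: the transposed Toeplitz entry after the substitution `x = m φ`. -/
theorem integral_pow_eigenangleCount {N m : ℕ} (hN : 1 ≤ N) (hm : 1 ≤ m) {A : Set ℝ}
    (hA : NullMeasurableSet A volume) (hAs : A ⊆ Set.Ico (-Real.pi) Real.pi) (t : ℂ) :
    ∫ U : unitaryGroup (Fin N) ℂ, (1 + t) ^ eigenangleCount ((fun φ : ℝ => (m : ℝ) * φ) ⁻¹' A) U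
        ∂cueMeasure N =
      (1 + t • gramMatrix (volume.restrict A) (wave N m)).det := by
  have hA' := nullMeasurableSet_preimage_mul hm hA
  simp_rw [eigenangleCount_eq]
  rw [integral_pow_eigenvalueCount hN (nullMeasurableSet_principalAngle_preimage hA'),
    ← det_transpose]
  congr 1
  rw [transpose_add, transpose_one, transpose_smul]
  congr 2
  ext j k
  rw [transpose_apply, of_apply, setIntegral_principalAngle_preimage hA'
    (preimage_mul_subset_Ico hm hAs) (by fun_prop), setIntegral_preimage_mul hm hA, gramMatrix,
    of_apply, ← mul_assoc, ← integral_const_mul]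
  congr 1
  ext x
  rw [mul_comm (star _), wave_mul_star_wave, Complex.star_def, ← Complex.exp_conj,
    ← Complex.exp_nat_mul, ← Complex.exp_nat_mul, ← Complex.exp_add, div_eq_mul_inv, mul_comm]
  have hm0 : (m : ℂ) ≠ 0 := by
    have : m ≠ 0 := by omega
    exact_mod_cast this
  congr 1
  · congr 1
    simp
    ring
  · push_cast
    field_simp

theorem aemeasurable_eigenangleCount {N : ℕ} (hN : 1 ≤ N) {A : Set ℝ}
    (hA : NullMeasurableSet A volume) :
    AEMeasurable (eigenangleCount (N := N) A) (cueMeasure N) :=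
  (aemeasurable_eigenvalueCount hN (nullMeasurableSet_principalAngle_preimage hA)).congr
    (Filter.Eventually.of_forall fun U => (eigenangleCount_eq A U).symm)

theorem eigenangleCount_le {N : ℕ} (A : Set ℝ) (U : unitaryGroup (Fin N) ℂ) :
    eigenangleCount A U ≤ N := by
  rw [eigenangleCount_eq]
  exact eigenvalueCount_le _ _

theorem ProbabilityTheory.HasLaw.integral_pow_eigenangleCount {Ω : Type*} [MeasurableSpace Ω]
    {P : Measure Ω} {N m : ℕ} {U : Ω → unitaryGroup (Fin N) ℂ} (hU : HasLaw U (cueMeasure N) P)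
    (hN : 1 ≤ N) (hm : 1 ≤ m) {A : Set ℝ} (hA : NullMeasurableSet A volume)
    (hAs : A ⊆ Set.Ico (-Real.pi) Real.pi) (t : ℂ) :
    ∫ ω, (1 + t) ^ eigenangleCount ((fun φ : ℝ => (m : ℝ) * φ) ⁻¹' A) (U ω) ∂P =
      (1 + t • gramMatrix (volume.restrict A) (wave N m)).det := by
  rw [← _root_.integral_pow_eigenangleCount hN hm hA hAs t]
  have h1 := aemeasurable_eigenangleCount hN (nullMeasurableSet_preimage_mul hm hA)
  have h2 : AEStronglyMeasurable (fun V : unitaryGroup (Fin N) ℂ =>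
      (1 + t) ^ eigenangleCount ((fun φ : ℝ => (m : ℝ) * φ) ⁻¹' A) V) (cueMeasure N) :=
    ((measurable_from_top (f := fun k : ℕ => (1 + t) ^ k)).comp_aemeasurable
      h1).aestronglyMeasurable
  rw [← hU.map_eq] at h2 ⊢
  exact (integral_map hU.aemeasurable h2).symm

theorem wasserstein1_eigenangleCount_le {Ω Ω' : Type*} [MeasurableSpace Ω] [MeasurableSpace Ω']
    {P : Measure Ω} [IsProbabilityMeasure P] {Q : Measure Ω'} [IsProbabilityMeasure Q]
    {m n : ℕ} (hm : 1 ≤ m) (hn : 1 ≤ n)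
    {U : Ω → Matrix.unitaryGroup (Fin n) ℂ} (hU : HasLaw U (cueMeasure n) P)
    {V : Ω' → Matrix.unitaryGroup (Fin (m * n)) ℂ} (hV : HasLaw V (cueMeasure (m * n)) Q)
    {A : Set ℝ} (hA : A ⊆ Set.Ico (-Real.pi) Real.pi) (hA_meas : NullMeasurableSet A volume)
    (hdiam : Metric.diam A ≤ Real.pi) :
    wasserstein1 P Q (fun ω => (eigenangleCount A (U ω) : ℤ))
        (fun ω => (eigenangleCount ((fun φ : ℝ => (m : ℝ) * φ) ⁻¹' A) (V ω) : ℤ)) ≤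
      ENNReal.ofReal (Real.sqrt (m * n) * volume.real A * Metric.diam A / (6 * Real.pi)) := by
  have hmn : 1 ≤ m * n := Nat.mul_pos hm hn
  have hbdd : Bornology.IsBounded A := (Metric.isBounded_Ico _ _).subset hA
  have hfin : volume A < ∞ := (measure_mono hA).trans_lt measure_Ico_lt_top
  have : IsFiniteMeasure (volume.restrict A) := ⟨by simpa using hfin⟩
  have hcont : ∀ i : Fin n ⊕ Fin (m * n),
      Continuous (Sum.elim (wave n 1) (wave (m * n) m) i) := by
    rintro (i | i)
    · exact continuous_wave _ _ _
    · exact continuous_wave _ _ _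
  have hint : ∀ i j, Integrable (fun x => star (Sum.elim (wave n 1) (wave (m * n) m) i x) *
      Sum.elim (wave n 1) (wave (m * n) m) j x) (volume.restrict A) := by
    intro i j
    have hc : Continuous fun x => star (Sum.elim (wave n 1) (wave (m * n) m) i x) *
      Sum.elim (wave n 1) (wave (m * n) m) j x := (hcont i).star.mul (hcont j)
    exact (hc.integrableOn_Icc (a := -Real.pi) (b := Real.pi)).mono_set
      (hA.trans Set.Ico_subset_Icc_self)
  obtain ⟨S, T, hS, hT, hSdet, hTdet, htr⟩ := exists_isHermitian_of_gramMatrix hint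
  -- The unscaled count is treated as the rescaled one with factor 1, so one formula covers both
  -- matrices.
  have hcount : ∀ W : unitaryGroup (Fin n) ℂ, eigenangleCount A W =
      eigenangleCount ((fun φ : ℝ => ((1 : ℕ) : ℝ) * φ) ⁻¹' A) W := fun W => by simp
  have hmU : AEMeasurable (fun ω => eigenangleCount A (U ω)) P := by
    have h1 := aemeasurable_eigenangleCount hn hA_meas
    rw [← hU.map_eq] at h1
    exact h1.comp_aemeasurable hU.aemeasurable
  have hmV : AEMeasurable
      (fun ω => eigenangleCount ((fun φ : ℝ => (m : ℝ) * φ) ⁻¹' A) (V ω)) Q := by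
    have h1 := aemeasurable_eigenangleCount hmn (nullMeasurableSet_preimage_mul hm hA_meas)
    rw [← hV.map_eq] at h1
    exact h1.comp_aemeasurable hV.aemeasurable
  refine (wasserstein1_le_of_integral_pow_eq_det hmU hmV (fun ω => eigenangleCount_le _ _)
    (fun ω => eigenangleCount_le _ _) hS hT (fun t => ?_) fun t => ?_).trans
    (ENNReal.ofReal_le_ofReal ?_)
  · simp_rw [hcount]
    rw [hU.integral_pow_eigenangleCount hn le_rfl hA_meas hA, hSdet]
  · rw [hV.integral_pow_eigenangleCount hmn hm hA_meas hA, hTdet]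
  set c := Metric.diam A / (12 * Real.pi) with hc
  have hc0 : 0 ≤ c := div_nonneg Metric.diam_nonneg (by positivity)
  have hk : ∀ x ∈ A, ∀ y ∈ A, ‖Complex.normSq
      (∑ i, wave n 1 i x * star (wave n 1 i y) -
        ∑ k, wave (m * n) m k x * star (wave (m * n) m k y))‖ ≤ c ^ 2 := by
    intro x hx y hy
    have hd : |x - y| ≤ Metric.diam A := by
      rw [← Real.dist_eq]
      exact Metric.dist_le_diam_of_mem hbdd hx hy
    rw [Complex.normSq_eq_norm_sq, norm_pow, norm_norm]
    refine pow_le_pow_left₀ (norm_nonneg _)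
      ((norm_sum_wave_sub_sum_wave_le hm (hd.trans hdiam)).trans ?_) 2
    exact div_le_div_of_nonneg_right hd (by positivity)
  have hin : ∀ x ∈ A, ‖∫ y in A, Complex.normSq
      (∑ i, wave n 1 i x * star (wave n 1 i y) -
        ∑ k, wave (m * n) m k x * star (wave (m * n) m k y))‖ ≤ c ^ 2 * volume.real A :=
    fun x hx => norm_setIntegral_le_of_norm_le_const hfin (hk x hx)
  have htr' : ((S - T) * (S - T)).trace.re ≤ (c * volume.real A) ^ 2 := by
    rw [htr]
    refine (Real.le_norm_self _).trans
      ((norm_setIntegral_le_of_norm_le_const hfin hin).trans_eq ?_)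
    ring
  -- The size is `n + m n ≤ 2 m n`; the weaker factor 4 has square root 2, which turns `1 / (12 π)`
  -- into the stated `1 / (6 π)`.
  have hcard : ((Fintype.card (Fin n ⊕ Fin (m * n)) : ℕ) : ℝ) ≤ 4 * (m * n) := by
    rw [Fintype.card_sum, Fintype.card_fin, Fintype.card_fin]
    push_cast
    have h1 : (1 : ℝ) ≤ m := by exact_mod_cast hm
    nlinarith [(Nat.cast_nonneg n : (0 : ℝ) ≤ n)]
  calc _ ≤ Real.sqrt (4 * (m * n) * (c * volume.real A) ^ 2) := by
        refine Real.sqrt_le_sqrt ?_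
        exact (mul_le_mul_of_nonneg_left htr' (Nat.cast_nonneg _)).trans
          (mul_le_mul_of_nonneg_right hcard (sq_nonneg _))
    _ = 2 * Real.sqrt (m * n) * (c * volume.real A) := by
        rw [Real.sqrt_mul (by positivity), Real.sqrt_sq (mul_nonneg hc0 measureReal_nonneg),
          Real.sqrt_mul (by norm_num)]
        congr 2
        rw [show (4 : ℝ) = 2 ^ 2 by norm_num, Real.sqrt_sq (by norm_num)]
    _ = _ := by
        rw [hc]
        field_simp
        ring

end CountGeneratingFunction

end

theorem theorem1 {Ω Ω' : Type*} [MeasurableSpace Ω] [MeasurableSpace Ω']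
    (P : Measure Ω) [IsProbabilityMeasure P] (Q : Measure Ω') [IsProbabilityMeasure Q]
    (m n : ℕ) (hm : 1 ≤ m) (hn : 1 ≤ n)
    (U : Ω → Matrix.unitaryGroup (Fin n) ℂ) (hU : HasLaw U (cueMeasure n) P)
    (V : Ω' → Matrix.unitaryGroup (Fin (m * n)) ℂ) (hV : HasLaw V (cueMeasure (m * n)) Q)
    (A : Set ℝ) (hA : A ⊆ Set.Ico (-Real.pi) Real.pi) (hA_meas : NullMeasurableSet A volume)
    (hdiam : Metric.diam A ≤ Real.pi) :
    ENNReal.ofReal (tvDist P Q (fun ω => (eigenangleCount A (U ω) : ℤ))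
        (fun ω => (rescaledEigenangleCount m A (V ω) : ℤ))) ≤
      wasserstein1 P Q (fun ω => (eigenangleCount A (U ω) : ℤ))
        (fun ω => (rescaledEigenangleCount m A (V ω) : ℤ)) ∧
    wasserstein1 P Q (fun ω => (eigenangleCount A (U ω) : ℤ))
        (fun ω => (rescaledEigenangleCount m A (V ω) : ℤ)) ≤
      ENNReal.ofReal (Real.sqrt (m * n) * volume.real A * Metric.diam A / (6 * Real.pi)) := by
  refine ⟨ofReal_tvDist_le_wasserstein1 P Q _ _, ?_⟩
  simp_rw [rescaledEigenangleCount_eq hm hA]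
  exact wasserstein1_eigenangleCount_le hm hn hU hV hA hA_meas hdiam
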